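/- Let $n\in\mathbb N$, let $k$ be a field, let $\hat O=k[[x]]=k[[x_1,\dots,x_n]]$, let $O_{\mathrm{alg}}=k[x]_{(x)}$ be the localization of $k[x]$ at the origin and, when $k=\mathbb C$, let $\mathcal O_0$ be the ring of convergent power series; all are regarded as subrings of $\hat O$. For $C\in\{k[x],O_{\mathrm{alg}},\mathcal O_0,\hat O\}$ let $D_C$ be the ring of differential operators generated by $C$ and commuting symbols $\partial_1,\dots,\partial_n$ with relations $\partial_i c-c\,\partial_i=\partial c/\partial x_i$, and let $h(D_C)$ be the $k$-algebra generated by $C$, the $\partial_i$ and a central variable $h$ with relations $\partial_i c-c\,\partial_i=(\partial c/\partial x_i)\,h$. Write $D=D_{k[x]}$, $D_{\mathrm{alg}}=D_{O_{\mathrm{alg}}}$, $\mathcal D_0=D_{\mathcal O_0}$, $\hat D=D_{\hat O}$. Ideals of $D_C$ and $h(D_C)$ are left ideals. For $P=\sum c_{\alpha\beta}x^\alpha\partial^\beta$ with $d=\max\{|\beta| : c_{\alpha\beta}\neq0 \text{ for some } \alpha\}$ put $h(P)=\sum c_{\alpha\beta}x^\alpha\partial^\beta h^{d-|\beta|}$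 (and $h(0)=0$); for an ideal $I$ of $D_C$ let $h(I)$ be the ideal of $h(D_C)$ generated by all $h(P)$, $P\in I$. Let $U_{\mathrm{loc}}=\{u\in\mathbb R^n : u_i\le0\ \forall i\}$ and $W_{\mathrm{loc}}=\{(u,v)\in\mathbb R^{2n} : u_i\le 0,\ u_i+v_i\ge0\ \forall i\}$. A weight $u$ gives $x^\alpha$ the weight $u\cdot\alpha$, and a weight $w=(u,v)$ gives $x^\alpha\partial^\beta$, respectively $x^\alpha\partial^\beta h^j$, the weight $u\cdot\alpha+v\cdot\beta$. The initial form $\mathrm{in}_w(P)$ is the sum of the terms of $P$ of maximal weight, $\mathrm{gr}^w(R)$ is the graded ring of the associated weight filtration of the ring $R$, and for an ideal $I$ of $R$, $\mathrm{in}_w(I)\subset\mathrm{gr}^w(R)$ is the graded ideal of $I$ for the induced filtration, spanned by the $\mathrm{in}_w(P)$, $P\in I$. Elements of $\mathrm{gr}^w(R)$ are identified with finite sums of initial forms of elements of $R$, so that graded rings and initial ideals for different $w$ can be compared. For a weight space $\Omega$ ($U_{\mathrm{loc}}$ if $R\subset \hat O$, $W_{\mathrm{loc}}$ otherwise) the Gröbner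 cone of $I$ at $w\in\Omega$ is the set of $w'\in\Omega$ such that $\mathrm{gr}^{w}(R)=\mathrm{gr}^{w'}(R)$ (same elements and same multiplication) and $\mathrm{in}_w(I)=\mathrm{in}_{w'}(I)$. The (open) Gröbner fan $\mathcal E(I,\Omega)$ is the set of all Gröbner cones of $I$ at points $w\in\Omega$. Then: 1. For every ideal $I$ of $O_{\mathrm{alg}}$: $\mathcal E(I,U_{\mathrm{loc}})=\mathcal E(\hat O I,U_{\mathrm{loc}})$. If $k=\mathbb C$, the same holds for every ideal $I$ of $\mathcal O_0$. 2. For every ideal $I$ of $D_{\mathrm{alg}}$: $\mathcal E(I,W_{\mathrm{loc}})=\mathcal E(\hat D I,W_{\mathrm{loc}})$. If $k=\mathbb C$, the same holds for every ideal $I$ of $\mathcal D_0$. 3. For every ideal $I$ of $D_{\mathrm{alg}}$: $\mathcal E(h(I),W_{\mathrm{loc}})=\mathcal E(h(\hat D I),W_{\mathrm{loc}})$. If $k=\mathbb C$, the same holds for every ideal $I$ of $\mathcal D_0$. 4. Consequently, for every ideal $I$ of $k[x]$: $\mathcal E(O_{\mathrm{alg}}I,U_{\mathrm{loc}})=\mathcal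 E(\hat O I,U_{\mathrm{loc}})$, and both equal $\mathcal E(\mathcal O_0 I,U_{\mathrm{loc}})$ if $k=\mathbb C$. For every ideal $I$ of $D$: $\mathcal E(D_{\mathrm{alg}}I,W_{\mathrm{loc}})=\mathcal E(\hat D I,W_{\mathrm{loc}})$, and both equal $\mathcal E(\mathcal D_0 I,W_{\mathrm{loc}})$ if $k=\mathbb C$. -/

import Mathlib

open scoped Polynomial

noncomputable section

namespace LocalGroebner

open scoped Classical in
/-- The power series whose coefficients at exponents in `s` are those of `f`, the others zero. -/
def seriesPart {k : Type*} [Semiring k] {n : ℕ} (s : Set (Fin n →₀ ℕ))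
    (f : MvPowerSeries (Fin n) k) : MvPowerSeries (Fin n) k :=
  fun α => if α ∈ s then MvPowerSeries.coeff α f else 0

open scoped Classical in
theorem coeff_seriesPart {k : Type*} [Semiring k] {n : ℕ} (s : Set (Fin n →₀ ℕ))
    (f : MvPowerSeries (Fin n) k) (α : Fin n →₀ ℕ) :
    MvPowerSeries.coeff α (seriesPart s f) = if α ∈ s then MvPowerSeries.coeff α f else 0 := rfl

theorem seriesPart_zero {k : Type*} [Semiring k] {n : ℕ} (s : Set (Fin n →₀ ℕ)) :
    seriesPart s (0 : MvPowerSeries (Fin n) k) = 0 := by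
  ext α
  simp [coeff_seriesPart]

/-! ### Rings of differential operators

Given commuting `k`-derivations `δ 0, …, δ (n-1)` of a commutative `k`-algebra `A`,
`DiffOp δ` is the `k`-algebra generated by `A` and by commuting symbols `∂ 0, …, ∂ (n-1)` with the
relations `∂ i * c = c * ∂ i + δ i c` for `c` in `A`. An element is stored as its unique
normal form `∑ c_β ∂^β`, that is, as the finitely supported function `β ↦ c_β`. -/

section DiffOp

variable {k A : Type*} [CommRing k] [CommRing A] [Algebra k A] {n : ℕ}

/-- Operators `∑ c_β ∂^β` with coefficients `c_β` in `A`. -/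
def DiffOp (_δ : Fin n → Derivation k A A) : Type _ := (Fin n →₀ ℕ) →₀ A

namespace DiffOp

instance (δ : Fin n → Derivation k A A) : AddCommGroup (DiffOp δ) :=
  inferInstanceAs (AddCommGroup ((Fin n →₀ ℕ) →₀ A))

instance (δ : Fin n → Derivation k A A) : Module A (DiffOp δ) :=
  inferInstanceAs (Module A ((Fin n →₀ ℕ) →₀ A))

instance (δ : Fin n → Derivation k A A) : Module k (DiffOp δ) :=
  inferInstanceAs (Module k ((Fin n →₀ ℕ) →₀ A))

instance (δ : Fin n → Derivation k A A) : IsScalarTower k A (DiffOp δ) :=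
  inferInstanceAs (IsScalarTower k A ((Fin n →₀ ℕ) →₀ A))

/-- The normal form of an operator, as a function `β ↦ c_β`. -/
def normalForm (δ : Fin n → Derivation k A A) : DiffOp δ ≃ₗ[A] ((Fin n →₀ ℕ) →₀ A) :=
  LinearEquiv.refl A ((Fin n →₀ ℕ) →₀ A)

/-- The operator `a ∂^β`. -/
def mono (δ : Fin n → Derivation k A A) (β : Fin n →₀ ℕ) (a : A) : DiffOp δ :=
  (normalForm δ).symm (Finsupp.single β a)

theorem mono_add (δ : Fin n → Derivation k A A) (β : Fin n →₀ ℕ) (a b : A) :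
    mono δ β (a + b) = mono δ β a + mono δ β b := by
  simp [mono]

theorem mono_smul (δ : Fin n → Derivation k A A) (β : Fin n →₀ ℕ) (a b : A) :
    a • mono δ β b = mono δ β (a * b) := by
  simp only [mono, ← map_smul, Finsupp.smul_single, smul_eq_mul]

theorem induction_mono {δ : Fin n → Derivation k A A} {p : DiffOp δ → Prop} (P : DiffOp δ)
    (zero : p 0) (add : ∀ P Q, p P → p Q → p (P + Q)) (single : ∀ β a, p (mono δ β a)) : p P :=
  Finsupp.induction_linear (motive := p) P zero add single

/-- The operator `a ∂^β`, linearly in `a`. -/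
def monoHom (δ : Fin n → Derivation k A A) (β : Fin n →₀ ℕ) : A →ₗ[k] DiffOp δ :=
  ((normalForm δ).symm.toLinearMap ∘ₗ Finsupp.lsingle β).restrictScalars k

theorem monoHom_apply (δ : Fin n → Derivation k A A) (β : Fin n →₀ ℕ) (a : A) :
    monoHom δ β a = mono δ β a := rfl

/-- The linear map with `a ∂^β ↦ f β a`. -/
def lift {N : Type*} [AddCommGroup N] [Module k N] (δ : Fin n → Derivation k A A)
    (f : (Fin n →₀ ℕ) → A →ₗ[k] N) : DiffOp δ →ₗ[k] N :=
  Finsupp.lsum k f ∘ₗ (normalForm δ).toLinearMap.restrictScalars k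

theorem lift_mono {N : Type*} [AddCommGroup N] [Module k N] (δ : Fin n → Derivation k A A)
    (f : (Fin n →₀ ℕ) → A →ₗ[k] N) (β : Fin n →₀ ℕ) (a : A) :
    lift δ f (mono δ β a) = f β a := by
  simp [lift, mono]

/-- Left multiplication by `∂ i` on normal forms:
`∂ i * (b ∂^γ) = b ∂^(γ + e_i) + δ i b ∂^γ`. -/
def derivAct (δ : Fin n → Derivation k A A) (i : Fin n) : Module.End k (DiffOp δ) :=
  lift δ fun γ => monoHom δ (γ + Finsupp.single i 1) + monoHom δ γ ∘ₗ (δ i : A →ₗ[k] A)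

theorem derivAct_mono (δ : Fin n → Derivation k A A) (i : Fin n) (γ : Fin n →₀ ℕ) (b : A) :
    derivAct δ i (mono δ γ b) = mono δ (γ + Finsupp.single i 1) b + mono δ γ (δ i b) := by
  rw [derivAct, lift_mono]
  rfl

theorem derivAct_smul (δ : Fin n → Derivation k A A) (i : Fin n) (a : A) (P : DiffOp δ) :
    derivAct δ i (a • P) = a • derivAct δ i P + δ i a • P := by
  induction P using induction_mono with
  | zero => simp
  | add P Q hP hQ => rw [smul_add, map_add, hP, hQ, map_add, smul_add, smul_add]; abel
  | single β b =>
    simp only [mono_smul, derivAct_mono, smul_add, Derivation.leibniz, smul_eq_mul, mono_add]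
    rw [mul_comm b, add_assoc]

variable (δ : Fin n → Derivation k A A) [hδ : Fact (∀ i j a, δ i (δ j a) = δ j (δ i a))]

theorem derivAct_commute (i j : Fin n) : Commute (derivAct δ i) (derivAct δ j) := by
  refine LinearMap.ext fun P => ?_
  induction P using induction_mono with
  | zero => simp
  | add P Q hP hQ => rw [map_add, map_add, hP, hQ]
  | single β b =>
    simp only [Module.End.mul_apply, derivAct_mono, map_add, hδ.out i j b]
    rw [add_right_comm β]
    abel

/-- Left multiplication by `∂^β` on normal forms. -/
def powAct (β : Fin n →₀ ℕ) : Module.End k (DiffOp δ) :=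
  ((Finsupp.toMultiset β).map (derivAct δ)).noncommProd (by
    rintro _ hx _ hy -
    obtain ⟨i, -, rfl⟩ := Multiset.mem_map.1 hx
    obtain ⟨j, -, rfl⟩ := Multiset.mem_map.1 hy
    exact derivAct_commute δ i j)

theorem powAct_zero : powAct δ 0 = 1 := by
  simp [powAct]

theorem powAct_add_single (β : Fin n →₀ ℕ) (i : Fin n) :
    powAct δ (β + Finsupp.single i 1) = derivAct δ i * powAct δ β := by
  rw [add_comm]
  simp [powAct]

/-- Left multiplication by an operator on normal forms:
`(∑ c_β ∂^β) * Q = ∑ c_β • (∂^β * Q)`. -/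
def act : DiffOp δ →ₗ[k] Module.End k (DiffOp δ) :=
  lift δ fun β =>
    LinearMap.mulRight k (powAct δ β) ∘ₗ (Algebra.lsmul k k (DiffOp δ) : A →ₐ[k] _).toLinearMap

theorem act_mono (β : Fin n →₀ ℕ) (a : A) (Q : DiffOp δ) :
    act δ (mono δ β a) Q = a • powAct δ β Q := by
  rw [act, lift_mono]
  rfl

theorem act_smul (a : A) (P Q : DiffOp δ) : act δ (a • P) Q = a • act δ P Q := by
  induction P using induction_mono with
  | zero => simp
  | add P P' hP hP' => simp only [smul_add, map_add, LinearMap.add_apply, hP, hP']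
  | single β b => rw [mono_smul, act_mono, act_mono, mul_smul]

theorem act_derivAct (i : Fin n) (P Q : DiffOp δ) :
    act δ (derivAct δ i P) Q = derivAct δ i (act δ P Q) := by
  induction P using induction_mono with
  | zero => simp
  | add P P' hP hP' => simp only [map_add, LinearMap.add_apply, hP, hP']
  | single β b =>
    rw [derivAct_mono, map_add, LinearMap.add_apply, act_mono, act_mono, act_mono, derivAct_smul,
      powAct_add_single, Module.End.mul_apply]

theorem induction_exponent {p : (Fin n →₀ ℕ) → Prop} (β : Fin n →₀ ℕ) (zero : p 0)
    (add : ∀ β i, p β → p (β + Finsupp.single i 1)) : p β := by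
  suffices h : ∀ γ, p γ → p (γ + β) by simpa using h 0 zero
  induction β using Finsupp.induction_linear with
  | zero => simp
  | add f g hf hg => exact fun γ h => add_assoc γ f g ▸ hg _ (hf _ h)
  | single i m =>
    induction m with
    | zero => simp
    | succ m ih =>
      intro γ h
      rw [Finsupp.single_add, ← add_assoc]
      exact add _ i (ih γ h)

theorem act_powAct (β : Fin n →₀ ℕ) (P Q : DiffOp δ) :
    act δ (powAct δ β P) Q = powAct δ β (act δ P Q) := by
  induction β using induction_exponent with
  | zero => simp [powAct_zero]
  | add β i h =>
    rw [powAct_add_single, Module.End.mul_apply, Module.End.mul_apply, act_derivAct, h]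

theorem powAct_one (β : Fin n →₀ ℕ) : powAct δ β (mono δ 0 1) = mono δ β 1 := by
  induction β using induction_exponent with
  | zero => simp [powAct_zero]
  | add β i h =>
    rw [powAct_add_single, Module.End.mul_apply, h, derivAct_mono]
    simp [mono]

theorem act_assoc (P Q R : DiffOp δ) : act δ (act δ P Q) R = act δ P (act δ Q R) := by
  induction P using induction_mono with
  | zero => simp
  | add P P' hP hP' => simp only [map_add, LinearMap.add_apply, hP, hP']
  | single β b => rw [act_mono, act_mono, act_smul, act_powAct]

theorem act_one (P : DiffOp δ) : act δ P (mono δ 0 1) = P := by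
  induction P using induction_mono with
  | zero => simp
  | add P P' hP hP' => simp only [map_add, LinearMap.add_apply, hP, hP']
  | single β b => rw [act_mono, powAct_one, mono_smul, mul_one]

instance : Ring (DiffOp δ) where
  __ := (inferInstance : AddCommGroup (DiffOp δ))
  mul P Q := act δ P Q
  one := mono δ 0 1
  left_distrib P Q R := map_add (act δ P) Q R
  right_distrib P Q R := by
    change act δ (P + Q) R = _
    rw [map_add]
    rfl
  zero_mul P := by
    change act δ 0 P = 0
    simp
  mul_zero P := map_zero (act δ P)
  mul_assoc := act_assoc δ
  one_mul P := by
    change act δ (mono δ 0 1) P = P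
    rw [act_mono, powAct_zero, one_smul]
    rfl
  mul_one := act_one δ

theorem mul_def (P Q : DiffOp δ) : P * Q = act δ P Q := rfl

instance : Algebra k (DiffOp δ) :=
  Algebra.ofModule
    (fun r P Q => by rw [mul_def, map_smul, LinearMap.smul_apply, mul_def])
    (fun r P Q => by rw [mul_def, map_smul, mul_def])

/-- An element of `A` as an operator of order zero. -/
def coe (a : A) : DiffOp δ := mono δ 0 a

/-- The generator `∂ i`. -/
def del (i : Fin n) : DiffOp δ := mono δ (Finsupp.single i 1) 1

theorem coe_mul (a b : A) : coe δ (a * b) = coe δ a * coe δ b := by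
  rw [mul_def, coe, coe, coe, act_mono, powAct_zero, Module.End.one_apply, mono_smul]

/-- The defining commutation relation. -/
theorem del_mul_coe (i : Fin n) (a : A) :
    del δ i * coe δ a = coe δ a * del δ i + coe δ (δ i a) := by
  have h := powAct_add_single δ 0 i
  rw [zero_add, powAct_zero, mul_one] at h
  rw [mul_def, mul_def, del, coe, coe, act_mono, act_mono, one_smul, h, derivAct_mono, powAct_zero,
    Module.End.one_apply, mono_smul, mul_one, zero_add]

/-- `∂ i * ∂ j = ∂ j * ∂ i`. -/
theorem del_mul_del (i j : Fin n) : del δ i * del δ j = del δ j * del δ i := by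
  have h : ∀ i, powAct δ (Finsupp.single i 1) = derivAct δ i := fun i => by
    have h := powAct_add_single δ 0 i
    rwa [zero_add, powAct_zero, mul_one] at h
  rw [mul_def, mul_def, del, del, act_mono, act_mono, one_smul, one_smul, h, h, derivAct_mono,
    derivAct_mono, add_comm (Finsupp.single i 1)]
  simp [mono]

end DiffOp

end DiffOp

/-! ### The operators with formal power series coefficients, and their homogenization -/

section Operators

variable (k : Type*) [Field k] (n : ℕ)

/-- `k[[x_1, …, x_n]]`. -/
abbrev Series : Type _ := MvPowerSeries (Fin n) k

/-- The subrings of `k[[x_1, …, x_n]]` containing `k`. -/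
abbrev SeriesRing : Type _ := Subalgebra k (Series k n)

/-- The partial derivatives on `k[[x]]`. -/
def partials (i : Fin n) : Derivation k (Series k n) (Series k n) := MvPowerSeries.pderiv k i

theorem partials_comm (i j : Fin n) (f : Series k n) :
    partials k n i (partials k n j f) = partials k n j (partials k n i f) := by
  rcases eq_or_ne i j with rfl | h
  · rfl
  ext α
  simp only [partials, MvPowerSeries.coeff_pderiv, Finsupp.add_apply, Finsupp.single_apply, if_neg h,
    if_neg h.symm, add_zero]
  rw [add_right_comm]
  ring

instance : Fact (∀ i j f, partials k n i (partials k n j f) = partials k n j (partials k n i f)) :=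
  ⟨partials_comm k n⟩

/-- The derivations `h · ∂/∂x_i` of `k[[x]][h]`, where `h` is the polynomial variable. -/
def hPartials (i : Fin n) : Derivation k (Series k n)[X] (Series k n)[X] :=
  (Polynomial.X : (Series k n)[X]) •
    (PolynomialModule.equivPolynomialSelf (R := Series k n)).toLinearMap.compDer
      (partials k n i).mapCoeffs

theorem hPartials_apply (i : Fin n) (p : (Series k n)[X]) :
    hPartials k n i p =
      Polynomial.X * PolynomialModule.equivPolynomialSelf ((partials k n i).mapCoeffs p) := rfl

theorem coeff_hPartials_zero (i : Fin n) (p : (Series k n)[X]) :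
    (hPartials k n i p).coeff 0 = 0 := by
  rw [hPartials_apply, Polynomial.mul_coeff_zero, Polynomial.coeff_X_zero, zero_mul]

theorem coeff_hPartials_succ (i : Fin n) (p : (Series k n)[X]) (j : ℕ) :
    (hPartials k n i p).coeff (j + 1) = partials k n i (p.coeff j) := by
  rw [hPartials_apply, Polynomial.coeff_X_mul]
  rfl

instance : Fact (∀ i j p, hPartials k n i (hPartials k n j p) =
    hPartials k n j (hPartials k n i p)) := ⟨fun i j p => by
  ext1 m
  rcases m with _ | _ | m <;>
    simp only [coeff_hPartials_zero, coeff_hPartials_succ, map_zero, zero_add,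
      partials_comm k n i j]⟩

/-- The ring of differential operators with coefficients in `k[[x]]`. -/
abbrev Dhat : Type _ := DiffOp (partials k n)

/-- The homogenized ring: generated over `k` by `k[[x]]`, the `∂_i` and a central
variable `h`, with `∂_i c - c ∂_i = (∂c/∂x_i) h`. -/
abbrev HDhat : Type _ := DiffOp (hPartials k n)

/-- The coefficient of `x^α ∂^β`. -/
def opCoeff (P : Dhat k n) (m : (Fin n →₀ ℕ) × (Fin n →₀ ℕ)) : k :=
  MvPowerSeries.coeff m.1 (DiffOp.normalForm _ P m.2)

/-- The coefficient of `x^α ∂^β h^j`. -/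
def hopCoeff (P : HDhat k n) (m : (Fin n →₀ ℕ) × (Fin n →₀ ℕ) × ℕ) : k :=
  MvPowerSeries.coeff m.1 ((DiffOp.normalForm _ P m.2.1).coeff m.2.2)

/-- The operator obtained by keeping only the terms `c x^α ∂^β` with `(α, β) ∈ s`. -/
def opPart (s : Set ((Fin n →₀ ℕ) × (Fin n →₀ ℕ))) (P : Dhat k n) : Dhat k n :=
  ∑ β ∈ (DiffOp.normalForm _ P).support,
    DiffOp.mono _ β (seriesPart {α | (α, β) ∈ s} (DiffOp.normalForm _ P β))

/-- The operator obtained by keeping only the terms `c x^α ∂^β h^j` with `(α, β, j) ∈ s`. -/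
def hopPart (s : Set ((Fin n →₀ ℕ) × (Fin n →₀ ℕ) × ℕ)) (P : HDhat k n) : HDhat k n :=
  ∑ β ∈ (DiffOp.normalForm _ P).support,
    DiffOp.mono _ β (∑ j ∈ (DiffOp.normalForm _ P β).support,
      Polynomial.monomial j
        (seriesPart {α | (α, β, j) ∈ s} ((DiffOp.normalForm _ P β).coeff j)))

open scoped Classical in
theorem opCoeff_opPart (s : Set ((Fin n →₀ ℕ) × (Fin n →₀ ℕ))) (P : Dhat k n)
    (m : (Fin n →₀ ℕ) × (Fin n →₀ ℕ)) :
    opCoeff k n (opPart k n s P) m = if m ∈ s then opCoeff k n P m else 0 := by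
  obtain ⟨α, β⟩ := m
  simp only [opCoeff, opPart, DiffOp.mono, map_sum, LinearEquiv.apply_symm_apply,
    Finsupp.finsetSum_apply]
  rw [Finset.sum_eq_single β]
  · simp [coeff_seriesPart]
  · intro γ _ h
    rw [Finsupp.single_eq_of_ne h.symm, map_zero]
  · intro h
    rw [Finsupp.notMem_support_iff.1 h, seriesPart_zero]
    simp

open scoped Classical in
theorem hopCoeff_hopPart (s : Set ((Fin n →₀ ℕ) × (Fin n →₀ ℕ) × ℕ)) (P : HDhat k n)
    (m : (Fin n →₀ ℕ) × (Fin n →₀ ℕ) × ℕ) :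
    hopCoeff k n (hopPart k n s P) m = if m ∈ s then hopCoeff k n P m else 0 := by
  obtain ⟨α, β, j⟩ := m
  simp only [hopCoeff, hopPart, DiffOp.mono, map_sum, LinearEquiv.apply_symm_apply,
    Finsupp.finsetSum_apply]
  rw [Finset.sum_eq_single β]
  · rw [Finsupp.single_eq_same, Polynomial.finsetSum_coeff, Finset.sum_eq_single j]
    · simp [coeff_seriesPart]
    · intro l _ h
      rw [Polynomial.coeff_monomial, if_neg h]
    · intro h
      rw [Polynomial.notMem_support_iff.1 h, seriesPart_zero]
      simp
  · intro γ _ h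
    rw [Finsupp.single_eq_of_ne h.symm]
  · intro h
    rw [Finsupp.notMem_support_iff.1 h]
    simp

end Operators

/-! ### Initial forms, graded rings and Gröbner fans

The three rings `k[[x]]`, `Dhat`, `HDhat` are treated together: each has coefficients indexed
by a set `M` of monomials, and allows one to keep the terms in a given set of monomials. -/

/-- Expansions of the elements of `X` in monomials indexed by `M`, with coefficients in `k`. -/
structure Expansion (k X M : Type*) [Field k] [Ring X] where
  coeff : X → M → k
  coeff_add : ∀ P Q, coeff (P + Q) = coeff P + coeff Q
  coeff_injective : Function.Injective coeff
  /-- keep the terms whose monomial lies in the given set, and drop the others -/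
  part : Set M → X → X
  coeff_part_of_mem : ∀ s P m, m ∈ s → coeff (part s P) m = coeff P m
  coeff_part_of_notMem : ∀ s P m, m ∉ s → coeff (part s P) m = 0

/-- `f = ∑ c_α x^α`. -/
def seriesExpansion (k : Type*) [Field k] (n : ℕ) :
    Expansion k (Series k n) (Fin n →₀ ℕ) where
  coeff f α := MvPowerSeries.coeff α f
  coeff_add P Q := by ext; simp
  coeff_injective P Q h := by
    ext α
    exact congrFun h α
  part := seriesPart
  coeff_part_of_mem s P m h := by rw [coeff_seriesPart, if_pos h]
  coeff_part_of_notMem s P m h := by rw [coeff_seriesPart, if_neg h]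

/-- `P = ∑ c_{α,β} x^α ∂^β`. -/
def opExpansion (k : Type*) [Field k] (n : ℕ) :
    Expansion k (Dhat k n) ((Fin n →₀ ℕ) × (Fin n →₀ ℕ)) where
  coeff := opCoeff k n
  coeff_add P Q := by ext; simp [opCoeff]
  coeff_injective P Q h := by
    apply (DiffOp.normalForm _).injective
    ext β α
    exact congrFun h (α, β)
  part := opPart k n
  coeff_part_of_mem s P m h := by rw [opCoeff_opPart, if_pos h]
  coeff_part_of_notMem s P m h := by rw [opCoeff_opPart, if_neg h]

/-- `P = ∑ c_{α,β,j} x^α ∂^β h^j`. -/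
def hopExpansion (k : Type*) [Field k] (n : ℕ) :
    Expansion k (HDhat k n) ((Fin n →₀ ℕ) × (Fin n →₀ ℕ) × ℕ) where
  coeff := hopCoeff k n
  coeff_add P Q := by ext; simp [hopCoeff]
  coeff_injective P Q h := by
    apply (DiffOp.normalForm _).injective
    ext β j α
    exact congrFun h (α, β, j)
  part := hopPart k n
  coeff_part_of_mem s P m h := by rw [hopCoeff_hopPart, if_pos h]
  coeff_part_of_notMem s P m h := by rw [hopCoeff_hopPart, if_neg h]

section Fan

variable {k X M W : Type*} [Field k] [Ring X] (E : Expansion k X M)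

/-- The initial form of `P` for the weights `wt`: the sum of the terms of `P` of maximal weight.
It represents the class of `P` in `F_r / F_{<r}` where `r` is the order of `P`. -/
def initForm (wt : M → ℝ) (P : X) : X :=
  E.part {m | ∀ m', E.coeff P m' ≠ 0 → wt m' ≤ wt m} P

/-- The graded object of a set `S` (closed under addition) for the filtration induced by `wt`,
namely `⊕_r (S ∩ F_r) / (S ∩ F_{<r})`; it consists of the finite sums of initial forms of elements
of `S`. For `S` a ring `R` it is the underlying group of the graded ring `gr(R)`, and for `S` an
ideal `I` it is the initial ideal `in(I)`. -/
def grOf (wt : M → ℝ) (S : Set X) : AddSubgroup X :=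
  AddSubgroup.closure (initForm E wt '' S)

/-- The component of weight `r`. -/
def component (wt : M → ℝ) (r : ℝ) (P : X) : X := E.part {m | wt m = r} P

/-- The coefficients of the product of `a` and `b` in the graded ring: the product of the class of
`P` in degree `r` and the class of `Q` in degree `s` is the class of `P * Q` in degree `r + s`, that
is, its component of weight `r + s`. (Elements of the graded ring have only finitely many nonzero
components, so the sum is finite there.) -/
def grMul (wt : M → ℝ) (a b : X) (m : M) : k :=
  ∑ᶠ r : ℝ, E.coeff (component E wt r a * component E wt (wt m - r) b) m

/-- The weights `wt` and `wt'` define the same graded ring of `R`: the same elements, with the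
same multiplication. -/
def SameGr (wt wt' : M → ℝ) (R : Set X) : Prop :=
  grOf E wt R = grOf E wt' R ∧
    ∀ a ∈ grOf E wt R, ∀ b ∈ grOf E wt R, grMul E wt a b = grMul E wt' a b

/-- The elements of `X` that lie in the left ideal `I` of the subring `R`. -/
def idealSet [Algebra k X] {R : Subalgebra k X} (I : Ideal R) : Set X :=
  Subtype.val '' (I : Set R)

/-- The Gröbner cone of the ideal `I` of `R` with respect to `w`, in the weight space `Ω`. -/
def groebnerCone [Algebra k X] (wt : W → M → ℝ) (Ω : Set W) {R : Subalgebra k X} (I : Ideal R)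
    (w : W) : Set W :=
  {w' | w' ∈ Ω ∧ SameGr E (wt w) (wt w') (R : Set X) ∧
    grOf E (wt w) (idealSet I) = grOf E (wt w') (idealSet I)}

/-- The (open) Gröbner fan of the ideal `I` of `R` on `Ω`: the set of all Gröbner cones. -/
def groebnerFan [Algebra k X] (wt : W → M → ℝ) (Ω : Set W) {R : Subalgebra k X} (I : Ideal R) :
    Set (Set W) :=
  groebnerCone E wt Ω I '' Ω

/-- The left ideal `R' · I` of `R'` generated by an ideal `I` of a subring `R ⊆ R'`. -/
def extend [Algebra k X] {R : Subalgebra k X} (R' : Subalgebra k X) (I : Ideal R) : Ideal R' :=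
  Ideal.span {f : R' | (f : X) ∈ idealSet I}

end Fan

/-! ### Weights -/

section Weights

variable {n : ℕ}

/-- The local weights `u ∈ ℝ^n` with `u_i ≤ 0`. -/
def Uloc (n : ℕ) : Set (Fin n → ℝ) := {u | ∀ i, u i ≤ 0}

/-- The local weights `(u, v) ∈ ℝ^{2n}` with `u_i ≤ 0` and `u_i + v_i ≥ 0`. -/
def Wloc (n : ℕ) : Set ((Fin n → ℝ) × (Fin n → ℝ)) :=
  {w | ∀ i, w.1 i ≤ 0 ∧ 0 ≤ w.1 i + w.2 i}

/-- The scalar product `u · α`. -/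
def dot (u : Fin n → ℝ) (α : Fin n →₀ ℕ) : ℝ := ∑ i, u i * (α i : ℝ)

/-- The weight of `x^α ∂^β`. -/
def opWeight (w : (Fin n → ℝ) × (Fin n → ℝ)) (m : (Fin n →₀ ℕ) × (Fin n →₀ ℕ)) : ℝ :=
  dot w.1 m.1 + dot w.2 m.2

/-- The weight of `x^α ∂^β h^j`; the variable `h` has weight zero. -/
def hopWeight (w : (Fin n → ℝ) × (Fin n → ℝ)) (m : (Fin n →₀ ℕ) × (Fin n →₀ ℕ) × ℕ) : ℝ :=
  dot w.1 m.1 + dot w.2 m.2.1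

end Weights

/-! ### The coefficient rings -/

section CoefficientRings

/-- `k[x]` as a subring of `k[[x]]`. -/
def polyRing (k : Type*) [Field k] (n : ℕ) : SeriesRing k n :=
  (MvPolynomial.coeToMvPowerSeries.algHom k : MvPolynomial (Fin n) k →ₐ[k] Series k n).range

/-- `k[[x]]` as a subring of itself. -/
def formalRing (k : Type*) [Field k] (n : ℕ) : SeriesRing k n := ⊤

/-- The localization of `k[x]` at the origin, as a subring of `k[[x]]`: the quotients `p / q` of
polynomials with `q(0) ≠ 0`. -/
def localRing (k : Type*) [Field k] (n : ℕ) : SeriesRing k n where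
  carrier := {f | ∃ p q : MvPolynomial (Fin n) k,
    MvPolynomial.constantCoeff q ≠ 0 ∧ (q : Series k n) * f = p}
  mul_mem' := by
    rintro f g ⟨p, q, hq, h⟩ ⟨p', q', hq', h'⟩
    refine ⟨p * p', q * q', by simp [hq, hq'], ?_⟩
    rw [MvPolynomial.coe_mul, MvPolynomial.coe_mul, ← h, ← h']
    ring
  add_mem' := by
    rintro f g ⟨p, q, hq, h⟩ ⟨p', q', hq', h'⟩
    refine ⟨p * q' + p' * q, q * q', by simp [hq, hq'], ?_⟩
    rw [MvPolynomial.coe_add, MvPolynomial.coe_mul, MvPolynomial.coe_mul, MvPolynomial.coe_mul,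
      ← h, ← h']
    ring
  algebraMap_mem' r := ⟨MvPolynomial.C r, 1, by simp, by
    rw [MvPolynomial.coe_one, one_mul, MvPolynomial.coe_C]
    rfl⟩

/-- Convergent power series over `ℂ`: those converging absolutely on some polydisc of positive
radius. -/
def IsConvergent {n : ℕ} (f : Series ℂ n) : Prop :=
  ∃ r : ℝ, 0 < r ∧ Summable fun α : Fin n →₀ ℕ => ‖MvPowerSeries.coeff α f‖ * r ^ α.degree

theorem summable_of_le {n : ℕ} (f : Series ℂ n) (r s : ℝ) (hr : 0 < r) (hrs : r ≤ s)
    (h : Summable fun α : Fin n →₀ ℕ => ‖MvPowerSeries.coeff α f‖ * s ^ α.degree) :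
    Summable fun α : Fin n →₀ ℕ => ‖MvPowerSeries.coeff α f‖ * r ^ α.degree := by
  refine h.of_nonneg_of_le (fun _ => by positivity) fun α => ?_
  gcongr

theorem summable_mul {n : ℕ} {F G : (Fin n →₀ ℕ) → ℝ} (hF : Summable F) (hG : Summable G)
    (hF' : 0 ≤ F) (hG' : 0 ≤ G) :
    Summable fun α => ∑ p ∈ Finset.HasAntidiagonal.antidiagonal α, F p.1 * G p.2 :=
  summable_sum_mul_antidiagonal_of_summable_mul (hF.mul_of_nonneg hG hF' hG')

theorem norm_coeff_mul_le {n : ℕ} (f g : Series ℂ n) (r : ℝ) (hr : 0 < r) (α : Fin n →₀ ℕ) :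
    ‖MvPowerSeries.coeff α (f * g)‖ * r ^ α.degree ≤ ∑ p ∈ Finset.HasAntidiagonal.antidiagonal α,
      (‖MvPowerSeries.coeff p.1 f‖ * r ^ p.1.degree) *
        (‖MvPowerSeries.coeff p.2 g‖ * r ^ p.2.degree) := by
  rw [MvPowerSeries.coeff_mul]
  refine (mul_le_mul_of_nonneg_right (norm_sum_le _ _) (by positivity)).trans ?_
  rw [Finset.sum_mul]
  refine Finset.sum_le_sum fun p hp => le_of_eq ?_
  have h : α.degree = p.1.degree + p.2.degree := by
    rw [← Finset.HasAntidiagonal.mem_antidiagonal.1 hp, map_add]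
  rw [h, pow_add, norm_mul]
  ring

theorem IsConvergent.mul {n : ℕ} {f g : Series ℂ n} (hf : IsConvergent f) (hg : IsConvergent g) :
    IsConvergent (f * g) := by
  obtain ⟨r, hr, hf⟩ := hf
  obtain ⟨s, hs, hg⟩ := hg
  have ht : 0 < min r s := lt_min hr hs
  have h := summable_mul (summable_of_le f _ _ ht (min_le_left r s) hf)
    (summable_of_le g _ _ ht (min_le_right r s) hg)
    (fun _ => by positivity) (fun _ => by positivity)
  exact ⟨min r s, ht, h.of_nonneg_of_le (fun _ => by positivity)
    (norm_coeff_mul_le f g _ ht)⟩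

theorem IsConvergent.add {n : ℕ} {f g : Series ℂ n} (hf : IsConvergent f) (hg : IsConvergent g) :
    IsConvergent (f + g) := by
  obtain ⟨r, hr, hf⟩ := hf
  obtain ⟨s, hs, hg⟩ := hg
  have ht : 0 < min r s := lt_min hr hs
  refine ⟨min r s, ht, ((summable_of_le f _ _ ht (min_le_left r s) hf).add
    (summable_of_le g _ _ ht (min_le_right r s) hg)).of_nonneg_of_le
      (fun α => by positivity) fun α => ?_⟩
  rw [map_add, ← add_mul]
  gcongr
  exact norm_add_le _ _

theorem IsConvergent.const (n : ℕ) (c : ℂ) : IsConvergent (MvPowerSeries.C c : Series ℂ n) := by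
  classical
  refine ⟨1, one_pos, summable_of_ne_finset_zero (s := {0}) fun α hα => ?_⟩
  rw [MvPowerSeries.coeff_C, if_neg (by simpa using hα), norm_zero, zero_mul]

/-- The ring of germs at the origin of analytic functions on `ℂ^n`, as the ring of convergent power
series. -/
def convRing (n : ℕ) : SeriesRing ℂ n where
  carrier := {f | IsConvergent f}
  mul_mem' := IsConvergent.mul
  add_mem' := IsConvergent.add
  algebraMap_mem' := IsConvergent.const n

end CoefficientRings

/-! ### Operators with coefficients in a given ring `C ⊆ k[[x]]` -/

section Rings

variable {k : Type*} [Field k] {n : ℕ}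

/-- The ring of differential operators with coefficients in `C`, as the subring of `Dhat` generated
by `C` and the `∂_i`. -/
def diffOps (C : SeriesRing k n) : Subalgebra k (Dhat k n) :=
  Algebra.adjoin k (DiffOp.coe (partials k n) '' C ∪ Set.range (DiffOp.del (partials k n)))

/-- The homogenized ring of differential operators with coefficients in `C`, as the subring of
`HDhat` generated by `C`, the `∂_i` and `h`. -/
def hdiffOps (C : SeriesRing k n) : Subalgebra k (HDhat k n) :=
  Algebra.adjoin k (((fun c => DiffOp.coe (hPartials k n) (Polynomial.C c)) '' C ∪
    Set.range (DiffOp.del (hPartials k n))) ∪ {DiffOp.coe (hPartials k n) Polynomial.X})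

/-- The degree of `P` in the `∂_i`. -/
def opDegree (P : Dhat k n) : ℕ := (DiffOp.normalForm _ P).support.sup fun β => β.degree

/-- The homogenization `∑ c_{α,β} x^α ∂^β h^{d-|β|}` of `P = ∑ c_{α,β} x^α ∂^β`, where `d` is the
degree of `P`. -/
def homogenize (P : Dhat k n) : HDhat k n :=
  ∑ β ∈ (DiffOp.normalForm _ P).support,
    DiffOp.mono _ β (Polynomial.monomial (opDegree P - β.degree) (DiffOp.normalForm _ P β))

/-- The homogenization of a left ideal `I`: the left ideal generated by the homogenizations
of the elements of `I`. -/
def homogenizeIdeal {C : SeriesRing k n} (I : Ideal (diffOps C)) : Ideal (hdiffOps C) :=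
  Ideal.span {Q : hdiffOps C | ∃ P ∈ I, (Q : HDhat k n) = homogenize (P : Dhat k n)}

/-- The Gröbner fan on `Uloc` of an ideal in a subring of `k[[x]]`. -/
def fanU {R : SeriesRing k n} (I : Ideal R) : Set (Set (Fin n → ℝ)) :=
  groebnerFan (seriesExpansion k n) dot (Uloc n) I

/-- The Gröbner fan on `Wloc` of a left ideal in a ring of differential operators. -/
def fanW {R : Subalgebra k (Dhat k n)} (I : Ideal R) : Set (Set ((Fin n → ℝ) × (Fin n → ℝ))) :=
  groebnerFan (opExpansion k n) opWeight (Wloc n) I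

/-- The Gröbner fan on `Wloc` of a left ideal in a homogenized ring of differential operators. -/
def fanH {R : Subalgebra k (HDhat k n)} (I : Ideal R) : Set (Set ((Fin n → ℝ) × (Fin n → ℝ))) :=
  groebnerFan (hopExpansion k n) hopWeight (Wloc n) I

end Rings

end LocalGroebner

end

open LocalGroebner

noncomputable section

namespace LocalGroebner

/-! ### Closed submodules of free modules -/

section Adic

variable {A : Type*} [CommRing A] {ι : Type*}

/-! Formal power series are faithfully flat over the local coefficient rings `C` (algebraic or
convergent), and taking initial ideals for a fixed local weight is compatible with this extension.
The rings k[[x]], `Dhat` and `HDhat` are free left k[[x]]-modules on bases of weighted elements, and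
the subring over `C` consists of the elements with all coordinates in `C`. A `Model` records what is
needed, so that one argument serves all three.

Faithful flatness is used in concrete form, for an ideal I over `C` and a set U of terms stable
under multiplication by monomials in x. By `IsGood.mem_span_of_suppIn`, an element of the extension
with terms in U is a k[[x]]-combination of elements of I with terms in U. By
`IsGood.exists_sub_suppIn`, an element over `C` that lies in the extension up to terms in U lies in
I up to terms in U. Both come from truncating the coefficients to polynomials and passing to the
limit with Krull's intersection theorem; the first also needs Artin-Rees.

With U = {weight ≤ r} the first shows that the initial ideal of the extension is spanned by that of
I (`Model.mem_grOf_extend`). With U = {weight < r} the second shows that the initial ideal of I is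
the part of the larger one lying in the graded ring over `C` (`Model.mem_grOf_idealSet`). Each
therefore determines the other. Graded rings are compared in `Model.sameGr_iff`: their elements
depend only on which u_i are negative, detected over `C` by 1/(1 - x_i), and each coefficient of a
product depends only on polynomial truncations of the factors. So the cones coincide point by point.
With U = {order in ∂ at most d}, flatness also shows that homogenization commutes with extension.

It remains to verify `IsGood`. For the algebraic ring the delicate point is stability under taking
weight components, a recursion on weights in qf = p. For convergent series it is Noetherianity, a
division theorem with estimates in norms adapted to a multiplicative ordering of the exponents. -/

theorem mem_pow_smul_top_pi [Finite ι] (I : Ideal A) (j : ℕ) (f : ι → A) (hf : ∀ s, f s ∈ I ^ j) :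
    f ∈ (I ^ j • ⊤ : Submodule A (ι → A)) := by
  classical
  have := Fintype.ofFinite ι
  rw [pi_eq_sum_univ' f]
  exact Submodule.sum_mem _ fun s _ => Submodule.smul_mem_smul (hf s) trivial

theorem apply_mem_of_mem_smul_top_pi (I : Ideal A) (f : ι → A)
    (hf : f ∈ (I • ⊤ : Submodule A (ι → A))) (s : ι) : f s ∈ I := by
  have h : (I • ⊤ : Submodule A (ι → A)).map (LinearMap.proj s) ≤ I := by
    rw [Submodule.map_smul'']
    exact Submodule.smul_le.2 fun r hr x _ => by
      rw [smul_eq_mul]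
      exact Ideal.mul_mem_right _ _ hr
  exact h ⟨f, hf, rfl⟩

/-- Krull's intersection theorem: submodules of a free module of finite rank are closed. -/
theorem mem_of_adic_closure [IsNoetherianRing A] [Finite ι] (I : Ideal A)
    (hI : I ≤ Ideal.jacobson ⊥) (N : Submodule A (ι → A))
    (v : ι → A) (hv : ∀ j, ∃ q ∈ N, ∀ s, v s - q s ∈ I ^ j) : v ∈ N := by
  -- Krull's theorem is applied to the quotient by `N`: the class of `v` lies in every power of `I`
  -- times the quotient, hence vanishes.
  rw [← Submodule.Quotient.mk_eq_zero, ← Submodule.mem_bot A,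
    ← Ideal.iInf_pow_smul_eq_bot_of_le_jacobson (M := (ι → A) ⧸ N) I hI, Submodule.mem_iInf]
  intro j
  obtain ⟨q, hq, h⟩ := hv j
  have h1 := Submodule.mem_map_of_mem (f := N.mkQ) (mem_pow_smul_top_pi I j (v - q) h)
  rw [Submodule.map_smul'', map_sub, show N.mkQ q = 0 from (Submodule.Quotient.mk_eq_zero N).2 hq,
    sub_zero] at h1
  exact Submodule.smul_mono le_rfl le_top h1

/-- The Artin-Rees lemma for the intersection of two submodules of a free module. -/
theorem exists_artin_rees_inf [IsNoetherianRing A] [Finite ι] (I : Ideal A)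
    (N F : Submodule A (ι → A)) :
    ∃ c, ∀ j, ∀ q ∈ N, ∀ p ∈ F, (∀ s, q s - p s ∈ I ^ (j + c)) →
      ∃ t ∈ N ⊓ F, ∀ s, q s - t s ∈ I ^ j := by
  obtain ⟨c, hc⟩ := Ideal.exists_pow_inf_eq_pow_smul I (N.map F.mkQ)
  refine ⟨c, fun j q hq p hp h => ?_⟩
  have h1 := Submodule.mem_map_of_mem (f := F.mkQ) (mem_pow_smul_top_pi I (j + c) (q - p) h)
  rw [Submodule.map_smul'', map_sub, show F.mkQ p = 0 from (Submodule.Quotient.mk_eq_zero F).2 hp,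
    sub_zero] at h1
  have h2 : F.mkQ q ∈ (I ^ (j + c) • ⊤ : Submodule A ((ι → A) ⧸ F)) ⊓ N.map F.mkQ :=
    ⟨Submodule.smul_mono le_rfl le_top h1, Submodule.mem_map_of_mem hq⟩
  rw [hc (j + c) (Nat.le_add_left _ _), Nat.add_sub_cancel] at h2
  have h3 : F.mkQ q ∈ (I ^ j • N).map F.mkQ := by
    rw [Submodule.map_smul'']
    exact Submodule.smul_mono le_rfl inf_le_right h2
  obtain ⟨r, hr, hqr⟩ := h3
  refine ⟨q - r, ⟨N.sub_mem hq (Submodule.smul_le_right hr), ?_⟩, fun s => ?_⟩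
  · refine (Submodule.Quotient.mk_eq_zero F).1 ?_
    exact (map_sub F.mkQ q r).trans (sub_eq_zero.2 hqr.symm)
  · rw [Pi.sub_apply, sub_sub_cancel]
    exact apply_mem_of_mem_smul_top_pi _ r (Submodule.smul_mono le_rfl le_top hr) s

end Adic

/-! ### Orders and truncations of power series -/

section Order

variable {k : Type*} [Field k] {n : ℕ}

theorem coeff_seriesPart_of_mem {s : Set (Fin n →₀ ℕ)} {α : Fin n →₀ ℕ} (h : α ∈ s)
    (f : Series k n) : MvPowerSeries.coeff α (seriesPart s f) = MvPowerSeries.coeff α f := by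
  rw [coeff_seriesPart, if_pos h]

theorem coeff_seriesPart_of_notMem {s : Set (Fin n →₀ ℕ)} {α : Fin n →₀ ℕ} (h : α ∉ s)
    (f : Series k n) : MvPowerSeries.coeff α (seriesPart s f) = 0 := by
  rw [coeff_seriesPart, if_neg h]

theorem mem_of_coeff_seriesPart_ne_zero {s : Set (Fin n →₀ ℕ)} {α : Fin n →₀ ℕ} {f : Series k n}
    (h : MvPowerSeries.coeff α (seriesPart s f) ≠ 0) : α ∈ s := by
  by_contra h'
  exact h (coeff_seriesPart_of_notMem h' f)

/-- The ideal of the power series all of whose terms have degree at least `j`. -/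
def ordIdeal (k : Type*) [Field k] (n j : ℕ) : Ideal (Series k n) where
  carrier := {f | ∀ α : Fin n →₀ ℕ, α.degree < j → MvPowerSeries.coeff α f = 0}
  zero_mem' _ _ := map_zero _
  add_mem' hf hg α hα := by rw [map_add, hf α hα, hg α hα, add_zero]
  smul_mem' c f hf α hα := by
    rw [smul_eq_mul, MvPowerSeries.coeff_mul]
    refine Finset.sum_eq_zero fun p hp => ?_
    rw [hf p.2 _, mul_zero]
    have h : α.degree = p.1.degree + p.2.degree := by
      rw [← Finset.HasAntidiagonal.mem_antidiagonal.1 hp, map_add]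
    omega

theorem mem_ordIdeal {j : ℕ} {f : Series k n} :
    f ∈ ordIdeal k n j ↔ ∀ α : Fin n →₀ ℕ, α.degree < j → MvPowerSeries.coeff α f = 0 := Iff.rfl

theorem ordIdeal_anti {i j : ℕ} (h : i ≤ j) : ordIdeal k n j ≤ ordIdeal k n i :=
  fun _ hf α hα => hf α (hα.trans_le h)

theorem mem_ordIdeal_one {f : Series k n} :
    f ∈ ordIdeal k n 1 ↔ MvPowerSeries.constantCoeff f = 0 := by
  rw [mem_ordIdeal, ← MvPowerSeries.coeff_zero_eq_constantCoeff_apply]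
  refine ⟨fun h => h 0 (by simp), fun h α hα => ?_⟩
  rw [Nat.lt_one_iff, Finsupp.degree_eq_zero_iff] at hα
  rw [hα, h]

theorem ordIdeal_mul {i j : ℕ} {f g : Series k n} (hf : f ∈ ordIdeal k n i)
    (hg : g ∈ ordIdeal k n j) : f * g ∈ ordIdeal k n (i + j) := by
  intro α hα
  rw [MvPowerSeries.coeff_mul]
  refine Finset.sum_eq_zero fun p hp => ?_
  have h : α.degree = p.1.degree + p.2.degree := by
    rw [← Finset.HasAntidiagonal.mem_antidiagonal.1 hp, map_add]
  rcases lt_or_ge p.1.degree i with h1 | h1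
  · rw [hf _ h1, zero_mul]
  · rw [hg _ (by omega), mul_zero]

theorem ordIdeal_one_pow_le (j : ℕ) : ordIdeal k n 1 ^ j ≤ ordIdeal k n j := by
  induction j with
  | zero => exact fun f _ α hα => absurd hα (Nat.not_lt_zero _)
  | succ j ih =>
    rw [pow_succ]
    exact Ideal.mul_le.2 fun f hf g hg => ordIdeal_mul (ih hf) hg

/-- The terms of degree less than `j`. -/
def trunc (j : ℕ) (f : Series k n) : Series k n := seriesPart {α | α.degree < j} f

theorem sub_trunc_mem (j : ℕ) (f : Series k n) : f - trunc j f ∈ ordIdeal k n j := by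
  intro α hα
  rw [map_sub, trunc, coeff_seriesPart_of_mem hα, sub_self]

theorem mem_polyRing_of_finite {f : Series k n}
    (h : {α : Fin n →₀ ℕ | MvPowerSeries.coeff α f ≠ 0}.Finite) : f ∈ polyRing k n := by
  classical
  refine ⟨∑ α ∈ h.toFinset, MvPolynomial.monomial α (MvPowerSeries.coeff α f), ?_⟩
  ext α
  change MvPowerSeries.coeff α (MvPolynomial.toMvPowerSeries _) = _
  rw [MvPolynomial.coeff_coe, MvPolynomial.coeff_sum]
  simp only [MvPolynomial.coeff_monomial, Finset.sum_ite_eq', Set.Finite.mem_toFinset,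
    Set.mem_ofPred_eq]
  split_ifs with hα
  · rfl
  · exact (not_not.1 hα).symm

theorem trunc_mem_polyRing (j : ℕ) (f : Series k n) : trunc j f ∈ polyRing k n := by
  refine mem_polyRing_of_finite ((Finsupp.finite_of_degree_lt j).subset fun α hα =>
    mem_of_coeff_seriesPart_ne_zero hα)

/-- The series `∑ f_(α+e) x^α`. -/
def shift (e : Fin n →₀ ℕ) (f : Series k n) : Series k n :=
  fun α => MvPowerSeries.coeff (α + e) f

theorem coeff_shift (e : Fin n →₀ ℕ) (f : Series k n) (α : Fin n →₀ ℕ) :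
    MvPowerSeries.coeff α (shift e f) = MvPowerSeries.coeff (α + e) f := rfl

theorem monomial_mul_shift {e : Fin n →₀ ℕ} {f : Series k n}
    (hf : ∀ α, MvPowerSeries.coeff α f ≠ 0 → e ≤ α) :
    MvPowerSeries.monomial e 1 * shift e f = f := by
  ext α
  rw [MvPowerSeries.coeff_monomial_mul]
  split_ifs with h
  · rw [one_mul, coeff_shift, tsub_add_cancel_of_le h]
  · by_contra h'
    exact h (hf α (Ne.symm h'))

theorem shift_mem {j : ℕ} (i : Fin n) {f : Series k n} (hf : f ∈ ordIdeal k n (j + 1)) :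
    shift (Finsupp.single i 1) f ∈ ordIdeal k n j := by
  intro α hα
  rw [coeff_shift]
  exact hf _ (by rw [map_add, Finsupp.degree_single]; omega)

/-- The terms in which `x_i` is the first variable that occurs. -/
def firstPart (i : Fin n) (f : Series k n) : Series k n :=
  seriesPart {γ | γ i ≠ 0 ∧ ∀ l < i, γ l = 0} f

theorem seriesPart_mem_ordIdeal (s : Set (Fin n →₀ ℕ)) {j : ℕ} {f : Series k n}
    (hf : f ∈ ordIdeal k n j) : seriesPart s f ∈ ordIdeal k n j := by
  intro α hα
  rw [coeff_seriesPart, hf α hα, ite_self]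

theorem sum_firstPart {f : Series k n} (hf : f ∈ ordIdeal k n 1) : ∑ i, firstPart i f = f := by
  ext α
  rw [map_sum]
  rcases eq_or_ne α 0 with rfl | hα
  · rw [hf 0 (by simp)]
    exact Finset.sum_eq_zero fun i _ => coeff_seriesPart_of_notMem (fun h => h.1 rfl) f
  · have h : α.support.Nonempty := by
      rwa [Finset.nonempty_iff_ne_empty, ne_eq, Finsupp.support_eq_empty]
    rw [Finset.sum_eq_single (α.support.min' h)]
    · refine coeff_seriesPart_of_mem ?_ f
      refine ⟨by simpa using α.support.min'_mem h, fun l hl => ?_⟩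
      by_contra hl'
      exact absurd (α.support.min'_le l (by simpa using hl')) (not_le.2 hl)
    · refine fun i _ hi => coeff_seriesPart_of_notMem (fun hi' => hi (le_antisymm ?_ ?_)) f
      · by_contra h2
        exact absurd (hi'.2 _ (not_le.1 h2)) (by simpa using α.support.min'_mem h)
      · exact α.support.min'_le _ (by simpa using hi'.1)
    · simp

theorem X_mul_shift_firstPart (i : Fin n) (f : Series k n) :
    MvPowerSeries.X i * shift (Finsupp.single i 1) (firstPart i f) = firstPart i f := by
  refine monomial_mul_shift fun α hα => ?_
  rw [Finsupp.single_le_iff]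
  exact Nat.one_le_iff_ne_zero.2 (mem_of_coeff_seriesPart_ne_zero hα).1

/-- The ideal of the elements of a coefficient ring that vanish at the origin. -/
def vanishing (C : SeriesRing k n) : Ideal C := (ordIdeal k n 1).comap C.val

/-- Sorting the terms by the first variable that occurs writes f as ∑ x_i g_i with g_i in `C` of
order one less, and induction applies. The point is that the adic topology of `C` is the one induced
from k[[x]]. -/
theorem mem_vanishing_pow {C : SeriesRing k n} (hX : ∀ i, MvPowerSeries.X i ∈ C)
    (hC : ∀ f ∈ C, ∀ i, shift (Finsupp.single i 1) (firstPart i f) ∈ C) (j : ℕ) (f : C)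
    (hf : (f : Series k n) ∈ ordIdeal k n j) : f ∈ vanishing C ^ j := by
  induction j generalizing f with
  | zero => simp
  | succ j ih =>
    have h : f = ∑ i, (⟨_, hX i⟩ : C) * ⟨_, hC f f.2 i⟩ := by
      ext1
      rw [AddSubmonoidClass.coe_finsetSum]
      simp only [MulMemClass.coe_mul, X_mul_shift_firstPart]
      exact (sum_firstPart (ordIdeal_anti (by omega) hf)).symm
    rw [h, pow_succ']
    refine Ideal.sum_mem _ fun i _ => Ideal.mul_mem_mul ?_ (ih _ ?_)
    · exact mem_ordIdeal_one.2 (MvPowerSeries.constantCoeff_X i)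
    · exact shift_mem i (seriesPart_mem_ordIdeal _ hf)

theorem mem_ordIdeal_one_pow {j : ℕ} {f : Series k n} (hf : f ∈ ordIdeal k n j) :
    f ∈ ordIdeal k n 1 ^ j := by
  have h := mem_vanishing_pow (C := formalRing k n) (fun _ => trivial) (fun _ _ _ => trivial) j
    ⟨f, trivial⟩ hf
  have h2 := Ideal.mem_map_of_mem (formalRing k n).val h
  rw [Ideal.map_pow] at h2
  exact Ideal.pow_right_mono (Ideal.map_comap_le) j h2

end Order

/-! ### Coefficient rings over which the formal power series are faithfully flat -/

section Good

variable {k : Type*} [Field k] {n : ℕ}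

/-- The properties of a ring of power series `C` used to compare ideals over `C` with ideals over
`k[[x]]`. -/
structure IsGood (C : SeriesRing k n) : Prop where
  noetherian : IsNoetherianRing C
  poly_le : polyRing k n ≤ C
  inv_mem : ∀ f ∈ C, MvPowerSeries.constantCoeff f ≠ 0 → f⁻¹ ∈ C
  mem_pow : ∀ (j : ℕ) (f : C), (f : Series k n) ∈ ordIdeal k n j → f ∈ vanishing C ^ j
  part_mem : ∀ u ∈ Uloc n, ∀ r : ℝ, ∀ f ∈ C, seriesPart {α | dot u α = r} f ∈ C
  partials_mem : ∀ i, ∀ f ∈ C, partials k n i f ∈ C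

/-- A series with nonzero constant term has its inverse in `C`, so 1 + fg is a unit of `C` whenever
f vanishes at the origin. This makes Krull's theorem available over `C`. -/
theorem IsGood.vanishing_le_jacobson {C : SeriesRing k n} (hC : IsGood C) :
    vanishing C ≤ Ideal.jacobson ⊥ := by
  intro f hf
  rw [Ideal.mem_jacobson_bot]
  intro g
  have hf' : MvPowerSeries.constantCoeff (f : Series k n) = 0 := mem_ordIdeal_one.1 hf
  have h : MvPowerSeries.constantCoeff ((f * g + 1 : C) : Series k n) ≠ 0 := by
    simp [hf']
  refine IsUnit.of_mul_eq_one ⟨_, hC.inv_mem _ (f * g + 1 : C).2 h⟩ ?_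
  ext1
  exact MvPowerSeries.mul_inv_cancel _ h

theorem ordIdeal_one_le_jacobson : ordIdeal k n 1 ≤ Ideal.jacobson ⊥ := by
  intro f hf
  rw [Ideal.mem_jacobson_bot]
  intro g
  have h : MvPowerSeries.constantCoeff (f * g + 1) ≠ 0 := by
    simp [mem_ordIdeal_one.1 hf]
  exact IsUnit.of_mul_eq_one _ (MvPowerSeries.mul_inv_cancel _ h)

/-! ### Finitely supported families of power series -/

variable {B : Type*}

/-- The terms of `y` all lie in `U`. -/
def SuppIn (U : Set ((Fin n →₀ ℕ) × B)) (y : B →₀ Series k n) : Prop :=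
  ∀ α b, MvPowerSeries.coeff α (y b) ≠ 0 → (α, b) ∈ U

/-- `U` is stable under multiplication by monomials in `x`. -/
def XStable (U : Set ((Fin n →₀ ℕ) × B)) : Prop :=
  ∀ α b γ, (α, b) ∈ U → (γ + α, b) ∈ U

/-- The families with all terms in `U`. -/
def suppIn (k : Type*) [Field k] (U : Set ((Fin n →₀ ℕ) × B)) (hU : XStable U) :
    Submodule (Series k n) (B →₀ Series k n) where
  carrier := {y | SuppIn U y}
  zero_mem' α b h := absurd rfl h
  add_mem' {x y} hx hy α b h := by
    by_contra h'
    refine h ?_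
    rw [Finsupp.add_apply, map_add, not_not.1 (mt (hx α b) h'), not_not.1 (mt (hy α b) h'), add_zero]
  smul_mem' c y hy α b h := by
    rw [Finsupp.smul_apply, smul_eq_mul, MvPowerSeries.coeff_mul] at h
    obtain ⟨p, hp, h⟩ := Finset.exists_ne_zero_of_sum_ne_zero h
    rw [← Finset.HasAntidiagonal.mem_antidiagonal.1 hp]
    exact hU _ _ _ (hy _ _ (right_ne_zero_of_mul h))

/-- Extension by zero. -/
def extendZero (k : Type*) [Field k] {n : ℕ} (S : Finset B) :
    (S → Series k n) →ₗ[Series k n] (B →₀ Series k n) :=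
  Finsupp.lmapDomain _ _ ((↑) : S → B) ∘ₗ
    (Finsupp.linearEquivFunOnFinite (Series k n) (Series k n) S).symm.toLinearMap

theorem extendZero_apply {S : Finset B} (f : S → Series k n) (s : S) :
    extendZero k S f s = f s := by
  change Finsupp.mapDomain _ _ _ = _
  rw [Finsupp.mapDomain_apply Subtype.val_injective]
  rfl

theorem extendZero_apply_of_notMem {S : Finset B} (f : S → Series k n) {b : B} (hb : b ∉ S) :
    extendZero k S f b = 0 := by
  refine Finsupp.mapDomain_of_notMem_range _ _ ?_
  rintro ⟨s, rfl⟩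
  exact hb s.2

theorem extendZero_restrict {S : Finset B} {y : B →₀ Series k n} (hy : y.support ⊆ S) :
    extendZero k S (fun s => y s) = y := by
  ext1 b
  by_cases hb : b ∈ S
  · exact extendZero_apply (fun s : S => y s) ⟨b, hb⟩
  · rw [extendZero_apply_of_notMem _ hb, Finsupp.notMem_support_iff.1 fun h => hb (hy h)]

variable {C : SeriesRing k n}

/-- Extension by zero, for families with values in `C`. -/
def extendZeroOver (C : SeriesRing k n) (S : Finset B) : (S → C) →ₗ[C] (B →₀ Series k n) :=
  (extendZero k S).restrictScalars C ∘ₗ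
    LinearMap.compLeft (Algebra.linearMap C (Series k n)) S

/-- Only finitely many coefficients enter a combination, and truncating them gives approximations by
elements of `N'`. The support bound `S` does not depend on the precision `j`, which allows all later
limits to be taken in a free module of finite rank; `S₀` makes room for one more given support. -/
theorem exists_finset_of_mem_span {N : Set (B →₀ Series k n)} {y : B →₀ Series k n}
    (hy : y ∈ Submodule.span (Series k n) N) (S₀ : Finset B) (hC : IsGood C)
    (N' : Submodule C (B →₀ Series k n)) (hN' : N ⊆ N') :
    ∃ S : Finset B, S₀ ⊆ S ∧ y.support ⊆ S ∧ ∀ j, ∃ q ∈ N', q.support ⊆ S ∧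
      ∀ b, y b - q b ∈ ordIdeal k n j := by
  classical
  induction hy using Submodule.span_induction with
  | mem x hx =>
    exact ⟨S₀ ∪ x.support, Finset.subset_union_left, Finset.subset_union_right, fun j =>
      ⟨x, hN' hx, Finset.subset_union_right, fun b => by rw [sub_self]; exact zero_mem _⟩⟩
  | zero =>
    exact ⟨S₀, subset_rfl, by simp, fun j => ⟨0, zero_mem _, by simp, fun b => by simp⟩⟩
  | add x y _ _ hx hy =>
    obtain ⟨S, h1, h2, h3⟩ := hx
    obtain ⟨T, h4, h5, h6⟩ := hy
    refine ⟨S ∪ T, h1.trans Finset.subset_union_left, ?_, fun j => ?_⟩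
    · exact Finsupp.support_add.trans (Finset.union_subset_union h2 h5)
    · obtain ⟨p, hp, hp', hp''⟩ := h3 j
      obtain ⟨q, hq, hq', hq''⟩ := h6 j
      refine ⟨p + q, add_mem hp hq,
        Finsupp.support_add.trans (Finset.union_subset_union hp' hq'), fun b => ?_⟩
      rw [Finsupp.add_apply, Finsupp.add_apply, add_sub_add_comm]
      exact add_mem (hp'' b) (hq'' b)
  | smul a x _ hx =>
    obtain ⟨S, h1, h2, h3⟩ := hx
    refine ⟨S, h1, Finsupp.support_smul.trans h2, fun j => ?_⟩
    obtain ⟨p, hp, hp', hp''⟩ := h3 j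
    refine ⟨trunc j a • p, N'.smul_mem ⟨_, hC.poly_le (trunc_mem_polyRing j a)⟩ hp,
      Finsupp.support_smul.trans hp', fun b => ?_⟩
    rw [Finsupp.smul_apply, Finsupp.smul_apply, smul_eq_mul, smul_eq_mul]
    have h : a * x b - trunc j a * p b = a * (x b - p b) + (a - trunc j a) * p b := by ring
    rw [h]
    exact add_mem (Ideal.mul_mem_left _ _ (hp'' b)) (Ideal.mul_mem_right _ _ (sub_trunc_mem j a))

/-- The truncation of a family with terms in `U`, as a family of polynomials with terms in `U`. -/
theorem suppIn_trunc {U : Set ((Fin n →₀ ℕ) × B)} {S : Finset B} {y : B →₀ Series k n}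
    (hy : SuppIn U y) (j : ℕ) : SuppIn U (extendZero k S fun s => trunc j (y s)) := by
  intro α b h
  by_cases hb : b ∈ S
  · rw [show b = ((⟨b, hb⟩ : S) : B) from rfl, extendZero_apply] at h
    refine hy α b fun h' => h ?_
    rw [trunc, coeff_seriesPart, h', ite_self]
  · rw [extendZero_apply_of_notMem _ hb, map_zero] at h
    exact absurd rfl h

/-- Flatness of `k[[x]]` over `C`: the extension of scalars from `C` to `k[[x]]` is compatible with
restricting to the families with terms in `U`. -/
theorem IsGood.mem_span_of_suppIn (hC : IsGood C) (N : Submodule C (B →₀ Series k n))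
    (hN : ∀ q ∈ N, ∀ b, q b ∈ C) {U : Set ((Fin n →₀ ℕ) × B)} (hU : XStable U)
    {y : B →₀ Series k n} (hy : y ∈ Submodule.span (Series k n) (N : Set (B →₀ Series k n)))
    (hyU : SuppIn U y) :
    y ∈ Submodule.span (Series k n) {q | q ∈ N ∧ SuppIn U q} := by
  have := hC.noetherian
  obtain ⟨S, -, hS, hyN⟩ := exists_finset_of_mem_span hy ∅ hC N subset_rfl
  let N₁ : Submodule C (S → C) := N.comap (extendZeroOver C S)
  let F₁ : Submodule C (S → C) :=
    ((suppIn k U hU).restrictScalars C).comap (extendZeroOver C S)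
  -- An approximation of `y` in `N` need not have its terms in `U`, but the truncation of `y` does.
  -- The two agree to order `j + c`, so Artin-Rees yields an element of both modules that still
  -- approximates `y` to order `j`.
  obtain ⟨c, hc⟩ := exists_artin_rees_inf (vanishing C) N₁ F₁
  have happrox : ∀ j, ∃ t ∈ N₁ ⊓ F₁, ∀ s : S, y s - t s ∈ ordIdeal k n j := by
    intro j
    obtain ⟨q, hq, hqS, hq'⟩ := hyN (j + c)
    let q₁ : S → C := fun s => ⟨q s, hN q hq s⟩
    let p₁ : S → C := fun s => ⟨trunc (j + c) (y s), hC.poly_le (trunc_mem_polyRing _ _)⟩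
    have hq₁ : q₁ ∈ N₁ := by
      change extendZero k S (fun s => q s) ∈ N
      rwa [extendZero_restrict hqS]
    have hp₁ : p₁ ∈ F₁ := suppIn_trunc hyU _
    obtain ⟨t, ht, h⟩ := hc j q₁ hq₁ p₁ hp₁ fun s => hC.mem_pow _ _ (by
      have h := sub_mem (sub_trunc_mem (j + c) (y s)) (hq' s)
      rwa [sub_sub_sub_cancel_left] at h)
    refine ⟨t, ht, fun s => ?_⟩
    have h1 : (q s - t s : Series k n) ∈ ordIdeal k n j := by
      have := Ideal.mem_map_of_mem C.val (h s)
      rw [Ideal.map_pow] at this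
      exact ordIdeal_one_pow_le j (Ideal.pow_right_mono Ideal.map_comap_le j this)
    have h2 := add_mem (ordIdeal_anti (Nat.le_add_right j c) (hq' s)) h1
    rwa [sub_add_sub_cancel] at h2
  let T : Submodule (Series k n) (S → Series k n) :=
    Submodule.span _ ((fun t s => (t s : Series k n)) '' ((N₁ ⊓ F₁ : Submodule C (S → C)) : Set (S → C)))
  have hT : (fun s : S => y s) ∈ T := by
    -- The limit is taken over k[[x]], where the span `T` is closed.
    refine mem_of_adic_closure (ordIdeal k n 1) ordIdeal_one_le_jacobson T _ fun j => ?_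
    obtain ⟨t, ht, h⟩ := happrox j
    exact ⟨_, Submodule.subset_span ⟨t, ht, rfl⟩, fun s => mem_ordIdeal_one_pow (h s)⟩
  have h := Submodule.mem_map_of_mem (f := extendZero k S) hT
  rw [extendZero_restrict hS, Submodule.map_span] at h
  refine Submodule.span_mono ?_ h
  rintro _ ⟨_, ⟨t, ht, rfl⟩, rfl⟩
  exact ht

/-- Faithfulness of `k[[x]]` over `C`: if an element with coefficients in `C` lies in the extension
of a module up to terms in `U`, then it does so over `C`. -/
theorem IsGood.exists_sub_suppIn (hC : IsGood C) (N : Submodule C (B →₀ Series k n))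
    (hN : ∀ q ∈ N, ∀ b, q b ∈ C) {U : Set ((Fin n →₀ ℕ) × B)} (hU : XStable U)
    {y z : B →₀ Series k n} (hy : y ∈ Submodule.span (Series k n) (N : Set (B →₀ Series k n)))
    (hz : ∀ b, z b ∈ C) (hyz : SuppIn U (y - z)) :
    ∃ q ∈ N, SuppIn U (z - q) := by
  have := hC.noetherian
  obtain ⟨S, hzS, hyS, hyN⟩ := exists_finset_of_mem_span hy z.support hC N subset_rfl
  let N₁ : Submodule C (S → C) := N.comap (extendZeroOver C S)
  let F₁ : Submodule C (S → C) :=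
    ((suppIn k U hU).restrictScalars C).comap (extendZeroOver C S)
  let z₁ : S → C := fun s => ⟨z s, hz s⟩
  -- Since z = y - (y - z), approximating `y` in `N` and truncating `y - z` places `z₁` in the adic
  -- closure of `N₁ ⊔ F₁`, which is closed over `C`.
  have h : z₁ ∈ N₁ ⊔ F₁ := by
    refine mem_of_adic_closure (vanishing C) hC.vanishing_le_jacobson _ _ fun j => ?_
    obtain ⟨q, hq, hqS, hq'⟩ := hyN j
    let q₁ : S → C := fun s => ⟨q s, hN q hq s⟩
    let p₁ : S → C := fun s => ⟨trunc j ((y - z) s), hC.poly_le (trunc_mem_polyRing _ _)⟩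
    have hq₁ : q₁ ∈ N₁ := by
      change extendZero k S (fun s => q s) ∈ N
      rwa [extendZero_restrict hqS]
    have hp₁ : p₁ ∈ F₁ := suppIn_trunc hyz _
    refine ⟨q₁ - p₁, Submodule.sub_mem _ (Submodule.mem_sup_left hq₁) (Submodule.mem_sup_right hp₁),
      fun s => hC.mem_pow _ _ ?_⟩
    have h := sub_mem (hq' s) (sub_trunc_mem j ((y - z) s))
    have e : (y s - q s) - ((y - z) s - trunc j ((y - z) s)) =
      z s - (q s - trunc j ((y - z) s)) := by
      rw [Finsupp.sub_apply]
      ring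
    rwa [e] at h
  obtain ⟨q, hq, p, hp, hqp⟩ := Submodule.mem_sup.1 h
  refine ⟨extendZeroOver C S q, hq, ?_⟩
  have hz₁ : z = extendZeroOver C S z₁ := (extendZero_restrict hzS).symm
  rw [hz₁, ← hqp, map_add, add_sub_cancel_left]
  exact hp

end Good

/-! ### Graded objects -/

section Graded

variable {k X M : Type*} [Field k] [Ring X] (E : Expansion k X M)

theorem Expansion.coeff_zero (m : M) : E.coeff 0 m = 0 := by
  have h := congrFun (E.coeff_add 0 0) m
  rw [add_zero, Pi.add_apply] at h
  exact left_eq_add.1 h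

/-- The expansion as an additive map. -/
def Expansion.coeffHom : X →+ (M → k) where
  toFun := E.coeff
  map_zero' := funext E.coeff_zero
  map_add' := E.coeff_add

theorem Expansion.coeffHom_apply (P : X) : E.coeffHom P = E.coeff P := rfl

theorem Expansion.coeff_neg (P : X) (m : M) : E.coeff (-P) m = -E.coeff P m :=
  congrFun (map_neg E.coeffHom P) m

/-- Only finitely many weights occur in `a`. -/
def FiniteWeights (wt : M → ℝ) (a : X) : Prop := (wt '' {m | E.coeff a m ≠ 0}).Finite

/-- The component of weight `r` of `a` is the leading component of an element of `S` of order at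
most `r`. -/
def IsLead (wt : M → ℝ) (S : Set X) (r : ℝ) (a : X) : Prop :=
  ∃ P ∈ S, (∀ m, E.coeff P m ≠ 0 → wt m ≤ r) ∧ ∀ m, wt m = r → E.coeff P m = E.coeff a m

/-- The nonzero elements of `S` have terms of maximal weight. -/
def HasOrders (wt : M → ℝ) : Prop :=
  ∀ P : X, P ≠ 0 → ∃ m, E.coeff P m ≠ 0 ∧ ∀ m', E.coeff P m' ≠ 0 → wt m' ≤ wt m

variable {E} {wt : M → ℝ}

theorem coeff_component_of_eq {r : ℝ} {m : M} (h : wt m = r) (a : X) :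
    E.coeff (component E wt r a) m = E.coeff a m := E.coeff_part_of_mem _ _ _ h

theorem coeff_component_of_ne {r : ℝ} {m : M} (h : wt m ≠ r) (a : X) :
    E.coeff (component E wt r a) m = 0 := E.coeff_part_of_notMem _ _ _ h

theorem initForm_eq_component {P : X} {m : M} (hm : E.coeff P m ≠ 0)
    (h : ∀ m', E.coeff P m' ≠ 0 → wt m' ≤ wt m) :
    initForm E wt P = component E wt (wt m) P := by
  apply E.coeff_injective
  ext m'
  rcases eq_or_ne (E.coeff P m') 0 with h0 | h0
  · trans (0 : k)
    · by_cases h1 : m' ∈ {m | ∀ m', E.coeff P m' ≠ 0 → wt m' ≤ wt m}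
      · exact (E.coeff_part_of_mem _ _ _ h1).trans h0
      · exact E.coeff_part_of_notMem _ _ _ h1
    · by_cases h1 : wt m' = wt m
      · rw [coeff_component_of_eq h1, h0]
      · rw [coeff_component_of_ne h1]
  · by_cases h1 : wt m' = wt m
    · rw [coeff_component_of_eq h1]
      refine E.coeff_part_of_mem _ _ _ fun m'' h'' => ?_
      rw [h1]
      exact h m'' h''
    · rw [coeff_component_of_ne h1]
      exact E.coeff_part_of_notMem _ _ _ fun h2 => h1 (le_antisymm (h _ h0) (h2 m hm))

theorem initForm_zero : initForm E wt 0 = 0 := by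
  apply E.coeff_injective
  ext m
  rw [E.coeff_zero]
  by_cases h1 : m ∈ {m | ∀ m', E.coeff (0 : X) m' ≠ 0 → wt m' ≤ wt m}
  · exact (E.coeff_part_of_mem _ _ _ h1).trans (E.coeff_zero m)
  · exact E.coeff_part_of_notMem _ _ _ h1

/-- An upper bound `r` for the order is enough: if it is attained the component is the initial form,
otherwise the component is zero. -/
theorem component_mem_grOf {S : Set X} {P : X} (hP : P ∈ S) {r : ℝ}
    (h : ∀ m, E.coeff P m ≠ 0 → wt m ≤ r) : component E wt r P ∈ grOf E wt S := by
  by_cases h0 : ∃ m, E.coeff P m ≠ 0 ∧ wt m = r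
  · obtain ⟨m, hm, rfl⟩ := h0
    rw [← initForm_eq_component hm h]
    exact AddSubgroup.subset_closure ⟨P, hP, rfl⟩
  · convert zero_mem (grOf E wt S)
    apply E.coeff_injective
    ext m
    rw [E.coeff_zero]
    by_cases h1 : wt m = r
    · rw [coeff_component_of_eq h1]
      by_contra h2
      exact h0 ⟨m, h2, h1⟩
    · exact coeff_component_of_ne h1 P

theorem FiniteWeights.component (a : X) (r : ℝ) : FiniteWeights E wt (component E wt r a) := by
  refine (Set.finite_singleton r).subset ?_
  rintro _ ⟨m, hm, rfl⟩
  by_contra h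
  exact hm (coeff_component_of_ne h a)

theorem FiniteWeights.exists_eq_sum {a : X} (ha : FiniteWeights E wt a) :
    ∃ F : Finset ℝ, a = ∑ r ∈ F, LocalGroebner.component E wt r a := by
  obtain ⟨F, hF⟩ : ∃ F : Finset ℝ, ∀ m, E.coeff a m ≠ 0 → wt m ∈ F :=
    ⟨Set.Finite.toFinset ha, fun m hm => (Set.Finite.mem_toFinset ha).2 ⟨m, hm, rfl⟩⟩
  refine ⟨F, ?_⟩
  apply E.coeff_injective
  ext m
  rw [← E.coeffHom_apply, ← E.coeffHom_apply, map_sum, Finset.sum_apply]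
  simp only [E.coeffHom_apply]
  by_cases hm : E.coeff a m = 0
  · rw [hm]
    refine (Finset.sum_eq_zero fun r _ => ?_).symm
    by_cases h : wt m = r
    · rw [coeff_component_of_eq h, hm]
    · rw [coeff_component_of_ne h]
  · rw [Finset.sum_eq_single (wt m), coeff_component_of_eq rfl]
    · exact fun r _ h => coeff_component_of_ne h.symm a
    · exact fun h => absurd (hF m hm) h

/-- The elements of the graded object of `S` are those with finitely many components, all of which
are leading components of elements of `S`. -/
theorem mem_grOf_iff (hwt : HasOrders E wt) (S : AddSubgroup X) (a : X) :
    a ∈ grOf E wt S ↔ FiniteWeights E wt a ∧ ∀ r, IsLead E wt S r a := by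
  constructor
  · intro ha
    refine AddSubgroup.closure_induction ?_ ?_ ?_ ?_ ha
    · rintro _ ⟨P, hP, rfl⟩
      rcases eq_or_ne P 0 with rfl | h0
      · rw [initForm_zero]
        refine ⟨Set.Finite.subset Set.finite_empty ?_, fun r => ⟨0, hP, fun m h => ?_, fun _ _ => rfl⟩⟩
        · rintro _ ⟨m, hm, -⟩
          exact hm (E.coeff_zero m)
        · exact absurd (E.coeff_zero m) h
      · obtain ⟨m, hm, h⟩ := hwt P h0
        rw [initForm_eq_component hm h]
        refine ⟨.component P _, fun r => ?_⟩
        rcases eq_or_ne r (wt m) with rfl | hr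
        · exact ⟨P, hP, h, fun m' h' => (coeff_component_of_eq h' P).symm⟩
        -- An initial form is homogeneous, so in any other weight its component is zero and 0 serves
        -- as witness.
        · refine ⟨0, zero_mem S, fun m' h' => absurd (E.coeff_zero m') h', fun m' h' => ?_⟩
          rw [E.coeff_zero, coeff_component_of_ne (h' ▸ hr)]
    · refine ⟨Set.Finite.subset Set.finite_empty ?_, fun r => ⟨0, zero_mem S, fun m h => ?_, fun _ _ => rfl⟩⟩
      · rintro _ ⟨m, hm, -⟩
        exact hm (E.coeff_zero m)
      · exact absurd (E.coeff_zero m) h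
    · rintro x y - - ⟨hx, hx'⟩ ⟨hy, hy'⟩
      refine ⟨(hx.union hy).subset ?_, fun r => ?_⟩
      · rintro _ ⟨m, hm, rfl⟩
        by_cases h : E.coeff x m = 0
        · refine Or.inr ⟨m, fun h' => hm ?_, rfl⟩
          rw [E.coeff_add, Pi.add_apply, h, h', add_zero]
        · exact Or.inl ⟨m, h, rfl⟩
      · obtain ⟨P, hP, h1, h2⟩ := hx' r
        obtain ⟨Q, hQ, h3, h4⟩ := hy' r
        refine ⟨P + Q, add_mem hP hQ, fun m hm => ?_, fun m hm => ?_⟩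
        · by_contra h
          refine hm ?_
          rw [E.coeff_add, Pi.add_apply, not_not.1 (mt (h1 m) h), not_not.1 (mt (h3 m) h), add_zero]
        · rw [E.coeff_add, E.coeff_add, Pi.add_apply, Pi.add_apply, h2 m hm, h4 m hm]
    · rintro x - ⟨hx, hx'⟩
      refine ⟨hx.subset ?_, fun r => ?_⟩
      · rintro _ ⟨m, hm, rfl⟩
        refine ⟨m, fun h => hm ?_, rfl⟩
        rw [E.coeff_neg, h, neg_zero]
      · obtain ⟨P, hP, h1, h2⟩ := hx' r
        refine ⟨-P, neg_mem hP, fun m hm => h1 m fun h => hm ?_, fun m hm => ?_⟩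
        · rw [E.coeff_neg, h, neg_zero]
        · rw [E.coeff_neg, E.coeff_neg, h2 m hm]
  · rintro ⟨hfin, hlead⟩
    obtain ⟨F, h⟩ := hfin.exists_eq_sum
    rw [h]
    refine AddSubgroup.sum_mem _ fun r _ => ?_
    obtain ⟨P, hP, h1, h2⟩ := hlead r
    have e : component E wt r a = component E wt r P := by
      apply E.coeff_injective
      ext m
      by_cases h : wt m = r
      · rw [coeff_component_of_eq h, coeff_component_of_eq h, h2 m h]
      · rw [coeff_component_of_ne h, coeff_component_of_ne h]
    rw [e]
    exact component_mem_grOf hP h1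

end Graded

/-! ### Rings that are free modules over the power series -/

section Model

variable {k : Type*} [Field k] {n : ℕ} {X M B : Type*} [Ring X]

/-- A presentation of `X` as a free left module over the power series, compatible with the
expansions of its elements. -/
structure Model (E : Expansion k X M) (n : ℕ) (B : Type*) where
  /-- the coordinates -/
  coord : X ≃+ (B →₀ Series k n)
  /-- the exponent of `x` and the basis element of a monomial -/
  split : M ≃ (Fin n →₀ ℕ) × B
  /-- the inclusion of the power series -/
  incl : Series k n → X
  coeff_eq : ∀ P m, E.coeff P m = MvPowerSeries.coeff (split m).1 (coord P (split m).2)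
  coord_incl_mul : ∀ a P, coord (incl a * P) = a • coord P
  continuous_mul : ∀ b, ∃ d, ∀ j Q, (∀ b', coord Q b' ∈ ordIdeal k n (j + d)) →
    ∀ b', coord (coord.symm (Finsupp.single b 1) * Q) b' ∈ ordIdeal k n j

/-- The weights of the monomials `x^α e_b`. -/
def pairWeight (u : Fin n → ℝ) (ω : B → ℝ) (m : (Fin n →₀ ℕ) × B) : ℝ := dot u m.1 + ω m.2

theorem dot_add (u : Fin n → ℝ) (α β : Fin n →₀ ℕ) : dot u (α + β) = dot u α + dot u β := by
  simp [dot, mul_add, Finset.sum_add_distrib]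

theorem dot_nonpos {u : Fin n → ℝ} (hu : u ∈ Uloc n) (α : Fin n →₀ ℕ) : dot u α ≤ 0 :=
  Finset.sum_nonpos fun i _ => mul_nonpos_of_nonpos_of_nonneg (hu i) (Nat.cast_nonneg _)

/-- By Dickson's lemma the exponents are well quasi-ordered, and for u ≤ 0 the map α ↦ -u·α is
monotone, so its values on `A` are well-ordered. This is why infinite series have initial forms for
local weights, even when the weights are irrational. -/
theorem exists_max_dot {u : Fin n → ℝ} (hu : u ∈ Uloc n) {A : Set (Fin n →₀ ℕ)}
    (hA : A.Nonempty) : ∃ α ∈ A, ∀ β ∈ A, dot u β ≤ dot u α := by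
  have hmono : Monotone fun α : Fin n →₀ ℕ => -dot u α := by
    intro α β h
    have h' := dot_add u (β - α) α
    rw [tsub_add_cancel_of_le h] at h'
    exact neg_le_neg (by linarith [dot_nonpos hu (β - α)])
  have hwf := ((Set.isPWO_of_wellQuasiOrderedLE A).image_of_monotone hmono).isWF
  obtain ⟨α, hα, h⟩ := hwf.min_mem (hA.image _)
  refine ⟨α, hα, fun β hβ => ?_⟩
  have := hwf.min_le (hA.image _) ⟨β, hβ, rfl⟩
  simp only at h this
  linarith

/-- Multiplication by a monomial in x cannot raise the weight, because u ≤ 0. -/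
theorem xStable_pairWeight_le {u : Fin n → ℝ} (hu : u ∈ Uloc n) (ω : B → ℝ) (r : ℝ) :
    XStable {m | pairWeight u ω m ≤ r} := by
  intro α b γ h
  have h' : pairWeight u ω (α, b) ≤ r := h
  change dot u (γ + α) + ω b ≤ r
  rw [dot_add]
  exact (by linarith [dot_nonpos hu γ] : dot u γ + dot u α + ω b ≤ dot u α + ω b).trans h'

theorem xStable_pairWeight_lt {u : Fin n → ℝ} (hu : u ∈ Uloc n) (ω : B → ℝ) (r : ℝ) :
    XStable {m | pairWeight u ω m < r} := by
  intro α b γ h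
  have h' : pairWeight u ω (α, b) < r := h
  change dot u (γ + α) + ω b < r
  rw [dot_add]
  exact (by linarith [dot_nonpos hu γ] : dot u γ + dot u α + ω b ≤ dot u α + ω b).trans_lt h'

/-- The component of weight `t` of a power series. -/
def weightPart (u : Fin n → ℝ) (t : ℝ) (c : Series k n) : Series k n :=
  seriesPart {α | dot u α = t} c

/-- As `g` is homogeneous of weight `r - t`, only the weight `t` part of `c` contributes to `c * g`
in weight `r`. Symmetrically, that part of `c` meets only the weight `r - t` terms of `f`, which are
those of `g`. -/
theorem coeff_weightPart_mul {u : Fin n → ℝ} {ω : B → ℝ} {t r : ℝ} (c f g : Series k n) (b : B)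
    (h1 : ∀ α, pairWeight u ω (α, b) = r - t → MvPowerSeries.coeff α f = MvPowerSeries.coeff α g)
    (h2 : ∀ α, pairWeight u ω (α, b) ≠ r - t → MvPowerSeries.coeff α g = 0)
    (α : Fin n →₀ ℕ) (hα : pairWeight u ω (α, b) = r) :
    MvPowerSeries.coeff α (weightPart u t c * f) = MvPowerSeries.coeff α (c * g) := by
  rw [MvPowerSeries.coeff_mul, MvPowerSeries.coeff_mul]
  refine Finset.sum_congr rfl fun p hp => ?_
  rw [← Finset.HasAntidiagonal.mem_antidiagonal.1 hp, pairWeight, dot_add] at hα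
  by_cases hp : dot u p.1 = t
  · rw [weightPart, coeff_seriesPart_of_mem hp, h1]
    rw [pairWeight]
    linarith
  · rw [weightPart, coeff_seriesPart_of_notMem hp, zero_mul, h2, mul_zero]
    rw [pairWeight]
    intro h
    exact hp (by linarith)

theorem coeff_weightPart_mul_of_ne {u : Fin n → ℝ} {ω : B → ℝ} {t r : ℝ} (c g : Series k n) (b : B)
    (h2 : ∀ α, pairWeight u ω (α, b) ≠ r → MvPowerSeries.coeff α g = 0)
    (α : Fin n →₀ ℕ) (hα : pairWeight u ω (α, b) ≠ r + t) :
    MvPowerSeries.coeff α (weightPart u t c * g) = 0 := by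
  rw [MvPowerSeries.coeff_mul]
  refine Finset.sum_eq_zero fun p hp => ?_
  rw [← Finset.HasAntidiagonal.mem_antidiagonal.1 hp, pairWeight, dot_add] at hα
  by_cases hp : dot u p.1 = t
  · rw [h2, mul_zero]
    intro h
    apply hα
    rw [pairWeight] at h
    linarith
  · rw [weightPart, coeff_seriesPart_of_notMem hp, zero_mul]

end Model

section Model

variable {k : Type*} [Field k] {n : ℕ} {X M B : Type*} [Ring X] {E : Expansion k X M}

namespace Model

variable (D : Model E n B)

theorem coeff_coord (P : X) (α : Fin n →₀ ℕ) (b : B) :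
    MvPowerSeries.coeff α (D.coord P b) = E.coeff P (D.split.symm (α, b)) := by
  rw [D.coeff_eq, Equiv.apply_symm_apply]

theorem suppIn_coord {U : Set ((Fin n →₀ ℕ) × B)} {P : X} :
    SuppIn U (D.coord P) ↔ ∀ m, E.coeff P m ≠ 0 → D.split m ∈ U := by
  constructor
  · intro h m hm
    rw [D.coeff_eq] at hm
    exact h _ _ hm
  · intro h α b hm
    rw [coeff_coord] at hm
    simpa using h _ hm

variable {D} {u : Fin n → ℝ} {ω : B → ℝ} {wt : M → ℝ}

/-- Each of the finitely many nonzero coordinates attains its maximal weight, and the largest of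
these maxima is the order. -/
theorem hasOrders (hu : u ∈ Uloc n) (hwt : ∀ m, wt m = pairWeight u ω (D.split m)) :
    HasOrders E wt := by
  intro P hP
  have h1 : (D.coord P).support.Nonempty := by
    rw [Finset.nonempty_iff_ne_empty, ne_eq, Finsupp.support_eq_empty]
    exact fun h => hP (D.coord.map_eq_zero_iff.1 h)
  have h2 : ∀ b : B, ∃ α, b ∈ (D.coord P).support → MvPowerSeries.coeff α (D.coord P b) ≠ 0 ∧
      ∀ β, MvPowerSeries.coeff β (D.coord P b) ≠ 0 → dot u β ≤ dot u α := by
    intro b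
    by_cases hb : b ∈ (D.coord P).support
    · obtain ⟨α, h, h'⟩ := exists_max_dot hu
        (A := {α | MvPowerSeries.coeff α (D.coord P b) ≠ 0}) (by
          by_contra h
          refine Finsupp.mem_support_iff.1 hb (MvPowerSeries.ext fun α => ?_)
          by_contra h'
          exact h ⟨α, h'⟩)
      exact ⟨α, fun _ => ⟨h, h'⟩⟩
    · exact ⟨0, fun h => absurd h hb⟩
  choose α hα using h2
  obtain ⟨b, hb, h3⟩ := Finset.exists_max_image _ (fun b => dot u (α b) + ω b) h1
  refine ⟨D.split.symm (α b, b), ?_, fun m hm => ?_⟩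
  · rw [← coeff_coord]
    exact (hα b hb).1
  · rw [D.coeff_eq] at hm
    have hb' : (D.split m).2 ∈ (D.coord P).support := by
      rw [Finsupp.mem_support_iff]
      intro h
      rw [h, map_zero] at hm
      exact hm rfl
    rw [hwt, hwt, Equiv.apply_symm_apply]
    exact (add_le_add_left ((hα _ hb').2 _ hm) _).trans (h3 _ hb')

theorem coord_component (hwt : ∀ m, wt m = pairWeight u ω (D.split m)) (r : ℝ) (P : X) (b : B) :
    D.coord (component E wt r P) b = weightPart u (r - ω b) (D.coord P b) := by
  ext α
  rw [coeff_coord, weightPart]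
  have hw : wt (D.split.symm (α, b)) = dot u α + ω b := by
    rw [hwt, Equiv.apply_symm_apply]
    rfl
  by_cases h : dot u α = r - ω b
  · rw [coeff_seriesPart_of_mem h, coeff_component_of_eq (by rw [hw]; linarith), coeff_coord]
  · rw [coeff_seriesPart_of_notMem h, coeff_component_of_ne]
    rw [hw]
    exact fun h' => h (by linarith)

theorem coeff_coord_component_of_eq (hwt : ∀ m, wt m = pairWeight u ω (D.split m)) {r : ℝ}
    {α : Fin n →₀ ℕ} {b : B} (h : pairWeight u ω (α, b) = r) (P : X) :
    MvPowerSeries.coeff α (D.coord (component E wt r P) b) =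
      MvPowerSeries.coeff α (D.coord P b) := by
  rw [coeff_coord, coeff_coord, coeff_component_of_eq]
  rw [hwt, Equiv.apply_symm_apply, h]

theorem coeff_coord_component_of_ne (hwt : ∀ m, wt m = pairWeight u ω (D.split m)) {r : ℝ}
    {α : Fin n →₀ ℕ} {b : B} (h : pairWeight u ω (α, b) ≠ r) (P : X) :
    MvPowerSeries.coeff α (D.coord (component E wt r P) b) = 0 := by
  rw [coeff_coord, coeff_component_of_ne]
  rwa [hwt, Equiv.apply_symm_apply]

variable (D) in
theorem eq_sum_incl_mul (P : X) :
    P = ∑ b ∈ (D.coord P).support, D.incl (D.coord P b) * D.coord.symm (Finsupp.single b 1) := by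
  apply D.coord.injective
  rw [map_sum]
  simp only [D.coord_incl_mul, AddEquiv.apply_symm_apply, Finsupp.smul_single, smul_eq_mul, mul_one]
  exact (Finsupp.sum_single (D.coord P)).symm

section Ideals

variable [Algebra k X] {R R' : Subalgebra k X} {C : SeriesRing k n}

/-- The elements of `X` in the ideal `I`, as an additive group. -/
def idealGroup (I : Ideal R) : AddSubgroup X :=
  (Submodule.toAddSubgroup I).map (R.val : R →+ X)

theorem incl_mem (hR : ∀ P, P ∈ R ↔ ∀ b, D.coord P b ∈ C) {c : Series k n} (hc : c ∈ C) :
    D.incl c ∈ R := by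
  rw [hR, ← mul_one (D.incl c)]
  intro b
  rw [D.coord_incl_mul, Finsupp.smul_apply]
  exact mul_mem hc ((hR 1).1 (one_mem R) b)

theorem mul_mem_idealSet {I : Ideal R} {a P : X} (ha : a ∈ R) (hP : P ∈ idealSet I) :
    a * P ∈ idealSet I := by
  obtain ⟨p, hp, rfl⟩ := hP
  exact ⟨⟨a, ha⟩ * p, I.mul_mem_left _ hp, rfl⟩

variable (D) in
/-- The coordinates of the elements of an ideal, as a module over the coefficient ring. -/
def idealModule (hR : ∀ P, P ∈ R ↔ ∀ b, D.coord P b ∈ C) (I : Ideal R) :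
    Submodule C (B →₀ Series k n) where
  carrier := D.coord '' idealSet I
  add_mem' := by
    rintro _ _ ⟨P, hP, rfl⟩ ⟨Q, hQ, rfl⟩
    exact ⟨P + Q, (idealGroup I).add_mem hP hQ, map_add _ _ _⟩
  zero_mem' := ⟨0, (idealGroup I).zero_mem, map_zero _⟩
  smul_mem' := by
    rintro c _ ⟨P, hP, rfl⟩
    exact ⟨_, mul_mem_idealSet (incl_mem hR c.2) hP, D.coord_incl_mul _ _⟩

theorem idealModule_apply_mem (hR : ∀ P, P ∈ R ↔ ∀ b, D.coord P b ∈ C) {I : Ideal R}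
    (q : B →₀ Series k n) (hq : q ∈ idealModule D hR I) (b : B) : q b ∈ C := by
  obtain ⟨_, ⟨P, -, rfl⟩, rfl⟩ := hq
  exact (hR P).1 P.2 b

theorem idealSet_subset_extend (hR' : ∀ P, P ∈ R') (I : Ideal R) :
    idealSet I ⊆ idealSet (extend R' I) := fun P hP =>
  ⟨⟨P, hR' P⟩, Ideal.subset_span hP, rfl⟩

/-- The extension of an ideal is spanned by it over the power series. -/
theorem mem_idealSet_extend (hR : ∀ P, P ∈ R ↔ ∀ b, D.coord P b ∈ C) (hR' : ∀ P, P ∈ R')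
    (I : Ideal R) (P : X) :
    P ∈ idealSet (extend R' I) ↔
      D.coord P ∈ Submodule.span (Series k n) (idealModule D hR I : Set (B →₀ Series k n)) := by
  constructor
  · rintro ⟨p, hp, rfl⟩
    refine Submodule.closure_induction (R := R') (M := R')
      (s := {f : R' | (f : X) ∈ idealSet I}) (p := fun p _ => D.coord (p : X) ∈ Submodule.span _ _)
      ?_ ?_ ?_ hp
    · exact (map_zero D.coord).symm ▸ zero_mem _
    · intro x y _ _ hx hy
      exact (map_add D.coord _ _).symm ▸ add_mem hx hy
    · rintro a x hx
      change D.coord ((a : X) * (x : X)) ∈ _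
      -- The basis elements have coordinates 0 and 1, so they lie in `R` and send `I` to itself.
      -- Expanding `a` in the basis leaves only power series coefficients to the left of elements of
      -- `I`.
      rw [eq_sum_incl_mul D (a : X), Finset.sum_mul, map_sum]
      refine Submodule.sum_mem _ fun b _ => ?_
      rw [mul_assoc, D.coord_incl_mul]
      refine Submodule.smul_mem _ _ (Submodule.subset_span ⟨_, mul_mem_idealSet ?_ hx, rfl⟩)
      rw [hR]
      intro b'
      rw [AddEquiv.apply_symm_apply]
      classical
      rw [Finsupp.single_apply]
      split_ifs
      exacts [one_mem C, zero_mem C]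
  · intro h
    let T : Submodule (Series k n) (B →₀ Series k n) :=
      { carrier := D.coord '' idealSet (extend R' I)
        add_mem' := by
          rintro _ _ ⟨P, hP, rfl⟩ ⟨Q, hQ, rfl⟩
          exact ⟨P + Q, (idealGroup (extend R' I)).add_mem hP hQ, map_add _ _ _⟩
        zero_mem' := ⟨0, (idealGroup (extend R' I)).zero_mem, map_zero _⟩
        smul_mem' := by
          rintro c _ ⟨P, hP, rfl⟩
          exact ⟨_, mul_mem_idealSet (hR' _) hP, D.coord_incl_mul c _⟩ }
    have hT : Submodule.span (Series k n) (idealModule D hR I : Set (B →₀ Series k n)) ≤ T := by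
      rw [Submodule.span_le]
      rintro _ ⟨Q, hQ, rfl⟩
      exact ⟨Q, idealSet_subset_extend hR' I hQ, rfl⟩
    obtain ⟨Q, hQ, hQP⟩ := hT h
    rwa [← D.coord.injective hQP]

/-! ### Comparison of the initial ideals of an ideal and of its extension -/

theorem component_mem (hC : IsGood C) (hR : ∀ P, P ∈ R ↔ ∀ b, D.coord P b ∈ C) (hu : u ∈ Uloc n)
    (hwt : ∀ m, wt m = pairWeight u ω (D.split m)) (r : ℝ) {P : X} (hP : P ∈ R) :
    component E wt r P ∈ R := by
  rw [hR]
  intro b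
  rw [coord_component hwt]
  exact hC.part_mem u hu _ _ ((hR P).1 hP b)

/-- Since `R` is stable under taking components, each component of an element of `R` is its own
leading witness; finiteness of the weights is the only further condition. -/
theorem grOf_subalgebra (hC : IsGood C) (hR : ∀ P, P ∈ R ↔ ∀ b, D.coord P b ∈ C) (hu : u ∈ Uloc n)
    (hwt : ∀ m, wt m = pairWeight u ω (D.split m)) (a : X) :
    a ∈ grOf E wt (R : Set X) ↔ a ∈ R ∧ FiniteWeights E wt a := by
  have hmem := mem_grOf_iff (hasOrders hu hwt) (Subalgebra.toSubmodule R).toAddSubgroup a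
  constructor
  · intro ha
    refine ⟨?_, (hmem.1 ha).1⟩
    suffices h : grOf E wt (R : Set X) ≤ (Subalgebra.toSubmodule R).toAddSubgroup from h ha
    refine (AddSubgroup.closure_le _).2 ?_
    rintro _ ⟨P, hP, rfl⟩
    rcases eq_or_ne P 0 with rfl | h0
    · rw [initForm_zero]
      exact zero_mem _
    · obtain ⟨m, hm, h⟩ := hasOrders hu hwt P h0
      rw [initForm_eq_component hm h]
      exact component_mem hC hR hu hwt _ hP
  · rintro ⟨ha, hfin⟩
    refine hmem.2 ⟨hfin, fun r => ⟨component E wt r a, component_mem hC hR hu hwt r ha, ?_, ?_⟩⟩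
    · intro m hm
      by_contra h
      exact hm (coeff_component_of_ne (not_le.1 h).ne' a)
    · exact fun m hm => coeff_component_of_eq hm a

/-- The initial ideal of `I` consists of the elements of the initial ideal of its extension that
lie in the graded ring over `C`. -/
theorem mem_grOf_idealSet (hC : IsGood C) (hR : ∀ P, P ∈ R ↔ ∀ b, D.coord P b ∈ C)
    (hR' : ∀ P, P ∈ R') (hu : u ∈ Uloc n) (hwt : ∀ m, wt m = pairWeight u ω (D.split m))
    (I : Ideal R) (a : X) :
    a ∈ grOf E wt (idealSet I) ↔
      a ∈ grOf E wt (idealSet (extend R' I)) ∧ a ∈ grOf E wt (R : Set X) := by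
  have hI := mem_grOf_iff (hasOrders hu hwt) (idealGroup I) a
  have hI' := mem_grOf_iff (hasOrders hu hwt) (idealGroup (extend R' I)) a
  constructor
  · intro ha
    refine ⟨AddSubgroup.closure_mono (Set.image_mono (idealSet_subset_extend hR' I)) ha,
      AddSubgroup.closure_mono (Set.image_mono ?_) ha⟩
    rintro _ ⟨P, -, rfl⟩
    exact P.2
  · rintro ⟨ha, haR⟩
    rw [grOf_subalgebra hC hR hu hwt] at haR
    refine hI.2 ⟨haR.2, fun r => ?_⟩
    obtain ⟨P, hP, h1, h2⟩ := (hI'.1 ha).2 r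
    -- The component of weight `r` of `a` has coordinates in `C` and differs from `P`, an element of
    -- the extension, by terms of weight below `r`. Faithfulness replaces `P` by an element of `I`
    -- with the same property.
    obtain ⟨q, hq, hqU⟩ := hC.exists_sub_suppIn (idealModule D hR I) (idealModule_apply_mem hR)
      (xStable_pairWeight_lt hu ω r) ((mem_idealSet_extend hR hR' I P).1 hP)
      ((hR _).1 (component_mem hC hR hu hwt r haR.1)) (by
        rw [← map_sub, suppIn_coord]
        intro m hm
        rw [sub_eq_add_neg, E.coeff_add, Pi.add_apply, E.coeff_neg, ← sub_eq_add_neg] at hm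
        change pairWeight u ω (D.split m) < r
        rw [← hwt]
        by_cases h : wt m = r
        · rw [coeff_component_of_eq h, h2 m h, sub_self] at hm
          exact absurd rfl hm
        · rw [coeff_component_of_ne h, sub_zero] at hm
          exact lt_of_le_of_ne (h1 m hm) h)
    obtain ⟨Q, hQ, rfl⟩ := hq
    rw [← map_sub, suppIn_coord] at hqU
    have h3 : ∀ m, r ≤ wt m → E.coeff Q m = E.coeff (component E wt r a) m := by
      intro m hm
      by_contra h
      have h4 : wt m < r := by
        rw [hwt]
        refine hqU m fun h' => h ?_
        rw [sub_eq_add_neg, E.coeff_add, Pi.add_apply, E.coeff_neg, ← sub_eq_add_neg] at h'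
        exact (sub_eq_zero.1 h').symm
      exact absurd h4 (not_lt.2 hm)
    refine ⟨Q, hQ, fun m hm => ?_, fun m hm => ?_⟩
    · by_contra h
      refine hm ?_
      rw [h3 m (not_le.1 h).le, coeff_component_of_ne (not_le.1 h).ne']
    · rw [h3 m hm.ge, coeff_component_of_eq hm]

/-- The initial ideal of the extension of `I` is spanned over the power series by the initial
ideal of `I`. -/
theorem mem_grOf_extend (hC : IsGood C) (hR : ∀ P, P ∈ R ↔ ∀ b, D.coord P b ∈ C)
    (hR' : ∀ P, P ∈ R') (hu : u ∈ Uloc n) (hwt : ∀ m, wt m = pairWeight u ω (D.split m))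
    (I : Ideal R) (a : X) :
    a ∈ grOf E wt (idealSet (extend R' I)) ↔ FiniteWeights E wt a ∧
      D.coord a ∈ Submodule.span (Series k n) (D.coord '' (grOf E wt (idealSet I) : Set X)) := by
  have hmem := mem_grOf_iff (hasOrders hu hwt) (idealGroup I)
  have hmem' := mem_grOf_iff (hasOrders hu hwt) (idealGroup (extend R' I)) a
  constructor
  · intro ha
    obtain ⟨hfin, hlead⟩ := hmem'.1 ha
    refine ⟨hfin, ?_⟩
    obtain ⟨F, hF⟩ := hfin.exists_eq_sum
    rw [hF, map_sum]
    refine Submodule.sum_mem _ fun r _ => ?_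
    obtain ⟨P, hP, h1, h2⟩ := hlead r
    -- Flatness rules out cancellation of higher terms: `P`, of order at most `r`, is a combination
    -- of elements of `I` that themselves have order at most `r`.
    have hP' := hC.mem_span_of_suppIn (idealModule D hR I) (idealModule_apply_mem hR)
      (xStable_pairWeight_le hu ω r) ((mem_idealSet_extend hR hR' I P).1 hP) (by
        rw [suppIn_coord]
        intro m hm
        change pairWeight u ω _ ≤ r
        rw [← hwt]
        exact h1 m hm)
    -- The induction carries a bound on the weights of `y` together with its homogeneous part `z` of
    -- weight `r`, kept in the span of the initial ideal of `I`.
    have hz := Submodule.span_induction (p := fun y _ => SuppIn {m | pairWeight u ω m ≤ r} y ∧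
        ∃ z ∈ Submodule.span (Series k n) (D.coord '' (grOf E wt (idealSet I) : Set X)),
          (∀ α b, pairWeight u ω (α, b) = r →
            MvPowerSeries.coeff α (y b) = MvPowerSeries.coeff α (z b)) ∧
          ∀ α b, pairWeight u ω (α, b) ≠ r → MvPowerSeries.coeff α (z b) = 0) ?_ ?_ ?_ ?_ hP'
    · obtain ⟨-, z, hz, hz1, hz2⟩ := hz
      convert hz
      ext b α
      by_cases h : pairWeight u ω (α, b) = r
      · rw [coeff_coord_component_of_eq hwt h, ← hz1 α b h, coeff_coord, coeff_coord, h2]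
        rw [hwt, Equiv.apply_symm_apply, h]
      · rw [coeff_coord_component_of_ne hwt h, hz2 α b h]
    · rintro _ ⟨⟨Q, hQ, rfl⟩, hQ'⟩
      refine ⟨hQ', D.coord (component E wt r Q), Submodule.subset_span ⟨_, component_mem_grOf hQ ?_, rfl⟩,
        fun α b h => (coeff_coord_component_of_eq hwt h Q).symm,
        fun α b h => coeff_coord_component_of_ne hwt h Q⟩
      rw [suppIn_coord] at hQ'
      intro m hm
      rw [hwt]
      exact hQ' m hm
    · exact ⟨zero_mem (suppIn k _ (xStable_pairWeight_le hu ω r)), 0, zero_mem _,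
        fun _ _ _ => rfl, fun _ _ _ => rfl⟩
    · rintro y y' - - ⟨hy, z, hz, h3, h4⟩ ⟨hy', z', hz', h3', h4'⟩
      refine ⟨add_mem (S := Submodule _ _) (s := suppIn k _ (xStable_pairWeight_le hu ω r)) hy hy',
        z + z', add_mem hz hz', fun α b h => ?_, fun α b h => ?_⟩
      · rw [Finsupp.add_apply, Finsupp.add_apply, map_add, map_add, h3 α b h, h3' α b h]
      · rw [Finsupp.add_apply, map_add, h4 α b h, h4' α b h, add_zero]
    · rintro c y - ⟨hy, z, hz, h3, h4⟩
      -- Terms of `c` of negative weight push `y` below `r`, so the top component of `c • y` comes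
      -- from the weight 0 part of `c`.
      refine ⟨(suppIn k _ (xStable_pairWeight_le hu ω r)).smul_mem c hy,
        weightPart u 0 c • z, Submodule.smul_mem _ _ hz, fun α b h => ?_, fun α b h => ?_⟩
      · rw [Finsupp.smul_apply, Finsupp.smul_apply, smul_eq_mul, smul_eq_mul,
          coeff_weightPart_mul (ω := ω) c (z b) (z b) b (fun _ _ => rfl)
            (fun α h => h4 α b (by rwa [sub_zero] at h)) α h,
          ← sub_eq_zero, ← map_sub, ← mul_sub]
        have hlt : SuppIn {m | pairWeight u ω m < r} (y - z) := by
          intro α b h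
          rw [Finsupp.sub_apply, map_sub] at h
          change pairWeight u ω (α, b) < r
          by_cases h' : pairWeight u ω (α, b) = r
          · rw [h3 α b h', sub_self] at h
            exact absurd rfl h
          · rw [h4 α b h', sub_zero] at h
            exact lt_of_le_of_ne (hy α b h) h'
        by_contra h'
        exact (((suppIn k _ (xStable_pairWeight_lt hu ω r)).smul_mem c hlt) α b h').ne h
      · rw [Finsupp.smul_apply, smul_eq_mul]
        exact coeff_weightPart_mul_of_ne c (z b) b (fun α => h4 α b) α (by rwa [add_zero])
  · rintro ⟨hfin, ha⟩
    refine hmem'.2 ⟨hfin, ?_⟩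
    have hspan : Submodule.span (Series k n) (D.coord '' (grOf E wt (idealSet I) : Set X)) ≤
        Submodule.span (Series k n) (D.coord '' (initForm E wt '' idealSet I)) := by
      rw [Submodule.span_le]
      rintro _ ⟨b, hb, rfl⟩
      refine AddSubgroup.closure_induction (p := fun b _ => D.coord b ∈ Submodule.span (Series k n)
        (D.coord '' (initForm E wt '' idealSet I))) ?_ ?_ ?_ ?_ hb
      · exact fun x hx => Submodule.subset_span ⟨x, hx, rfl⟩
      · rw [map_zero]
        exact zero_mem _
      · intro x y _ _ hx hy
        rw [map_add]
        exact add_mem hx hy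
      · intro x _ hx
        rw [map_neg]
        exact neg_mem hx
    intro r
    suffices h : ∀ y ∈ Submodule.span (Series k n) (D.coord '' (initForm E wt '' idealSet I)),
        ∃ P ∈ idealSet (extend R' I), SuppIn {m | pairWeight u ω m ≤ r} (D.coord P) ∧
          ∀ α b, pairWeight u ω (α, b) = r →
            MvPowerSeries.coeff α (D.coord P b) = MvPowerSeries.coeff α (y b) by
      obtain ⟨P, hP, h1, h2⟩ := h _ (hspan ha)
      refine ⟨P, hP, fun m hm => ?_, fun m hm => ?_⟩
      · rw [hwt]
        exact (suppIn_coord D).1 h1 m hm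
      · rw [D.coeff_eq, D.coeff_eq, h2]
        rwa [hwt] at hm
    intro y hy
    -- This induction uses sums of single multiples of generators. It therefore suffices to lift
    -- each c·in(P), without knowing anything about the terms of `y` above weight `r`.
    refine Submodule.closure_induction ?_ ?_ ?_ hy
    · exact ⟨0, (idealGroup (extend R' I)).zero_mem,
        (map_zero D.coord).symm ▸ zero_mem (suppIn k _ (xStable_pairWeight_le hu ω r)),
        fun _ _ _ => (map_zero D.coord).symm ▸ rfl⟩
    · rintro y y' - - ⟨P, hP, h1, h2⟩ ⟨P', hP', h1', h2'⟩
      refine ⟨P + P', (idealGroup (extend R' I)).add_mem hP hP', ?_, fun α b h => ?_⟩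
      · rw [map_add]
        exact add_mem (S := Submodule _ _) (s := suppIn k _ (xStable_pairWeight_le hu ω r)) h1 h1'
      · rw [map_add, Finsupp.add_apply, Finsupp.add_apply, map_add, map_add, h2 α b h, h2' α b h]
    · rintro c _ ⟨_, ⟨P, hP, rfl⟩, rfl⟩
      rcases eq_or_ne P 0 with rfl | h0
      · refine ⟨0, (idealGroup (extend R' I)).zero_mem,
          (map_zero D.coord).symm ▸ zero_mem (suppIn k _ (xStable_pairWeight_le hu ω r)),
          fun α b _ => ?_⟩
        rw [initForm_zero, map_zero, smul_zero]
      · obtain ⟨m, hm, hmax⟩ := hasOrders hu hwt P h0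
        rw [initForm_eq_component hm hmax]
        -- Only the part of `c` of weight `r - wt m` moves the initial form of `P` to weight `r`;
        -- using that part alone keeps the whole product at weight at most `r`.
        refine ⟨D.incl (weightPart u (r - wt m) c) * P,
          mul_mem_idealSet (hR' _) (idealSet_subset_extend hR' I hP), ?_, fun α b h => ?_⟩
        · intro α b h
          rw [D.coord_incl_mul, Finsupp.smul_apply, smul_eq_mul, MvPowerSeries.coeff_mul] at h
          obtain ⟨p, hp, h⟩ := Finset.exists_ne_zero_of_sum_ne_zero h
          rw [← Finset.HasAntidiagonal.mem_antidiagonal.1 hp]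
          have h1 : dot u p.1 = r - wt m := mem_of_coeff_seriesPart_ne_zero (left_ne_zero_of_mul h)
          have h2 := right_ne_zero_of_mul h
          rw [coeff_coord] at h2
          have h3 := hmax _ h2
          rw [hwt, Equiv.apply_symm_apply] at h3
          change dot u p.2 + ω b ≤ _ at h3
          change dot u _ + ω b ≤ r
          rw [dot_add, h1]
          linarith
        · rw [D.coord_incl_mul, Finsupp.smul_apply, Finsupp.smul_apply, smul_eq_mul, smul_eq_mul]
          refine coeff_weightPart_mul (ω := ω) c _ _ b (fun α' h' => ?_) (fun α' h' => ?_) α h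
          · exact (coeff_coord_component_of_eq hwt (by rw [h', sub_sub_cancel]) P).symm
          · exact coeff_coord_component_of_ne hwt (by rwa [sub_sub_cancel] at h') P

end Ideals

end Model

end Model

/-! ### Test elements: the series 1/(1 - x_i) -/

section Geometric

variable {k : Type*} [Field k] {n : ℕ}

/-- The geometric series `∑ x_i^j`. -/
def geometric (k : Type*) [Field k] {n : ℕ} (i : Fin n) : Series k n :=
  seriesPart {α | ∀ l, l ≠ i → α l = 0} (fun _ => 1)

theorem coeff_geometric_of_mem {i : Fin n} {α : Fin n →₀ ℕ} (h : ∀ l, l ≠ i → α l = 0) :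
    MvPowerSeries.coeff α (geometric k i) = 1 :=
  coeff_seriesPart_of_mem (s := {α | ∀ l, l ≠ i → α l = 0}) h _

theorem coeff_geometric_of_notMem {i : Fin n} {α : Fin n →₀ ℕ} (h : ¬ ∀ l, l ≠ i → α l = 0) :
    MvPowerSeries.coeff α (geometric k i) = 0 :=
  coeff_seriesPart_of_notMem (s := {α | ∀ l, l ≠ i → α l = 0}) h _

theorem geometric_mul_one_sub_X (i : Fin n) :
    geometric k i * (1 - MvPowerSeries.X i) = 1 := by
  classical
  ext α
  rw [mul_comm, sub_mul, one_mul, map_sub, MvPowerSeries.X, MvPowerSeries.coeff_monomial_mul,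
    MvPowerSeries.coeff_one, one_mul]
  rcases eq_or_ne α 0 with rfl | h0
  · rw [coeff_geometric_of_mem (fun _ _ => rfl)]
    simp
  · rw [if_neg h0]
    have hα : ∀ l, l ≠ i → (α - Finsupp.single i 1 : Fin n →₀ ℕ) l = α l := fun l hl => by
      rw [Finsupp.tsub_apply, Finsupp.single_eq_of_ne hl, tsub_zero]
    by_cases h : ∀ l, l ≠ i → α l = 0
    · rw [coeff_geometric_of_mem h, if_pos, coeff_geometric_of_mem, sub_self]
      · exact fun l hl => (hα l hl).trans (h l hl)
      · by_contra h1
        refine h0 (Finsupp.ext fun l => ?_)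
        rcases eq_or_ne l i with rfl | hl
        · simpa [Finsupp.single_le_iff] using h1
        · exact h l hl
    · rw [coeff_geometric_of_notMem h, coeff_geometric_of_notMem, ite_self, sub_self]
      exact fun h' => h fun l hl => (hα l hl).symm.trans (h' l hl)

/-- It is the inverse of the polynomial 1 - x_i, whose constant term is 1. This gives `C` an element
with infinitely many terms in a single variable. -/
theorem IsGood.geometric_mem {C : SeriesRing k n} (hC : IsGood C) (i : Fin n) :
    geometric k i ∈ C := by
  have h : MvPowerSeries.constantCoeff (1 - MvPowerSeries.X i : Series k n) ≠ 0 := by simp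
  rw [(MvPowerSeries.eq_inv_iff_mul_eq_one h).2 (geometric_mul_one_sub_X i)]
  refine hC.inv_mem _ (sub_mem (one_mem _) (hC.poly_le ⟨MvPolynomial.X i, ?_⟩)) h
  exact MvPolynomial.coe_X i

end Geometric

theorem trunc_zero {k : Type*} [Field k] {n : ℕ} (j : ℕ) : trunc j (0 : Series k n) = 0 :=
  seriesPart_zero _

/-! ### Comparison of graded rings and of Gröbner fans -/

namespace Model

variable {k : Type*} [Field k] {n : ℕ} {X M B : Type*} [Ring X] {E : Expansion k X M}
  {D : Model E n B} {u u' : Fin n → ℝ} {ω ω' : B → ℝ} {wt wt' : M → ℝ}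

/-- Finitely many weights are bounded below, which bounds the exponent of each x_i with u_i < 0;
variables with u_i = 0 do not affect the weight. So the condition depends on `u` only through the
set of i with u_i < 0, and not on `ω` at all. -/
theorem finiteWeights_iff (hu : u ∈ Uloc n) (hwt : ∀ m, wt m = pairWeight u ω (D.split m)) (a : X) :
    FiniteWeights E wt a ↔
      ∃ K : ℕ, ∀ m, E.coeff a m ≠ 0 → ∀ i, u i < 0 → (D.split m).1 i ≤ K := by
  have hsupp : ∀ m, E.coeff a m ≠ 0 → (D.split m).2 ∈ (D.coord a).support := by
    intro m hm
    rw [Finsupp.mem_support_iff]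
    intro h
    rw [D.coeff_eq, h] at hm
    exact hm rfl
  constructor
  · intro ha
    obtain ⟨L, hL⟩ := Set.Finite.bddBelow ha
    obtain ⟨Z, hZ⟩ := ((D.coord a).support.image ω).bddAbove
    obtain ⟨K, hK⟩ := exists_nat_ge (∑ i, |(L - Z) / u i|)
    refine ⟨K, fun m hm i hi => ?_⟩
    -- From L ≤ u·α + ω(b) ≤ u_i α_i + Z one gets α_i ≤ (L - Z)/u_i. Summing absolute values over
    -- all indices makes the bound `K` independent of i.
    have h1 : L ≤ wt m := hL ⟨m, hm, rfl⟩
    have h2 : ω (D.split m).2 ≤ Z := hZ (Finset.mem_image_of_mem _ (hsupp m hm))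
    rw [hwt, pairWeight] at h1
    have h3 : dot u (D.split m).1 ≤ u i * (D.split m).1 i := by
      rw [dot, ← Finset.add_sum_erase _ _ (Finset.mem_univ i)]
      exact add_le_of_nonpos_right (Finset.sum_nonpos fun l _ =>
        mul_nonpos_of_nonpos_of_nonneg (hu l) (Nat.cast_nonneg _))
    have h4 : ((D.split m).1 i : ℝ) ≤ (L - Z) / u i := by
      rw [le_div_iff_of_neg hi]
      linarith
    have h5 : |(L - Z) / u i| ≤ ∑ i, |(L - Z) / u i| :=
      Finset.single_le_sum (f := fun i => |(L - Z) / u i|) (fun _ _ => abs_nonneg _)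
        (Finset.mem_univ i)
    exact_mod_cast ((h4.trans (le_abs_self _)).trans h5).trans hK
  · rintro ⟨K, hK⟩
    let f : (Fin n → Fin (K + 1)) → B → ℝ := fun p b => ∑ i, u i * ((p i : ℕ) : ℝ) + ω b
    refine (Set.Finite.image2 f Set.finite_univ (D.coord a).support.finite_toSet).subset ?_
    rintro _ ⟨m, hm, rfl⟩
    refine ⟨fun i => ⟨min ((D.split m).1 i) K, Nat.lt_succ_of_le (min_le_right _ _)⟩, trivial,
      (D.split m).2, hsupp m hm, ?_⟩
    rw [hwt, pairWeight, dot]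
    refine congrArg (· + ω (D.split m).2) ?_
    refine Finset.sum_congr rfl fun i _ => ?_
    rcases (hu i).lt_or_eq with h | h
    · have := hK m hm i h
      simp only [min_eq_left this]
    · rw [h, zero_mul, zero_mul]

/-- Coefficients stand on the left and cost no precision, so the loss `d` is the largest one over
the basis elements in `S`, uniformly in `P`. -/
theorem exists_continuous_mul (S : Finset B) : ∃ d, ∀ j P Q, (D.coord P).support ⊆ S →
    (∀ b, D.coord Q b ∈ ordIdeal k n (j + d)) → ∀ b, D.coord (P * Q) b ∈ ordIdeal k n j := by
  choose d hd using D.continuous_mul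
  refine ⟨S.sup d, fun j P Q hP hQ b => ?_⟩
  rw [eq_sum_incl_mul D P, Finset.sum_mul, map_sum, Finsupp.finsetSum_apply]
  refine Ideal.sum_mem _ fun b' hb' => ?_
  rw [mul_assoc, D.coord_incl_mul, Finsupp.smul_apply]
  refine Ideal.mul_mem_left _ _ (hd b' j Q (fun b => ordIdeal_anti ?_ (hQ b)) b)
  exact Nat.add_le_add_left (Finset.le_sup (hP hb')) j

theorem coord_mul_mem_left {j : ℕ} {P : X} (hP : ∀ b, D.coord P b ∈ ordIdeal k n j)
    (Q : X) (b : B) :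
    D.coord (P * Q) b ∈ ordIdeal k n j := by
  rw [eq_sum_incl_mul D P, Finset.sum_mul, map_sum, Finsupp.finsetSum_apply]
  refine Ideal.sum_mem _ fun b' _ => ?_
  rw [mul_assoc, D.coord_incl_mul, Finsupp.smul_apply]
  exact Ideal.mul_mem_right _ _ (hP b')

/-- The multiplication of the graded ring is determined by truncations. -/
theorem grMul_congr (hwt : ∀ m, wt m = pairWeight u ω (D.split m)) {S : Finset B} {d j : ℕ}
    (hd : ∀ j P Q, (D.coord P).support ⊆ S →
      (∀ b, D.coord Q b ∈ ordIdeal k n (j + d)) → ∀ b, D.coord (P * Q) b ∈ ordIdeal k n j)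
    {a a' b b' : X} (ha' : (D.coord a').support ⊆ S)
    (haa' : ∀ c, D.coord (a - a') c ∈ ordIdeal k n j)
    (hbb' : ∀ c, D.coord (b - b') c ∈ ordIdeal k n (j + d)) (m : M)
    (hm : (D.split m).1.degree < j) : grMul E wt a b m = grMul E wt a' b' m := by
  have hsub : ∀ r (P Q : X), component E wt r (P - Q) = component E wt r P - component E wt r Q := by
    intro r P Q
    apply D.coord.injective
    refine Finsupp.ext fun c => ?_
    rw [map_sub, Finsupp.sub_apply, coord_component hwt, coord_component hwt, coord_component hwt,
      map_sub, Finsupp.sub_apply]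
    ext α
    rw [map_sub, weightPart, weightPart, weightPart, coeff_seriesPart, coeff_seriesPart,
      coeff_seriesPart, map_sub]
    split_ifs
    · rfl
    · rw [sub_self]
  have hcomp : ∀ r (P : X) i, (∀ c, D.coord P c ∈ ordIdeal k n i) →
      ∀ c, D.coord (component E wt r P) c ∈ ordIdeal k n i := by
    intro r P i hP c
    rw [coord_component hwt]
    exact seriesPart_mem_ordIdeal _ (hP c)
  have hsupp : ∀ r, (D.coord (component E wt r a')).support ⊆ S := by
    intro r c hc
    refine ha' ?_
    rw [Finsupp.mem_support_iff] at hc ⊢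
    intro h
    refine hc ?_
    rw [coord_component hwt, h, weightPart, seriesPart_zero]
  refine finsum_congr fun r => ?_
  -- In the first summand the left factor has high order, which multiplication on the right
  -- preserves. In the second the right factor does, with the loss `d` compensated; this `d` works
  -- for every `r` because components do not enlarge the support.
  have h : component E wt r a * component E wt (wt m - r) b -
      component E wt r a' * component E wt (wt m - r) b' =
      component E wt r (a - a') * component E wt (wt m - r) b +
        component E wt r a' * component E wt (wt m - r) (b - b') := by
    rw [hsub, hsub]
    noncomm_ring
  rw [D.coeff_eq, D.coeff_eq, ← sub_eq_zero, ← map_sub, ← Finsupp.sub_apply, ← map_sub, h, map_add,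
    Finsupp.add_apply]
  exact add_mem (coord_mul_mem_left (hcomp _ _ _ haa') _ _)
    (hd j _ _ (hsupp r) (hcomp _ _ _ hbb') _) _ hm

variable (D) in
/-- The truncation of all coordinates. -/
def truncate (j : ℕ) (a : X) : X :=
  D.coord.symm ((D.coord a).mapRange (trunc j) (trunc_zero j))

theorem coord_truncate (j : ℕ) (a : X) (b : B) :
    D.coord (truncate D j a) b = trunc j (D.coord a b) := by
  rw [truncate, AddEquiv.apply_symm_apply, Finsupp.mapRange_apply]

theorem coord_sub_truncate_mem (j : ℕ) (a : X) (b : B) :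
    D.coord (a - truncate D j a) b ∈ ordIdeal k n j := by
  rw [map_sub, Finsupp.sub_apply, coord_truncate]
  exact sub_trunc_mem j _

theorem support_coord_truncate (j : ℕ) (a : X) :
    (D.coord (truncate D j a)).support ⊆ (D.coord a).support := by
  rw [truncate, AddEquiv.apply_symm_apply]
  exact Finsupp.support_mapRange

variable [Algebra k X] {R R' : Subalgebra k X} {C : SeriesRing k n}

/-- If u_i = 0 while u'_i < 0, then 1/(1 - x_i) on a basis element has a single weight for `wt` and
infinitely many for `wt'`, so it lies in the first graded ring over `C` only. -/
theorem neg_of_grOf_le [Nonempty B] (hC : IsGood C) (hR : ∀ P, P ∈ R ↔ ∀ b, D.coord P b ∈ C)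
    (hu : u ∈ Uloc n) (hu' : u' ∈ Uloc n) (hwt : ∀ m, wt m = pairWeight u ω (D.split m))
    (hwt' : ∀ m, wt' m = pairWeight u' ω' (D.split m))
    (h : grOf E wt (R : Set X) ≤ grOf E wt' (R : Set X)) (i : Fin n) (hi : u' i < 0) : u i < 0 := by
  by_contra h0
  obtain ⟨b⟩ := ‹Nonempty B›
  classical
  let a : X := D.coord.symm (Finsupp.single b (geometric k i))
  have ha : D.coord a = Finsupp.single b (geometric k i) := D.coord.apply_symm_apply _
  have haR : a ∈ R := by
    rw [hR, ha]
    intro b'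
    rw [Finsupp.single_apply]
    split_ifs
    exacts [hC.geometric_mem i, zero_mem C]
  have hfin : FiniteWeights E wt a := by
    rw [finiteWeights_iff hu hwt]
    refine ⟨0, fun m hm l hl => ?_⟩
    rw [D.coeff_eq, ha, Finsupp.single_apply] at hm
    split_ifs at hm
    · by_contra h1
      refine hm (coeff_geometric_of_notMem fun h2 => h1 ?_)
      rw [h2 l]
      rintro rfl
      exact h0 hl
    · exact absurd rfl hm
  have h1 := h ((grOf_subalgebra hC hR hu hwt a).2 ⟨haR, hfin⟩)
  obtain ⟨K, hK⟩ := (finiteWeights_iff hu' hwt' a).1 ((grOf_subalgebra hC hR hu' hwt' a).1 h1).2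
  have h2 := hK (D.split.symm (Finsupp.single i (K + 1), b)) (by
    rw [← coeff_coord, ha, Finsupp.single_eq_same, coeff_geometric_of_mem]
    · exact one_ne_zero
    · exact fun l hl => Finsupp.single_eq_of_ne hl) i hi
  simp at h2

theorem mem_grOf_top (hR' : ∀ P, P ∈ R') (hu : u ∈ Uloc n)
    (hwt : ∀ m, wt m = pairWeight u ω (D.split m)) (a : X) :
    a ∈ grOf E wt (R' : Set X) ↔ FiniteWeights E wt a := by
  refine (mem_grOf_iff (hasOrders hu hwt) (Subalgebra.toSubmodule R').toAddSubgroup a).trans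
    ⟨fun h => h.1, fun h => ⟨h, fun r => ⟨component E wt r a, hR' _, fun m hm => ?_, fun m hm =>
      coeff_component_of_eq hm a⟩⟩⟩
  by_contra h
  exact hm (coeff_component_of_ne (not_le.1 h).ne' a)

theorem truncate_mem_grOf (hC : IsGood C) (hR : ∀ P, P ∈ R ↔ ∀ b, D.coord P b ∈ C)
    (hu : u ∈ Uloc n) (hwt : ∀ m, wt m = pairWeight u ω (D.split m)) (j : ℕ) (a : X) :
    truncate D j a ∈ grOf E wt (R : Set X) := by
  rw [grOf_subalgebra hC hR hu hwt, hR, finiteWeights_iff hu hwt]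
  refine ⟨fun b => ?_, j, fun m hm i _ => ?_⟩
  · rw [coord_truncate]
    exact hC.poly_le (trunc_mem_polyRing _ _)
  · rw [D.coeff_eq, coord_truncate] at hm
    have h : (D.split m).1.degree < j := mem_of_coeff_seriesPart_ne_zero hm
    exact (Finsupp.le_degree i _).trans h.le

/-- The graded rings over `C` agree for two weights if and only if those over the power series
do. -/
theorem sameGr_iff [Nonempty B] (hC : IsGood C) (hR : ∀ P, P ∈ R ↔ ∀ b, D.coord P b ∈ C)
    (hR' : ∀ P, P ∈ R') (hu : u ∈ Uloc n) (hu' : u' ∈ Uloc n)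
    (hwt : ∀ m, wt m = pairWeight u ω (D.split m))
    (hwt' : ∀ m, wt' m = pairWeight u' ω' (D.split m)) :
    SameGr E wt wt' (R : Set X) ↔ SameGr E wt wt' (R' : Set X) := by
  have hsub : ∀ a, a ∈ grOf E wt (R : Set X) → a ∈ grOf E wt (R' : Set X) := fun a ha =>
    AddSubgroup.closure_mono (Set.image_mono fun P _ => hR' P) ha
  constructor
  · rintro ⟨h1, h2⟩
    refine ⟨?_, fun a _ b _ => ?_⟩
    · ext a
      rw [mem_grOf_top hR' hu hwt, mem_grOf_top hR' hu' hwt', finiteWeights_iff hu hwt,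
        finiteWeights_iff hu' hwt']
      have h3 : ∀ i, u i < 0 ↔ u' i < 0 := fun i =>
        ⟨neg_of_grOf_le hC hR hu' hu hwt' hwt h1.ge i,
          neg_of_grOf_le hC hR hu hu' hwt hwt' h1.le i⟩
      simp only [h3]
    · ext m
      obtain ⟨d, hd⟩ := exists_continuous_mul (D := D) (D.coord a).support
      -- The x-degree of `m` must be strictly below the truncation order; the right factor is kept
      -- to the further precision `d` lost by multiplication.
      let j := (D.split m).1.degree + 1
      rw [grMul_congr hwt hd (support_coord_truncate j a) (coord_sub_truncate_mem j a)
          (coord_sub_truncate_mem (j + d) b) m (Nat.lt_succ_self _),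
        grMul_congr hwt' hd (support_coord_truncate j a) (coord_sub_truncate_mem j a)
          (coord_sub_truncate_mem (j + d) b) m (Nat.lt_succ_self _),
        h2 _ (truncate_mem_grOf hC hR hu hwt j a) _ (truncate_mem_grOf hC hR hu hwt (j + d) b)]
  · rintro ⟨h1, h2⟩
    refine ⟨?_, fun a ha b hb => h2 a (hsub a ha) b (hsub b hb)⟩
    ext a
    rw [grOf_subalgebra hC hR hu hwt, grOf_subalgebra hC hR hu' hwt', ← mem_grOf_top hR' hu hwt,
      ← mem_grOf_top hR' hu' hwt', h1]

/-- The Gröbner fan of an ideal over `C` is that of its extension to the power series. -/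
theorem groebnerFan_extend [Nonempty B] (hC : IsGood C) (hR : ∀ P, P ∈ R ↔ ∀ b, D.coord P b ∈ C)
    (hR' : ∀ P, P ∈ R') {W : Type*} {Ω : Set W} {wt : W → M → ℝ}
    (hwt : ∀ w ∈ Ω, ∃ u ∈ Uloc n, ∃ ω : B → ℝ, ∀ m, wt w m = pairWeight u ω (D.split m))
    (I : Ideal R) : groebnerFan E wt Ω I = groebnerFan E wt Ω (extend R' I) := by
  refine Set.image_congr fun w hw => ?_
  obtain ⟨u, hu, ω, h⟩ := hwt w hw
  ext w'
  refine and_congr_right fun hw' => ?_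
  obtain ⟨u', hu', ω', h'⟩ := hwt w' hw'
  rw [sameGr_iff hC hR hR' hu hu' h h']
  refine and_congr_right fun hgr => ⟨fun hI => ?_, fun hI => ?_⟩
  -- Each initial ideal is recovered from the other: by spanning over k[[x]] in one direction, by
  -- intersecting with the graded ring over `C` in the other.
  · ext a
    rw [mem_grOf_extend hC hR hR' hu h, mem_grOf_extend hC hR hR' hu' h', hI,
      ← mem_grOf_top hR' hu h, ← mem_grOf_top hR' hu' h', hgr.1]
  · ext a
    rw [mem_grOf_idealSet hC hR hR' hu h, mem_grOf_idealSet hC hR hR' hu' h', hI,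
      ((sameGr_iff hC hR hR' hu hu' h h').2 hgr).1]

end Model

/-! ### Operators with coefficients in a subring -/

namespace DiffOp

section

variable {k A : Type*} [CommRing k] [CommRing A] [Algebra k A] {n : ℕ}
  (δ : Fin n → Derivation k A A)

theorem eq_sum_mono (P : DiffOp δ) :
    P = ∑ β ∈ (normalForm δ P).support, mono δ β (normalForm δ P β) := by
  apply (normalForm δ).injective
  simp only [mono, map_sum, LinearEquiv.apply_symm_apply]
  exact (Finsupp.sum_single (normalForm δ P)).symm

theorem normalForm_mono_mem {S : AddSubgroup A} {a : A} (ha : a ∈ S) (β γ : Fin n →₀ ℕ) :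
    normalForm δ (mono δ β a) γ ∈ S := by
  classical
  rw [mono, LinearEquiv.apply_symm_apply, Finsupp.single_apply]
  split_ifs
  exacts [ha, zero_mem S]

theorem normalForm_derivAct_mem {S T : AddSubgroup A} (hST : S ≤ T) {i : Fin n}
    (hδ : ∀ a ∈ S, δ i a ∈ T) {P : DiffOp δ} (hP : ∀ β, normalForm δ P β ∈ S) (γ : Fin n →₀ ℕ) :
    normalForm δ (derivAct δ i P) γ ∈ T := by
  rw [eq_sum_mono δ P, map_sum, map_sum, Finsupp.finsetSum_apply]
  refine sum_mem fun β _ => ?_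
  rw [derivAct_mono, map_add, Finsupp.add_apply]
  exact add_mem (normalForm_mono_mem δ (hST (hP β)) _ _) (normalForm_mono_mem δ (hδ _ (hP β)) _ _)

variable [hδ : Fact (∀ i j a, δ i (δ j a) = δ j (δ i a))]

/-- Each ∂_i costs at most one step of the filtration, hence ∂^β at most |β|. A constant filtration
gives stability of operators over a subring; the filtration by order of vanishing gives continuity
of multiplication. -/
theorem normalForm_powAct_mem {S : ℕ → AddSubgroup A} (hS : Antitone S)
    (hδ : ∀ i j, ∀ a ∈ S (j + 1), δ i a ∈ S j) (β : Fin n →₀ ℕ) :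
    ∀ {j : ℕ} {P : DiffOp δ}, (∀ γ, normalForm δ P γ ∈ S (j + β.degree)) →
      ∀ γ, normalForm δ (powAct δ β P) γ ∈ S j := by
  induction β using induction_exponent with
  | zero =>
    intro j P hP γ
    rw [powAct_zero]
    exact hS (Nat.le_add_right _ _) (hP γ)
  | add β i h =>
    intro j P hP γ
    rw [powAct_add_single, Module.End.mul_apply]
    refine normalForm_derivAct_mem δ (hS (Nat.le_succ j)) (hδ i j) (h fun γ => ?_) γ
    have := hP γ
    rwa [map_add, Finsupp.degree_single, add_comm β.degree, ← add_assoc] at this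

theorem mono_zero_mul (a : A) (P : DiffOp δ) : mono δ 0 a * P = a • P := by
  rw [mul_def, act_mono, powAct_zero, Module.End.one_apply]

theorem algebraMap_eq (r : k) : algebraMap k (DiffOp δ) r = mono δ 0 (algebraMap k A r) := by
  rw [Algebra.algebraMap_eq_smul_one, Algebra.algebraMap_eq_smul_one]
  exact (map_smul (monoHom δ 0) r 1).symm

/-- The operators with coefficients in a subring stable under the derivations. -/
def opsOver (S : Subalgebra k A) (hS : ∀ i, ∀ a ∈ S, δ i a ∈ S) : Subalgebra k (DiffOp δ) where
  carrier := {P | ∀ β, normalForm δ P β ∈ S}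
  add_mem' {P Q} hP hQ β := by
    rw [map_add, Finsupp.add_apply]
    exact add_mem (hP β) (hQ β)
  mul_mem' {P Q} hP hQ γ := by
    rw [mul_def, eq_sum_mono δ P, map_sum, LinearMap.sum_apply, map_sum, Finsupp.finsetSum_apply]
    refine sum_mem fun β _ => ?_
    rw [act_mono, map_smul, Finsupp.smul_apply]
    exact mul_mem (hP β) (normalForm_powAct_mem δ
      (S := fun _ => (Subalgebra.toSubmodule S).toAddSubgroup) antitone_const
      (fun i _ => hS i) β (j := 0) hQ γ)
  algebraMap_mem' r β := by
    rw [algebraMap_eq]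
    exact normalForm_mono_mem δ (S := (Subalgebra.toSubmodule S).toAddSubgroup)
      (S.algebraMap_mem r) 0 β

theorem mem_opsOver {S : Subalgebra k A} {hS : ∀ i, ∀ a ∈ S, δ i a ∈ S} {P : DiffOp δ} :
    P ∈ opsOver δ S hS ↔ ∀ β, normalForm δ P β ∈ S := Iff.rfl

theorem mono_mem_opsOver {S : Subalgebra k A} {hS : ∀ i, ∀ a ∈ S, δ i a ∈ S} {a : A} (ha : a ∈ S)
    (β : Fin n →₀ ℕ) : mono δ β a ∈ opsOver δ S hS :=
  normalForm_mono_mem δ (S := (Subalgebra.toSubmodule S).toAddSubgroup) ha β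

theorem mono_one_mem {T : Subalgebra k (DiffOp δ)} (hT : ∀ i, del δ i ∈ T) (β : Fin n →₀ ℕ) :
    mono δ β 1 ∈ T := by
  induction β using induction_exponent with
  | zero => exact one_mem T
  | add β i h =>
    have e : mono δ (β + Finsupp.single i 1) 1 = del δ i * mono δ β 1 := by
      have h1 := powAct_add_single δ 0 i
      rw [zero_add, powAct_zero, mul_one] at h1
      rw [mul_def, del, act_mono, one_smul, h1, derivAct_mono]
      simp [mono]
    rw [e]
    exact mul_mem (hT i) h

theorem opsOver_le {S : Subalgebra k A} {hS : ∀ i, ∀ a ∈ S, δ i a ∈ S}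
    {T : Subalgebra k (DiffOp δ)} (hcoe : ∀ a ∈ S, coe δ a ∈ T) (hdel : ∀ i, del δ i ∈ T) :
    opsOver δ S hS ≤ T := by
  intro P hP
  rw [eq_sum_mono δ P]
  refine sum_mem fun β _ => ?_
  rw [← mul_one (normalForm δ P β), ← mono_smul, ← mono_zero_mul]
  exact mul_mem (hcoe _ (hP β)) (mono_one_mem δ hdel β)

/-- The inclusion of the coefficients. -/
def coeHom : A →+* DiffOp δ where
  toFun := coe δ
  map_one' := rfl
  map_mul' := coe_mul δ
  map_zero' := (monoHom δ 0).map_zero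
  map_add' := mono_add δ 0

end

end DiffOp

section Rings

variable {k : Type*} [Field k] {n : ℕ}

/-- Operators with normal form over `C` form a subring because `C` is stable under the derivations;
it contains the generators, and each of its elements is visibly a polynomial in them. -/
theorem mem_diffOps {C : SeriesRing k n} (hC : ∀ i, ∀ f ∈ C, partials k n i f ∈ C) (P : Dhat k n) :
    P ∈ diffOps C ↔ ∀ β, DiffOp.normalForm _ P β ∈ C := by
  suffices h : diffOps C = DiffOp.opsOver (partials k n) C hC by rw [h, DiffOp.mem_opsOver]
  apply le_antisymm
  · refine Algebra.adjoin_le ?_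
    rintro _ (⟨c, hc, rfl⟩ | ⟨i, rfl⟩)
    · exact DiffOp.mono_mem_opsOver _ hc 0
    · exact DiffOp.mono_mem_opsOver _ (one_mem C) _
  · exact DiffOp.opsOver_le _ (fun c hc => Algebra.subset_adjoin (Or.inl ⟨c, hc, rfl⟩))
      fun i => Algebra.subset_adjoin (Or.inr ⟨i, rfl⟩)

/-- The polynomials in `h` with coefficients in `C`. -/
def polynomialsOver (C : SeriesRing k n) : Subalgebra k (Series k n)[X] where
  carrier := {p | ∀ j, p.coeff j ∈ C}
  add_mem' {p q} hp hq j := by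
    rw [Polynomial.coeff_add]
    exact add_mem (hp j) (hq j)
  mul_mem' {p q} hp hq j := by
    rw [Polynomial.coeff_mul]
    exact sum_mem fun x _ => mul_mem (hp _) (hq _)
  algebraMap_mem' r j := by
    rw [Polynomial.algebraMap_apply, Polynomial.coeff_C]
    split_ifs
    exacts [C.algebraMap_mem r, zero_mem C]

theorem hPartials_mem_polynomialsOver {C : SeriesRing k n}
    (hC : ∀ i, ∀ f ∈ C, partials k n i f ∈ C) (i : Fin n) (p : (Series k n)[X])
    (hp : p ∈ polynomialsOver C) : hPartials k n i p ∈ polynomialsOver C := by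
  rintro (_ | j)
  · rw [coeff_hPartials_zero]
    exact zero_mem C
  · rw [coeff_hPartials_succ]
    exact hC i _ (hp j)

theorem mem_hdiffOps {C : SeriesRing k n} (hC : ∀ i, ∀ f ∈ C, partials k n i f ∈ C)
    (P : HDhat k n) :
    P ∈ hdiffOps C ↔ ∀ β j, (DiffOp.normalForm _ P β).coeff j ∈ C := by
  suffices h : hdiffOps C = DiffOp.opsOver (hPartials k n) (polynomialsOver C)
      (hPartials_mem_polynomialsOver hC) by
    rw [h, DiffOp.mem_opsOver]
    rfl
  apply le_antisymm
  · refine Algebra.adjoin_le ?_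
    rintro _ ((⟨c, hc, rfl⟩ | ⟨i, rfl⟩) | rfl)
    · refine DiffOp.mono_mem_opsOver _ (fun j => ?_) 0
      rw [Polynomial.coeff_C]
      split_ifs
      exacts [hc, zero_mem C]
    · exact DiffOp.mono_mem_opsOver _ (one_mem (polynomialsOver C)) _
    · refine DiffOp.mono_mem_opsOver _ (fun j => ?_) 0
      rw [Polynomial.coeff_X]
      split_ifs
      exacts [one_mem C, zero_mem C]
  · refine DiffOp.opsOver_le _ (fun p hp => ?_)
      fun i => Algebra.subset_adjoin (Or.inl (Or.inr ⟨i, rfl⟩))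
    change DiffOp.coeHom (hPartials k n) p ∈ _
    rw [p.as_sum_support_C_mul_X_pow, map_sum]
    refine sum_mem fun j _ => ?_
    rw [map_mul, map_pow]
    have h1 : DiffOp.coeHom (hPartials k n) (Polynomial.C (p.coeff j)) ∈ hdiffOps C :=
      Algebra.subset_adjoin (Or.inl (Or.inl ⟨_, hp j, rfl⟩))
    have h2 : DiffOp.coeHom (hPartials k n) Polynomial.X ∈ hdiffOps C :=
      Algebra.subset_adjoin (Or.inr rfl)
    exact mul_mem h1 (pow_mem h2 j)

end Rings

/-! ### The models of the three rings -/

section Models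

variable (k : Type*) [Field k] (n : ℕ)

/-- A power series as a family with one member. -/
def seriesCoord : Series k n ≃+ (Unit →₀ Series k n) where
  toFun := Finsupp.single ()
  invFun y := y ()
  left_inv _ := Finsupp.single_eq_same
  right_inv _ := Finsupp.ext fun _ => Finsupp.single_eq_same
  map_add' := Finsupp.single_add ()

theorem seriesCoord_apply (f : Series k n) (b : Unit) : seriesCoord k n f b = f :=
  Finsupp.single_eq_same

/-- The power series as a free module of rank one. -/
def seriesModel : Model (seriesExpansion k n) n Unit where
  coord := seriesCoord k n
  split := (Equiv.prodPUnit _).symm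
  incl := id
  coeff_eq P m := by
    rw [seriesCoord_apply]
    rfl
  coord_incl_mul a P := (Finsupp.smul_single a () P).symm
  continuous_mul b := ⟨0, fun j Q hQ b' => by
    have h : (seriesCoord k n).symm (Finsupp.single b 1) = 1 := Finsupp.single_eq_same
    rw [h, one_mul]
    exact hQ b'⟩

theorem partials_mem_ordIdeal (i : Fin n) (j : ℕ) (f : Series k n)
    (hf : f ∈ ordIdeal k n (j + 1)) : partials k n i f ∈ ordIdeal k n j := by
  intro α hα
  rw [partials, MvPowerSeries.coeff_pderiv, hf, zero_mul]
  rw [map_add, Finsupp.degree_single]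
  omega

/-- The operators as a free module with basis `∂^β`. -/
def opModel : Model (opExpansion k n) n (Fin n →₀ ℕ) where
  coord := (DiffOp.normalForm (partials k n)).toAddEquiv
  split := Equiv.refl _
  incl := DiffOp.coe (partials k n)
  coeff_eq P m := rfl
  coord_incl_mul a P := by
    rw [DiffOp.coe, DiffOp.mono_zero_mul]
    exact map_smul (DiffOp.normalForm (partials k n)) a P
  continuous_mul β := ⟨β.degree, fun j Q hQ γ => by
    change DiffOp.normalForm _ (DiffOp.mono _ β 1 * Q) γ ∈ _
    rw [DiffOp.mul_def, DiffOp.act_mono, one_smul]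
    exact DiffOp.normalForm_powAct_mem _
      (S := fun j => (ordIdeal k n j).toAddSubgroup)
      (fun _ _ h => ordIdeal_anti h) (partials_mem_ordIdeal k n) β hQ γ⟩

/-- The polynomials in `h` all of whose coefficients have order at least `j`. -/
def ordPolynomials (j : ℕ) : AddSubgroup (Series k n)[X] where
  carrier := {p | ∀ i, p.coeff i ∈ ordIdeal k n j}
  zero_mem' i := by
    rw [Polynomial.coeff_zero]
    exact zero_mem _
  add_mem' {p q} hp hq i := by
    rw [Polynomial.coeff_add]
    exact add_mem (hp i) (hq i)
  neg_mem' {p} hp i := by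
    rw [Polynomial.coeff_neg]
    exact neg_mem (hp i)

/-- The coordinates of a homogenized operator. -/
def hopCoord : HDhat k n ≃+ ((Fin n →₀ ℕ) × ℕ →₀ Series k n) :=
  ((DiffOp.normalForm (hPartials k n)).toAddEquiv.trans
    (Finsupp.mapRange.addEquiv (Polynomial.basisMonomials (Series k n)).repr.toAddEquiv)).trans
    (Finsupp.curryAddEquiv).symm

theorem hopCoord_apply (P : HDhat k n) (β : Fin n →₀ ℕ) (j : ℕ) :
    hopCoord k n P (β, j) = (DiffOp.normalForm _ P β).coeff j := rfl

/-- The homogenized operators as a free module with basis `∂^β h^j`. -/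
def hopModel : Model (hopExpansion k n) n ((Fin n →₀ ℕ) × ℕ) where
  coord := hopCoord k n
  split := Equiv.refl _
  incl a := DiffOp.coe (hPartials k n) (Polynomial.C a)
  coeff_eq P m := rfl
  coord_incl_mul a P := by
    ext1 ⟨β, j⟩
    rw [hopCoord_apply, DiffOp.coe, DiffOp.mono_zero_mul, map_smul, Finsupp.smul_apply,
      smul_eq_mul, Polynomial.coeff_C_mul]
    rfl
  continuous_mul := by
    rintro ⟨β, i⟩
    -- The central factor h^i only shifts the h-degree, so the loss of order is due to ∂^β alone.
    refine ⟨β.degree, fun j Q hQ => ?_⟩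
    have h : (hopCoord k n).symm (Finsupp.single (β, i) 1) =
        DiffOp.mono (hPartials k n) β (Polynomial.X ^ i) := by
      rw [AddEquiv.symm_apply_eq]
      ext1 ⟨γ, l⟩
      classical
      rw [hopCoord_apply, DiffOp.mono, LinearEquiv.apply_symm_apply, Finsupp.single_apply,
        Finsupp.single_apply]
      by_cases h1 : β = γ
      · simp [h1, Polynomial.coeff_X_pow, eq_comm]
      · simp [h1]
    rintro ⟨γ, l⟩
    rw [h, hopCoord_apply, DiffOp.mul_def, DiffOp.act_mono, map_smul, Finsupp.smul_apply,
      smul_eq_mul, Polynomial.coeff_X_pow_mul']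
    split_ifs
    · exact DiffOp.normalForm_powAct_mem _ (S := ordPolynomials k n)
        (fun _ _ h p hp i => ordIdeal_anti h (hp i))
        (by
          rintro i j p hp (_ | l)
          · rw [coeff_hPartials_zero]
            exact zero_mem _
          · rw [coeff_hPartials_succ]
            exact partials_mem_ordIdeal k n i j _ (hp l))
        β (fun γ i => hQ (γ, i)) γ _
    · exact zero_mem _

end Models

/-! ### Invariance of the fans under extension to formal power series -/

section Fans

variable {k : Type*} [Field k] {n : ℕ} {C : SeriesRing k n}

theorem fanU_extend (hC : IsGood C) (I : Ideal C) : fanU I = fanU (extend (formalRing k n) I) := by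
  refine Model.groebnerFan_extend (D := seriesModel k n) hC (fun P => ?_) (fun P => Algebra.mem_top)
    (fun u hu => ⟨u, hu, fun _ => 0, fun m => ?_⟩) I
  · constructor
    · intro h b
      exact (seriesCoord_apply k n P b).symm ▸ h
    · intro h
      exact seriesCoord_apply k n P () ▸ h ()
  · exact (add_zero _).symm

theorem mem_diffOps_formalRing (P : Dhat k n) : P ∈ diffOps (formalRing k n) :=
  (mem_diffOps (C := formalRing k n) (fun _ _ _ => Algebra.mem_top) P).2 fun _ => Algebra.mem_top

theorem mem_hdiffOps_formalRing (P : HDhat k n) : P ∈ hdiffOps (formalRing k n) :=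
  (mem_hdiffOps (C := formalRing k n) (fun _ _ _ => Algebra.mem_top) P).2
    fun _ _ => Algebra.mem_top

theorem fanW_extend (hC : IsGood C) (I : Ideal (diffOps C)) :
    fanW I = fanW (extend (diffOps (formalRing k n)) I) :=
  Model.groebnerFan_extend (D := opModel k n) hC (mem_diffOps hC.partials_mem)
    mem_diffOps_formalRing (fun w hw => ⟨w.1, fun i => (hw i).1, dot w.2, fun _ => rfl⟩) I

theorem fanH_extend (hC : IsGood C) (I : Ideal (hdiffOps C)) :
    fanH I = fanH (extend (hdiffOps (formalRing k n)) I) :=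
  Model.groebnerFan_extend (D := hopModel k n) hC
    (fun P => (mem_hdiffOps hC.partials_mem P).trans ⟨fun h b => h b.1 b.2, fun h β j => h (β, j)⟩)
    mem_hdiffOps_formalRing
    (fun w hw => ⟨w.1, fun i => (hw i).1, fun b => dot w.2 b.1, fun _ => rfl⟩) I

end Fans

/-! ### Homogenization and extension of scalars -/

section Extend

variable {k X : Type*} [Field k] [Ring X] [Algebra k X]

theorem extend_extend {R₁ R₂ R₃ : Subalgebra k X} (h₁₂ : R₁ ≤ R₂) (h₂₃ : R₂ ≤ R₃) (I : Ideal R₁) :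
    extend R₃ (extend R₂ I) = extend R₃ I := by
  apply le_antisymm
  · refine Ideal.span_le.2 ?_
    rintro ⟨_, hf⟩ ⟨g, hg, rfl⟩
    have h : ∀ g ∈ extend R₂ I, Subalgebra.inclusion h₂₃ g ∈ extend R₃ I := by
      intro g hg
      refine Submodule.span_induction (R := R₂) (s := {f : R₂ | (f : X) ∈ idealSet I})
        (p := fun g _ => Subalgebra.inclusion h₂₃ g ∈ extend R₃ I) ?_ ?_ ?_ ?_ hg
      · exact fun x hx => Ideal.subset_span hx
      · exact zero_mem _
      · intro x y _ _ hx hy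
        exact add_mem hx hy
      · intro a x _ hx
        exact Ideal.mul_mem_left _ (Subalgebra.inclusion h₂₃ a) hx
    exact h g hg
  · refine Ideal.span_mono ?_
    rintro ⟨_, hf⟩ ⟨g, hg, rfl⟩
    exact ⟨⟨g, h₁₂ g.2⟩, Ideal.subset_span ⟨g, hg, rfl⟩, rfl⟩

end Extend

section Homogenize

variable {k : Type*} [Field k] {n : ℕ}

variable (k n) in
/-- The homogenization in degree `d`, `∑ c_β ∂^β ↦ ∑ c_β ∂^β h^(d-|β|)`. -/
def homogenizeAt (d : ℕ) : Dhat k n →ₗ[k] HDhat k n :=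
  DiffOp.lift _ fun β => DiffOp.monoHom (hPartials k n) β ∘ₗ
    ((Polynomial.monomial (d - β.degree)).restrictScalars k)

theorem homogenizeAt_mono (d : ℕ) (β : Fin n →₀ ℕ) (c : Series k n) :
    homogenizeAt k n d (DiffOp.mono _ β c) =
      DiffOp.mono _ β (Polynomial.monomial (d - β.degree) c) := by
  rw [homogenizeAt, DiffOp.lift_mono]
  rfl

/-- Homogenization is not additive, since the degree varies with the operator. Fixing the degree
gives a linear map, to which induction over spans applies. -/
theorem homogenize_eq (P : Dhat k n) : homogenize P = homogenizeAt k n (opDegree P) P := by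
  conv_rhs => rw [DiffOp.eq_sum_mono _ P, map_sum, ← DiffOp.eq_sum_mono _ P]
  simp only [homogenizeAt_mono]
  rfl

theorem homogenizeAt_smul (d : ℕ) (c : Series k n) (P : Dhat k n) :
    homogenizeAt k n d (c • P) = Polynomial.C c • homogenizeAt k n d P := by
  induction P using DiffOp.induction_mono with
  | zero => rw [smul_zero, map_zero, smul_zero]
  | add P Q hP hQ => rw [smul_add, map_add, hP, hQ, map_add, smul_add]
  | single β b =>
    rw [DiffOp.mono_smul, homogenizeAt_mono, homogenizeAt_mono, DiffOp.mono_smul,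
      Polynomial.C_mul_monomial]

/-- Homogenizing in a degree above the true one only inserts extra powers of the central variable h,
so the result stays in any left ideal containing the homogenization. -/
theorem homogenizeAt_eq {d : ℕ} {P : Dhat k n} (hP : opDegree P ≤ d) :
    homogenizeAt k n d P = (Polynomial.X ^ (d - opDegree P) : (Series k n)[X]) • homogenize P := by
  rw [homogenize, Finset.smul_sum]
  conv_lhs => rw [DiffOp.eq_sum_mono _ P, map_sum]
  refine Finset.sum_congr rfl fun β hβ => ?_
  have h : β.degree ≤ opDegree P := Finset.le_sup (f := fun β : Fin n →₀ ℕ => β.degree) hβ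
  rw [homogenizeAt_mono, DiffOp.mono_smul, Polynomial.X_pow_mul_monomial,
    show opDegree P - β.degree + (d - opDegree P) = d - β.degree by omega]

variable {C : SeriesRing k n}

theorem mem_homogenizeIdeal {I : Ideal (diffOps C)} {P : diffOps C} (hP : P ∈ I) {Q : hdiffOps C}
    (hQ : (Q : HDhat k n) = homogenize (P : Dhat k n)) : Q ∈ homogenizeIdeal I :=
  Ideal.subset_span ⟨P, hP, hQ⟩

theorem homogenizeIdeal_mono {C' : SeriesRing k n} (hC : hdiffOps C ≤ hdiffOps C')
    {I : Ideal (diffOps C)} {I' : Ideal (diffOps C')} (h : idealSet I ⊆ idealSet I')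
    (Q : hdiffOps C) (hQ : Q ∈ homogenizeIdeal I) :
    Subalgebra.inclusion hC Q ∈ homogenizeIdeal I' := by
  refine Submodule.span_induction (R := hdiffOps C)
    (s := {Q : hdiffOps C | ∃ P ∈ I, (Q : HDhat k n) = homogenize (P : Dhat k n)})
    (p := fun Q _ => Subalgebra.inclusion hC Q ∈ homogenizeIdeal I') ?_ ?_ ?_ ?_ hQ
  · rintro Q ⟨P, hP, hQ⟩
    obtain ⟨P', hP', e⟩ := h ⟨P, hP, rfl⟩
    refine mem_homogenizeIdeal hP' ?_
    rw [Subalgebra.coe_inclusion, hQ, e]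
  · rw [map_zero]
    exact zero_mem _
  · intro x y _ _ hx hy
    rw [map_add]
    exact add_mem hx hy
  · intro a x _ hx
    rw [smul_eq_mul, map_mul]
    exact Ideal.mul_mem_left _ _ hx

/-- Homogenization commutes with the extension of ideals to the power series. -/
theorem homogenizeIdeal_extend (hC : IsGood C) (I : Ideal (diffOps C)) :
    homogenizeIdeal (extend (diffOps (formalRing k n)) I) =
      extend (hdiffOps (formalRing k n)) (homogenizeIdeal I) := by
  have hR := mem_diffOps hC.partials_mem
  have hhR := fun P => (mem_hdiffOps hC.partials_mem P)
  apply le_antisymm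
  · refine Ideal.span_le.2 ?_
    rintro Q ⟨P, hP, hQ⟩
    suffices h : homogenize (P : Dhat k n) ∈
        idealSet (extend (hdiffOps (formalRing k n)) (homogenizeIdeal I)) by
      obtain ⟨Q', hQ', e⟩ := h
      rwa [SetLike.mem_coe, Subtype.ext (hQ.trans e.symm)]
    let J := extend (hdiffOps (formalRing k n)) (homogenizeIdeal I)
    let d := opDegree (P : Dhat k n)
    -- Flatness with this `U` writes `P` as a combination of elements of `I` of degree at most that
    -- of `P`. All of them can then be homogenized in the common degree `d`.
    have hU : XStable {m : (Fin n →₀ ℕ) × (Fin n →₀ ℕ) | m.2.degree ≤ d} := fun α β γ h => h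
    have hP' := hC.mem_span_of_suppIn (Model.idealModule (opModel k n) hR I)
      (Model.idealModule_apply_mem hR) hU
      ((Model.mem_idealSet_extend (D := opModel k n) hR mem_diffOps_formalRing I P).1
        ⟨P, hP, rfl⟩) (by
          intro α β h
          refine Finset.le_sup (f := fun β : Fin n →₀ ℕ => β.degree) (Finsupp.mem_support_iff.2 ?_)
          intro h0
          exact h (congrArg (MvPowerSeries.coeff α) h0))
    have key := Submodule.span_induction
      (p := fun y _ => homogenizeAt k n d ((opModel k n).coord.symm y) ∈ idealSet J) ?_ ?_ ?_ ?_ hP'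
    · rwa [AddEquiv.symm_apply_apply, ← homogenize_eq] at key
    · rintro _ ⟨⟨Q, hQ, rfl⟩, hQd⟩
      have hdeg : opDegree Q ≤ d := by
        refine Finset.sup_le fun β hβ => ?_
        by_contra h
        refine Finsupp.mem_support_iff.1 hβ (MvPowerSeries.ext fun α => ?_)
        by_contra h'
        exact h (hQd α β h')
      rw [AddEquiv.symm_apply_apply, homogenizeAt_eq hdeg, ← DiffOp.mono_zero_mul]
      refine Model.mul_mem_idealSet (mem_hdiffOps_formalRing _)
        (Model.idealSet_subset_extend mem_hdiffOps_formalRing _ ?_)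
      obtain ⟨Q, hQ, rfl⟩ := hQ
      refine ⟨⟨homogenize (Q : Dhat k n), (hhR _).2 fun β j => ?_⟩,
        Ideal.subset_span ⟨Q, hQ, rfl⟩, rfl⟩
      rw [homogenize, map_sum, Finsupp.finsetSum_apply, Polynomial.finsetSum_coeff]
      refine sum_mem fun γ _ => ?_
      classical
      rw [DiffOp.mono, LinearEquiv.apply_symm_apply, Finsupp.single_apply]
      split_ifs
      · rw [Polynomial.coeff_monomial]
        split_ifs
        exacts [(hR _).1 Q.2 γ, zero_mem C]
      · exact zero_mem C
    · rw [map_zero, map_zero]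
      exact (Model.idealGroup J).zero_mem
    · intro x y _ _ hx hy
      rw [map_add, map_add]
      exact (Model.idealGroup J).add_mem hx hy
    · intro c x _ hx
      change homogenizeAt k n d (c • (opModel k n).coord.symm x) ∈ idealSet J
      rw [homogenizeAt_smul, ← DiffOp.mono_zero_mul]
      exact Model.mul_mem_idealSet (mem_hdiffOps_formalRing _) hx
  · refine Ideal.span_le.2 ?_
    rintro ⟨_, hf⟩ ⟨Q, hQ, rfl⟩
    exact homogenizeIdeal_mono (fun P _ => mem_hdiffOps_formalRing P)
      (Model.idealSet_subset_extend mem_diffOps_formalRing I) Q hQ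

theorem fanH_homogenizeIdeal (hC : IsGood C) (I : Ideal (diffOps C)) :
    fanH (homogenizeIdeal I) =
      fanH (homogenizeIdeal (extend (diffOps (formalRing k n)) I)) := by
  rw [fanH_extend hC, homogenizeIdeal_extend hC]

end Homogenize

theorem diffOps_mono {k : Type*} [Field k] {n : ℕ} {C C' : SeriesRing k n} (h : C ≤ C') :
    diffOps C ≤ diffOps C' :=
  Algebra.adjoin_mono (Set.union_subset_union_left _ (Set.image_mono h))

/-! ### The localization of the polynomial ring at the origin -/

section LocalRing

variable {k : Type*} [Field k] {n : ℕ}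

theorem mem_polyRing_iff {f : Series k n} :
    f ∈ polyRing k n ↔ {α : Fin n →₀ ℕ | MvPowerSeries.coeff α f ≠ 0}.Finite := by
  refine ⟨?_, mem_polyRing_of_finite⟩
  rintro ⟨p, rfl⟩
  refine p.support.finite_toSet.subset fun α hα => ?_
  change MvPowerSeries.coeff α (p : Series k n) ≠ 0 at hα
  rw [MvPolynomial.coeff_coe] at hα
  exact MvPolynomial.mem_support_iff.2 hα

theorem seriesPart_mem_polyRing (s : Set (Fin n →₀ ℕ)) {f : Series k n} (hf : f ∈ polyRing k n) :
    seriesPart s f ∈ polyRing k n := by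
  rw [mem_polyRing_iff] at hf ⊢
  refine hf.subset fun α hα h => hα ?_
  rw [coeff_seriesPart, h, ite_self]

theorem shift_mem_polyRing (e : Fin n →₀ ℕ) {f : Series k n} (hf : f ∈ polyRing k n) :
    shift e f ∈ polyRing k n := by
  rw [mem_polyRing_iff] at hf ⊢
  exact hf.preimage (add_left_injective e).injOn

theorem polyRing_le_localRing : polyRing k n ≤ localRing k n := by
  rintro _ ⟨p, rfl⟩
  refine ⟨p, 1, by simp, ?_⟩
  rw [MvPolynomial.coe_one, one_mul]
  rfl

theorem coe_mem_localRing (p : MvPolynomial (Fin n) k) : (p : Series k n) ∈ localRing k n :=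
  polyRing_le_localRing ⟨p, rfl⟩

theorem constantCoeff_coe (p : MvPolynomial (Fin n) k) :
    MvPowerSeries.constantCoeff (p : Series k n) = MvPolynomial.constantCoeff p := by
  rw [← MvPowerSeries.coeff_zero_eq_constantCoeff_apply, MvPolynomial.coeff_coe,
    MvPolynomial.constantCoeff_eq]

theorem inv_mem_localRing {f : Series k n} (hf : f ∈ localRing k n)
    (h0 : MvPowerSeries.constantCoeff f ≠ 0) : f⁻¹ ∈ localRing k n := by
  obtain ⟨p, q, hq, h⟩ := hf
  refine ⟨q, p, ?_, ?_⟩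
  · rw [← constantCoeff_coe, ← h, map_mul, constantCoeff_coe]
    exact mul_ne_zero hq h0
  · rw [← h, mul_assoc, MvPowerSeries.mul_inv_cancel _ h0, mul_one]

/-- The subring is a localization of k[x], at the polynomials not vanishing at the origin, so it
inherits Hilbert's basis theorem. -/
theorem isNoetherianRing_localRing : IsNoetherianRing (localRing k n) := by
  let φ : MvPolynomial (Fin n) k →+* localRing k n :=
    (MvPolynomial.coeToMvPowerSeries.ringHom (σ := Fin n) (R := k)).codRestrict
      (localRing k n).toSubring coe_mem_localRing
  let := φ.toAlgebra
  let S : Submonoid (MvPolynomial (Fin n) k) :=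
    { carrier := {q | MvPolynomial.constantCoeff q ≠ 0}
      mul_mem' := fun {a b} ha hb => by
        change MvPolynomial.constantCoeff (a * b) ≠ 0
        rw [map_mul]
        exact mul_ne_zero ha hb
      one_mem' := by
        change MvPolynomial.constantCoeff 1 ≠ 0
        simp }
  have : IsLocalization S (localRing k n) :=
    { map_units := fun q => by
        have h : MvPowerSeries.constantCoeff ((q : MvPolynomial (Fin n) k) : Series k n) ≠ 0 := by
          rw [constantCoeff_coe]
          exact q.2
        exact IsUnit.of_mul_eq_one ⟨_, inv_mem_localRing (coe_mem_localRing _) h⟩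
          (Subtype.ext (MvPowerSeries.mul_inv_cancel _ h))
      surj := fun f => by
        obtain ⟨p, q, hq, h⟩ := f.2
        exact ⟨(p, ⟨q, hq⟩), Subtype.ext ((mul_comm _ _).trans h)⟩
      exists_of_eq := fun {p q} h => ⟨1, by
        rw [MvPolynomial.coe_injective _ _ (congrArg Subtype.val h)]⟩ }
  exact IsLocalization.isNoetherianRing S _ inferInstance

/-- The denominator is a unit, so the numerator has the same order of vanishing. For polynomials,
division by variables stays inside the ring, and the membership transfers from k[x] to its
localization. -/
theorem mem_vanishing_pow_localRing (j : ℕ) (f : localRing k n)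
    (hf : (f : Series k n) ∈ ordIdeal k n j) : f ∈ vanishing (localRing k n) ^ j := by
  obtain ⟨p, q, hq, h⟩ := f.2
  have hq0 : MvPowerSeries.constantCoeff (q : Series k n) ≠ 0 := by rwa [constantCoeff_coe]
  have h1 := mem_vanishing_pow (C := polyRing k n)
    (fun i => ⟨MvPolynomial.X i, MvPolynomial.coe_X i⟩)
    (fun f hf i => shift_mem_polyRing _ (seriesPart_mem_polyRing _ hf)) j ⟨p, p, rfl⟩
    (by
      change (p : Series k n) ∈ _
      rw [← h]
      exact Ideal.mul_mem_left _ _ hf)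
  have h2 := Ideal.mem_map_of_mem (Subalgebra.inclusion polyRing_le_localRing) h1
  rw [Ideal.map_pow] at h2
  have h3 : (vanishing (polyRing k n)).map (Subalgebra.inclusion polyRing_le_localRing) ≤
      vanishing (localRing k n) := Ideal.map_le_iff_le_comap.2 fun _ h => h
  have h4 : f = ⟨_, inv_mem_localRing (coe_mem_localRing q) hq0⟩ *
      Subalgebra.inclusion polyRing_le_localRing ⟨p, p, rfl⟩ := by
    ext1
    change (f : Series k n) = (q : Series k n)⁻¹ * p
    rw [← h, ← mul_assoc, MvPowerSeries.inv_mul_cancel _ hq0, one_mul]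
  rw [h4]
  exact Ideal.mul_mem_left _ _ (Ideal.pow_right_mono h3 j h2)

theorem partials_mem_localRing (i : Fin n) {f : Series k n} (hf : f ∈ localRing k n) :
    partials k n i f ∈ localRing k n := by
  obtain ⟨p, q, hq, h⟩ := hf
  refine ⟨q * MvPolynomial.pderiv i p - p * MvPolynomial.pderiv i q, q * q, ?_, ?_⟩
  · rw [map_mul]
    exact mul_ne_zero hq hq
  · have h1 := congrArg (partials k n i) h
    rw [Derivation.leibniz, smul_eq_mul, smul_eq_mul, partials, MvPowerSeries.pderiv_coe,
      MvPowerSeries.pderiv_coe] at h1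
    have h2 : ((q * MvPolynomial.pderiv i p - p * MvPolynomial.pderiv i q : MvPolynomial (Fin n) k) :
        Series k n) = q * (MvPolynomial.pderiv i p : MvPolynomial (Fin n) k) -
          p * (MvPolynomial.pderiv i q : MvPolynomial (Fin n) k) := by
      rw [← MvPolynomial.coe_mul, ← MvPolynomial.coe_mul]
      exact map_sub (MvPolynomial.coeToMvPowerSeries.ringHom (σ := Fin n) (R := k)) _ _
    rw [h2, ← h1, MvPolynomial.coe_mul, ← h, partials]
    ring

theorem weightPart_weightPart_mul (u : Fin n → ℝ) (s t : ℝ) (c g : Series k n) :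
    weightPart u s (weightPart u t c * g) = weightPart u t c * weightPart u (s - t) g := by
  ext α
  by_cases hα : dot u α = s
  · rw [weightPart, coeff_seriesPart_of_mem hα, MvPowerSeries.coeff_mul, MvPowerSeries.coeff_mul]
    refine Finset.sum_congr rfl fun p hp => ?_
    rw [← Finset.HasAntidiagonal.mem_antidiagonal.1 hp, dot_add] at hα
    by_cases h : dot u p.1 = t
    · rw [weightPart, weightPart, coeff_seriesPart_of_mem (α := p.2)]
      change dot u p.2 = s - t
      linarith
    · rw [weightPart, coeff_seriesPart_of_notMem h, zero_mul, zero_mul]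
  · rw [weightPart, coeff_seriesPart_of_notMem hα, MvPowerSeries.coeff_mul]
    refine (Finset.sum_eq_zero fun p hp => ?_).symm
    rw [← Finset.HasAntidiagonal.mem_antidiagonal.1 hp, dot_add] at hα
    by_cases h : dot u p.1 = t
    · rw [weightPart, weightPart, coeff_seriesPart_of_notMem (α := p.2), mul_zero]
      intro h'
      have h'' : dot u p.2 = s - t := h'
      exact hα (by linarith)
    · rw [weightPart, coeff_seriesPart_of_notMem h, zero_mul]

theorem weightPart_sum {ι : Type*} (u : Fin n → ℝ) (s : ℝ) (F : Finset ι) (f : ι → Series k n) :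
    weightPart u s (∑ i ∈ F, f i) = ∑ i ∈ F, weightPart u s (f i) := by
  ext α
  rw [map_sum]
  by_cases hα : dot u α = s
  · simp only [weightPart, coeff_seriesPart_of_mem (s := {α | dot u α = s}) hα, map_sum]
  · simp only [weightPart, coeff_seriesPart_of_notMem (s := {α | dot u α = s}) hα,
      Finset.sum_const_zero]

/-- A polynomial is the sum of its components. -/
theorem exists_eq_sum_weightPart (u : Fin n → ℝ) {q : Series k n} (hq : q ∈ polyRing k n) :
    ∃ T : Finset ℝ, (∀ t ∈ T, ∃ α, dot u α = t) ∧ q = ∑ t ∈ T, weightPart u t q := by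
  classical
  rw [mem_polyRing_iff] at hq
  refine ⟨hq.toFinset.image (dot u), fun t ht => ?_, ?_⟩
  · obtain ⟨α, -, h⟩ := Finset.mem_image.1 ht
    exact ⟨α, h⟩
  · ext α
    rw [map_sum]
    by_cases hα : MvPowerSeries.coeff α q = 0
    · rw [hα]
      refine (Finset.sum_eq_zero fun t _ => ?_).symm
      rw [weightPart, coeff_seriesPart, hα, ite_self]
    · rw [Finset.sum_eq_single (dot u α)]
      · exact (coeff_seriesPart_of_mem (s := {β | dot u β = dot u α}) rfl q).symm
      · exact fun t _ ht => coeff_seriesPart_of_notMem (s := {β | dot u β = t}) ht.symm q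
      · exact fun h => absurd (Finset.mem_image_of_mem _ (hq.mem_toFinset.2 hα)) h

/-- Comparing weights in qf = p gives q_0 f_s = p_s - ∑ q_t f_{s-t} over the nonzero weights t of q,
which are negative. Here q_0 is a polynomial with q_0(0) = q(0) ≠ 0, hence invertible in the local
ring, and the f_{s-t} have weights closer to 0. -/
theorem weightPart_mem_localRing {u : Fin n → ℝ} (hu : u ∈ Uloc n) (r : ℝ) {f : Series k n}
    (hf : f ∈ localRing k n) : weightPart u r f ∈ localRing k n := by
  classical
  obtain ⟨p, q, hq, h⟩ := hf
  have hpoly : ∀ (p : MvPolynomial (Fin n) k) t, weightPart u t (p : Series k n) ∈ localRing k n :=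
    fun p t => polyRing_le_localRing (seriesPart_mem_polyRing _ ⟨p, rfl⟩)
  have hq0 : MvPowerSeries.constantCoeff (weightPart u 0 (q : Series k n)) ≠ 0 := by
    rw [← MvPowerSeries.coeff_zero_eq_constantCoeff_apply, weightPart, coeff_seriesPart_of_mem,
      MvPowerSeries.coeff_zero_eq_constantCoeff_apply, constantCoeff_coe]
    · exact hq
    · change dot u 0 = 0
      simp [dot]
  obtain ⟨T, hT, hqT⟩ := exists_eq_sum_weightPart u (q := (q : Series k n)) ⟨q, rfl⟩
  -- The weights are real, so the recursion needs a uniform gap: finitely many weights occur in q,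
  -- and the nonzero ones stay at least `ε` below 0.
  obtain ⟨ε, hε, hTε⟩ : ∃ ε : ℝ, 0 < ε ∧ ∀ t ∈ T, t ≠ 0 → t ≤ -ε := by
    rcases (T.filter (· ≠ 0)).eq_empty_or_nonempty with h | h
    · refine ⟨1, one_pos, fun t ht ht' => ?_⟩
      exact absurd (Finset.mem_filter.2 ⟨ht, ht'⟩) (h ▸ Finset.notMem_empty t)
    · obtain ⟨t, ht, hmax⟩ := Finset.exists_max_image _ id h
      rw [Finset.mem_filter] at ht
      obtain ⟨α, rfl⟩ := hT t ht.1
      refine ⟨-dot u α, neg_pos.2 (lt_of_le_of_ne (dot_nonpos hu α) ht.2), fun s hs hs' => ?_⟩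
      rw [neg_neg]
      exact hmax s (Finset.mem_filter.2 ⟨hs, hs'⟩)
  have hmain : ∀ N : ℕ, ∀ s : ℝ, -(N * ε) < s → weightPart u s f ∈ localRing k n := by
    intro N
    induction N with
    | zero =>
      intro s hs
      convert zero_mem (localRing k n)
      ext α
      refine coeff_seriesPart_of_notMem (s := {α | dot u α = s}) (fun h' => ?_) f
      have h1 : dot u α = s := h'
      have h2 := dot_nonpos hu α
      simp only [Nat.cast_zero, zero_mul, neg_zero] at hs
      linarith
    | succ N ih =>
      intro s hs
      have h1 : weightPart u s (p : Series k n) =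
          ∑ t ∈ T, weightPart u t (q : Series k n) * weightPart u (s - t) f := by
        rw [← h]
        conv_lhs => rw [hqT, Finset.sum_mul, weightPart_sum]
        exact Finset.sum_congr rfl fun t _ => weightPart_weightPart_mul u s t _ _
      have h2 : weightPart u 0 (q : Series k n) * weightPart u s f ∈ localRing k n := by
        by_cases h0 : (0 : ℝ) ∈ T
        · rw [← Finset.add_sum_erase _ _ h0, sub_zero, ← sub_eq_iff_eq_add] at h1
          rw [← h1]
          refine sub_mem (hpoly p s) (sum_mem fun t ht => mul_mem (hpoly q t) (ih _ ?_))
          rw [Finset.mem_erase] at ht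
          have := hTε t ht.2 ht.1
          push_cast at hs
          linarith
        · exfalso
          refine hq0 ?_
          rw [hqT, weightPart_sum, map_sum]
          refine Finset.sum_eq_zero fun t ht => ?_
          rw [← MvPowerSeries.coeff_zero_eq_constantCoeff_apply]
          have ht0 : t ≠ 0 := fun h => h0 (h ▸ ht)
          have hd : dot u (0 : Fin n →₀ ℕ) = 0 := by simp [dot]
          rw [weightPart, coeff_seriesPart_of_mem (s := {α | dot u α = 0}) hd]
          exact coeff_seriesPart_of_notMem (s := {α | dot u α = t}) (fun h => ht0 (h.symm.trans hd)) _
      have h3 := mul_mem (inv_mem_localRing (hpoly q 0) hq0) h2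
      rwa [← mul_assoc, MvPowerSeries.inv_mul_cancel _ hq0, one_mul] at h3
  obtain ⟨N, hN⟩ := exists_nat_gt (-r / ε)
  refine hmain N r ?_
  rw [div_lt_iff₀ hε] at hN
  linarith

theorem isGood_localRing : IsGood (localRing k n) where
  noetherian := isNoetherianRing_localRing
  poly_le := polyRing_le_localRing
  inv_mem _ := inv_mem_localRing
  mem_pow := mem_vanishing_pow_localRing
  part_mem _ hu r _ := weightPart_mem_localRing hu r
  partials_mem i _ := partials_mem_localRing i

end LocalRing

/-! ### Sizes of exponents

Exponents are ordered by their images under an injective homomorphism to the positive integers. -/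

section Size

variable {n : ℕ}

/-- The integer `∏ p_i^(α_i)`, where `p_i` is the `i`-th prime. -/
def size (α : Fin n →₀ ℕ) : ℕ := ∏ i : Fin n, Nat.nth Nat.Prime i ^ α i

theorem size_zero : size (0 : Fin n →₀ ℕ) = 1 := by
  simp [size]

theorem size_add (α β : Fin n →₀ ℕ) : size (α + β) = size α * size β := by
  simp [size, pow_add, Finset.prod_mul_distrib]

theorem size_pos (α : Fin n →₀ ℕ) : 0 < size α :=
  Finset.prod_pos fun _ _ => pow_pos (Nat.prime_nth_prime _).pos _

theorem size_injective : Function.Injective (size (n := n)) := by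
  intro α β h
  ext i
  have key : ∀ α : Fin n →₀ ℕ, (size α).factorization (Nat.nth Nat.Prime i) = α i := by
    intro α
    rw [size, Nat.factorization_prod fun j _ => (pow_pos (Nat.prime_nth_prime _).pos _).ne',
      Finsupp.finsetSum_apply, Finset.sum_eq_single i]
    · rw [(Nat.prime_nth_prime _).factorization_pow, Finsupp.single_eq_same]
    · intro j _ hj
      rw [(Nat.prime_nth_prime _).factorization_pow, Finsupp.single_eq_of_ne]
      exact fun h => hj (Fin.ext (Nat.nth_injective Nat.infinite_setOfPred_prime h)).symm
    · simp
  rw [← key α, ← key β, h]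

theorem finite_size_lt (K : ℕ) : {α : Fin n →₀ ℕ | size α < K}.Finite :=
  (Set.finite_lt_nat K).preimage size_injective.injOn

/-- Every prime is at least 2. Together with the upper bound by a power of a constant `b`, this
makes decay in `size` equivalent to convergence on a polydisc. -/
theorem two_pow_degree_le_size (α : Fin n →₀ ℕ) : 2 ^ α.degree ≤ size α := by
  rw [Finsupp.degree_eq_sum, ← Finset.prod_pow_eq_pow_sum]
  exact Finset.prod_le_prod' fun i _ => Nat.pow_le_pow_left (Nat.prime_nth_prime _).two_le _

theorem exists_size_le_pow_degree (n : ℕ) :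
    ∃ b : ℕ, 0 < b ∧ ∀ α : Fin n →₀ ℕ, size α ≤ b ^ α.degree := by
  refine ⟨∏ i : Fin n, Nat.nth Nat.Prime i, Finset.prod_pos fun _ _ => (Nat.prime_nth_prime _).pos,
    fun α => ?_⟩
  rw [Finsupp.degree_eq_sum, ← Finset.prod_pow_eq_pow_sum]
  refine Finset.prod_le_prod' fun i _ => Nat.pow_le_pow_left ?_ _
  exact Finset.single_le_prod' (f := fun i : Fin n => Nat.nth Nat.Prime i)
    (fun _ _ => (Nat.prime_nth_prime _).one_le) (Finset.mem_univ i)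

end Size

/-! ### Convergence of power series in terms of weighted norms -/

section Norm

open scoped ENNReal

variable {n : ℕ}

/-- The weight of an exponent in the norm `wnorm s`. -/
def normWeight (s : ℕ) (α : Fin n →₀ ℕ) : ℝ≥0∞ := ((size α : ℝ≥0∞)⁻¹) ^ s

theorem normWeight_add (s : ℕ) (α β : Fin n →₀ ℕ) :
    normWeight s (α + β) = normWeight s α * normWeight s β := by
  rw [normWeight, size_add, Nat.cast_mul, ENNReal.mul_inv (Or.inr (ENNReal.natCast_ne_top _))
    (Or.inl (ENNReal.natCast_ne_top _)), mul_pow]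
  rfl

theorem size_ne_zero (α : Fin n →₀ ℕ) : (size α : ℝ≥0∞) ≠ 0 :=
  Nat.cast_ne_zero.2 (size_pos α).ne'

theorem normWeight_mul_size (s : ℕ) (α : Fin n →₀ ℕ) :
    normWeight s α * (size α : ℝ≥0∞) ^ s = 1 := by
  rw [normWeight, ← mul_pow, ENNReal.inv_mul_cancel (size_ne_zero α) (ENNReal.natCast_ne_top _),
    one_pow]

theorem normWeight_ne_top (s : ℕ) (α : Fin n →₀ ℕ) : normWeight s α ≠ ∞ :=
  ENNReal.pow_ne_top (ENNReal.inv_ne_top.2 (size_ne_zero α))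

/-- The norm `∑ |f_α| size(α)^(-s)`. -/
def wnorm (s : ℕ) (f : Series ℂ n) : ℝ≥0∞ :=
  ∑' α, ‖MvPowerSeries.coeff α f‖ₑ * normWeight s α

theorem wnorm_le_of_coeff {s : ℕ} {f g : Series ℂ n}
    (h : ∀ α, ‖MvPowerSeries.coeff α f‖ₑ ≤ ‖MvPowerSeries.coeff α g‖ₑ) : wnorm s f ≤ wnorm s g :=
  ENNReal.tsum_le_tsum fun α => mul_le_mul_left (h α) _

theorem wnorm_add_le (s : ℕ) (f g : Series ℂ n) : wnorm s (f + g) ≤ wnorm s f + wnorm s g := by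
  rw [wnorm, wnorm, wnorm, ← ENNReal.tsum_add]
  refine ENNReal.tsum_le_tsum fun α => ?_
  rw [← add_mul, map_add]
  exact mul_le_mul_left (enorm_add_le _ _) _

theorem wnorm_neg (s : ℕ) (f : Series ℂ n) : wnorm s (-f) = wnorm s f := by
  simp only [wnorm, map_neg, enorm_neg]

theorem wnorm_zero (s : ℕ) : wnorm s (0 : Series ℂ n) = 0 := by
  simp [wnorm]

theorem wnorm_sub_le (s : ℕ) (f g : Series ℂ n) : wnorm s (f - g) ≤ wnorm s f + wnorm s g := by
  rw [sub_eq_add_neg, ← wnorm_neg s g]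
  exact wnorm_add_le s f (-g)

theorem wnorm_sum_le {ι : Type*} (s : ℕ) (F : Finset ι) (f : ι → Series ℂ n) :
    wnorm s (∑ i ∈ F, f i) ≤ ∑ i ∈ F, wnorm s (f i) := by
  classical
  induction F using Finset.induction_on with
  | empty => simp [wnorm_zero]
  | insert i F hi ih =>
    rw [Finset.sum_insert hi, Finset.sum_insert hi]
    exact (wnorm_add_le s _ _).trans (by gcongr)

theorem wnorm_mul_le (s : ℕ) (f g : Series ℂ n) : wnorm s (f * g) ≤ wnorm s f * wnorm s g := by
  have h : ∀ α, ‖MvPowerSeries.coeff α (f * g)‖ₑ * normWeight s α ≤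
      ∑' p : Finset.HasAntidiagonal.antidiagonal α, (‖MvPowerSeries.coeff p.1.1 f‖ₑ * normWeight s p.1.1) *
        (‖MvPowerSeries.coeff p.1.2 g‖ₑ * normWeight s p.1.2) := by
    intro α
    rw [tsum_fintype, Finset.sum_coe_sort (Finset.HasAntidiagonal.antidiagonal α)
      (fun p => (‖MvPowerSeries.coeff p.1 f‖ₑ * normWeight s p.1) *
        (‖MvPowerSeries.coeff p.2 g‖ₑ * normWeight s p.2)), MvPowerSeries.coeff_mul]
    refine (mul_le_mul_left (enorm_sum_le _ _) _).trans ?_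
    rw [Finset.sum_mul]
    refine Finset.sum_le_sum fun p hp => le_of_eq ?_
    rw [← Finset.HasAntidiagonal.mem_antidiagonal.1 hp, normWeight_add, enorm_mul]
    ring
  refine (ENNReal.tsum_le_tsum h).trans ?_
  rw [← ENNReal.tsum_sigma fun α (p : Finset.HasAntidiagonal.antidiagonal α) =>
      (‖MvPowerSeries.coeff p.1.1 f‖ₑ * normWeight s p.1.1) *
        (‖MvPowerSeries.coeff p.1.2 g‖ₑ * normWeight s p.1.2),
    ← Finset.HasAntidiagonal.sigmaAntidiagonalEquivProd.symm.tsum_eq]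
  refine le_of_eq ?_
  rw [wnorm, wnorm, ← ENNReal.tsum_mul_right, ENNReal.tsum_prod']
  exact tsum_congr fun α => by rw [← ENNReal.tsum_mul_left]; rfl

theorem wnorm_seriesPart_le (s : ℕ) (t : Set (Fin n →₀ ℕ)) (f : Series ℂ n) :
    wnorm s (seriesPart t f) ≤ wnorm s f := by
  refine wnorm_le_of_coeff fun α => ?_
  rw [coeff_seriesPart]
  split_ifs
  · exact le_rfl
  · simp

/-- The norm weights are multiplicative, so dividing by x^e costs exactly the inverse weight of x^e;
terms not divisible by x^e are discarded. -/
theorem wnorm_shift_le (s : ℕ) (e : Fin n →₀ ℕ) (f : Series ℂ n) :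
    wnorm s (shift e f) ≤ (size e : ℝ≥0∞) ^ s * wnorm s f := by
  refine le_trans ?_ (mul_le_mul_right (ENNReal.tsum_comp_le_tsum_of_injective
    (add_left_injective e) fun α => ‖MvPowerSeries.coeff α f‖ₑ * normWeight s α) _)
  rw [← ENNReal.tsum_mul_left]
  refine ENNReal.tsum_le_tsum fun α => le_of_eq ?_
  rw [normWeight_add, coeff_shift]
  calc _ = ‖MvPowerSeries.coeff (α + e) f‖ₑ * normWeight s α *
        (normWeight s e * (size e : ℝ≥0∞) ^ s) := by rw [normWeight_mul_size, mul_one]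
    _ = _ := by ring

theorem wnorm_anti {s t : ℕ} (h : s ≤ t) (f : Series ℂ n) : wnorm t f ≤ wnorm s f := by
  refine ENNReal.tsum_le_tsum fun α => mul_le_mul_right (pow_le_pow_right_of_le_one' ?_ h) _
  exact ENNReal.inv_le_one.2 (by exact_mod_cast size_pos α)

/-- Given a radius r, any `s` with 2^(-s) < r works, as `size α` is at least 2^|α|. Conversely the
bound `size α` ≤ b^|α| yields the radius b^(-s). -/
theorem isConvergent_iff {f : Series ℂ n} : IsConvergent f ↔ ∃ s, wnorm s f ≠ ∞ := by
  constructor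
  · rintro ⟨r, hr, hsum⟩
    obtain ⟨s, hs⟩ := exists_pow_lt_of_lt_one hr (by norm_num : (2 : ℝ)⁻¹ < 1)
    refine ⟨s, ne_top_of_le_ne_top hsum.tsum_ofReal_ne_top (ENNReal.tsum_le_tsum fun α => ?_)⟩
    rw [ENNReal.ofReal_mul (norm_nonneg _), ofReal_norm]
    refine mul_le_mul_right ?_ _
    have h1 : ((size α : ℝ)⁻¹) ^ s ≤ r ^ α.degree := by
      refine le_trans ?_ (pow_le_pow_left₀ (by positivity) hs.le _)
      rw [← pow_mul, mul_comm s, pow_mul]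
      refine pow_le_pow_left₀ (by positivity) ?_ _
      rw [inv_pow]
      exact inv_anti₀ (by positivity) (by exact_mod_cast two_pow_degree_le_size α)
    refine le_trans (le_of_eq ?_) (ENNReal.ofReal_le_ofReal h1)
    rw [normWeight, ENNReal.ofReal_pow (by positivity),
      ENNReal.ofReal_inv_of_pos (by exact_mod_cast size_pos α), ENNReal.ofReal_natCast]
  · rintro ⟨s, hs⟩
    obtain ⟨b, hb, hb'⟩ := exists_size_le_pow_degree n
    refine ⟨((b : ℝ)⁻¹) ^ s, by positivity,
      (ENNReal.summable_toReal hs).of_nonneg_of_le (fun α => by positivity) fun α => ?_⟩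
    rw [ENNReal.toReal_mul, toReal_enorm]
    refine mul_le_mul_of_nonneg_left ?_ (norm_nonneg _)
    rw [normWeight, ENNReal.toReal_pow, ENNReal.toReal_inv, ENNReal.toReal_natCast, ← pow_mul,
      mul_comm s, pow_mul]
    refine pow_le_pow_left₀ (by positivity) ?_ _
    rw [inv_pow]
    exact inv_anti₀ (by exact_mod_cast size_pos α) (by exact_mod_cast hb' α)

/-- If all terms of `g` are larger than `x^e`, then `g` becomes small relative to `x^e`. -/
theorem exists_wnorm_mul_size_le {g : Series ℂ n} (hg : IsConvergent g) {e : Fin n →₀ ℕ}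
    (he : ∀ α, MvPowerSeries.coeff α g ≠ 0 → size e < size α) {c : ℝ≥0∞} (hc : 0 < c) :
    ∃ s₀, ∀ s, s₀ ≤ s → wnorm s g * (size e : ℝ≥0∞) ^ s ≤ c := by
  obtain ⟨s, hs⟩ := isConvergent_iff.1 hg
  -- Sizes are integers, so every term of `g` has size at least `size e + 1`. Raising the exponent
  -- `s` by one therefore gains the factor `ρ`, which is less than 1.
  let ρ : ℝ≥0∞ := (size e : ℝ≥0∞) * ((size e + 1 : ℕ) : ℝ≥0∞)⁻¹
  have hρ : ρ < 1 := by
    change (size e : ℝ≥0∞) / ((size e + 1 : ℕ) : ℝ≥0∞) < 1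
    rw [ENNReal.div_lt_iff (Or.inl (by simp)) (Or.inl (ENNReal.natCast_ne_top _)), one_mul]
    exact_mod_cast Nat.lt_succ_self _
  have hle : ∀ m, wnorm (s + m) g * (size e : ℝ≥0∞) ^ (s + m) ≤
      wnorm s g * (size e : ℝ≥0∞) ^ s * ρ ^ m := by
    intro m
    have h1 : wnorm (s + m) g ≤ wnorm s g * (((size e + 1 : ℕ) : ℝ≥0∞)⁻¹) ^ m := by
      rw [wnorm, wnorm, ← ENNReal.tsum_mul_right]
      refine ENNReal.tsum_le_tsum fun α => ?_
      rcases eq_or_ne (MvPowerSeries.coeff α g) 0 with h0 | h0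
      · simp [h0]
      · rw [normWeight, pow_add, mul_assoc]
        refine mul_le_mul_right (mul_le_mul_right (pow_le_pow_left' ?_ m) _) _
        exact ENNReal.inv_le_inv.2 (by exact_mod_cast he α h0)
    refine (mul_le_mul_left h1 _).trans (le_of_eq ?_)
    rw [pow_add, mul_pow]
    ring
  have hlim : Filter.Tendsto (fun m => wnorm s g * (size e : ℝ≥0∞) ^ s * ρ ^ m) Filter.atTop
      (nhds 0) := by
    have h := ENNReal.Tendsto.const_mul (a := wnorm s g * (size e : ℝ≥0∞) ^ s)
      (ENNReal.tendsto_pow_atTop_nhds_zero_of_lt_one hρ)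
      (Or.inr (ENNReal.mul_ne_top hs (ENNReal.pow_ne_top (ENNReal.natCast_ne_top (size e)))))
    rwa [mul_zero] at h
  obtain ⟨m₀, hm₀⟩ := Filter.eventually_atTop.1 (hlim.eventually (ge_mem_nhds hc))
  refine ⟨s + m₀, fun t ht => ?_⟩
  obtain ⟨m, rfl⟩ := Nat.exists_eq_add_of_le ht
  rw [add_assoc]
  exact (hle _).trans (hm₀ _ (Nat.le_add_right _ _))

end Norm

/-! ### Division of power series -/

section Division

open scoped ENNReal

variable {k : Type*} [Field k] {n : ℕ}

/-- The power series all of whose terms have size at least `K`. -/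
def VanishBelow (K : ℕ) (f : Series k n) : Prop :=
  ∀ α, size α < K → MvPowerSeries.coeff α f = 0

/-- A map that increases the sizes of the terms has `id + T` surjective. -/
theorem exists_add_eq (T : Series k n →+ Series k n)
    (hT : ∀ K h, VanishBelow K h → VanishBelow (K + 1) (T h)) (F : Series k n) :
    ∃ H, H + T H = F := by
  obtain ⟨a, ha⟩ : ∃ a : ℕ → Series k n, ∀ j, a (j + 1) = F - T (a j) :=
    ⟨fun j => Nat.rec 0 (fun _ h => F - T h) j, fun _ => rfl⟩
  have hstep : ∀ j, VanishBelow j (a (j + 1) - a j) := by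
    intro j
    induction j with
    | zero => exact fun α h => absurd h (Nat.not_lt_zero _)
    | succ j ih =>
      have h : a (j + 1 + 1) - a (j + 1) = T (a j - a (j + 1)) := by
        rw [ha (j + 1), map_sub]
        linear_combination -(ha j)
      rw [h]
      refine hT j _ fun α hα => ?_
      rw [← neg_sub, map_neg, ih α hα, neg_zero]
  have hlim : ∀ i j, VanishBelow j (a (j + i) - a j) := by
    intro i j
    induction i with
    | zero =>
      intro α _
      rw [add_zero, sub_self, map_zero]
    | succ i ih =>
      intro α hα
      rw [← add_assoc, ← sub_add_sub_cancel _ (a (j + i)), map_add, ih α hα, add_zero]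
      exact hstep (j + i) α (by omega)
  -- The iteration a ↦ F - T a fixes the terms of size below `j` from stage `j` on, so the
  -- coefficient at `α` is final at stage `size α + 1`.
  let H : Series k n := fun α => MvPowerSeries.coeff α (a (size α + 1))
  have hH : ∀ j, VanishBelow j (H - a j) := by
    intro j α hα
    obtain ⟨i, rfl⟩ := Nat.exists_eq_add_of_le (Nat.succ_le_of_lt hα)
    have h := hlim i (size α).succ α (Nat.lt_succ_self _)
    rw [map_sub] at h ⊢
    rw [sub_eq_zero.1 h]
    exact sub_self _
  refine ⟨H, ?_⟩
  ext α
  have h1 := hH (size α + 1 + 1) α (by omega)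
  have h2 := hT _ _ (hH (size α + 1)) α (by omega)
  rw [ha, map_sub, map_sub] at h1
  rw [map_sub, map_sub] at h2
  rw [map_add]
  linear_combination h1 + h2

/-- The operator `h ↦ ∑ q_e t_e`, where `x^e q_e` is the sum of the terms of `h` in `Δ e`. -/
def divisionMap (G : Finset (Fin n →₀ ℕ)) (Δ : (Fin n →₀ ℕ) → Set (Fin n →₀ ℕ))
    (t : (Fin n →₀ ℕ) → Series k n) : Series k n →+ Series k n where
  toFun h := ∑ e ∈ G, shift e (seriesPart (Δ e) h) * t e
  map_zero' := by
    refine Finset.sum_eq_zero fun e _ => ?_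
    rw [seriesPart_zero]
    exact zero_mul _
  map_add' f g := by
    rw [← Finset.sum_add_distrib]
    refine Finset.sum_congr rfl fun e _ => ?_
    rw [← add_mul]
    congr 1
    ext α
    rw [map_add, coeff_shift, coeff_shift, coeff_shift, coeff_seriesPart, coeff_seriesPart,
      coeff_seriesPart, map_add]
    split_ifs
    · rfl
    · rw [add_zero]

theorem divisionMap_apply (G : Finset (Fin n →₀ ℕ)) (Δ : (Fin n →₀ ℕ) → Set (Fin n →₀ ℕ))
    (t : (Fin n →₀ ℕ) → Series k n) (h : Series k n) :
    divisionMap G Δ t h = ∑ e ∈ G, shift e (seriesPart (Δ e) h) * t e := rfl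

/-- The map replaces a factor x^e by strictly larger terms of `t e`. Size is multiplicative with
positive integer values, so every size rises by at least one. -/
theorem vanishBelow_divisionMap {G : Finset (Fin n →₀ ℕ)}
    {Δ : (Fin n →₀ ℕ) → Set (Fin n →₀ ℕ)} {t : (Fin n →₀ ℕ) → Series k n}
    (ht : ∀ e ∈ G, ∀ α, MvPowerSeries.coeff α (t e) ≠ 0 → size e < size α) (K : ℕ)
    (h : Series k n) (hK : VanishBelow K h) : VanishBelow (K + 1) (divisionMap G Δ t h) := by
  intro α hα
  rw [divisionMap_apply, map_sum]
  refine Finset.sum_eq_zero fun e he => ?_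
  rw [MvPowerSeries.coeff_mul]
  refine Finset.sum_eq_zero fun p hp => ?_
  by_cases h0 : MvPowerSeries.coeff p.2 (t e) = 0
  · rw [h0, mul_zero]
  · rw [coeff_shift, coeff_seriesPart, hK, ite_self, zero_mul]
    have h1 := ht e he _ h0
    rw [← Finset.HasAntidiagonal.mem_antidiagonal.1 hp, size_add] at hα
    rw [size_add]
    have h2 := Nat.mul_lt_mul_of_pos_left h1 (size_pos p.1)
    omega

theorem wnorm_ne_top_of_finite {s : ℕ} {f : Series ℂ n}
    (hf : {α : Fin n →₀ ℕ | MvPowerSeries.coeff α f ≠ 0}.Finite) : wnorm s f ≠ ∞ := by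
  rw [wnorm, tsum_eq_sum (s := hf.toFinset)]
  · exact ENNReal.sum_ne_top.2 fun α _ => ENNReal.mul_ne_top enorm_ne_top (normWeight_ne_top s α)
  · intro α hα
    rw [hf.mem_toFinset] at hα
    rw [not_not.1 hα, enorm_zero, zero_mul]

/-- The norm of `H` could be infinite, so half of it cannot be absorbed directly. The estimate is
made on the truncations by size, whose norms are finite, and passes to the supremum. -/
theorem wnorm_le_two_mul {T : Series ℂ n →+ Series ℂ n}
    (hT : ∀ K h, VanishBelow K h → VanishBelow (K + 1) (T h)) {s : ℕ}
    (hs : ∀ h, wnorm s (T h) ≤ 2⁻¹ * wnorm s h) {F H : Series ℂ n} (hH : H + T H = F) :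
    wnorm s H ≤ 2 * wnorm s F := by
  have htr : ∀ K, wnorm s (seriesPart {α | size α < K} H) ≤ 2 * wnorm s F := by
    intro K
    let S : Set (Fin n →₀ ℕ) := {α | size α < K}
    have h1 : VanishBelow K (H - seriesPart S H) := by
      intro α hα
      rw [map_sub, coeff_seriesPart_of_mem (s := S) hα, sub_self]
    -- As `T` raises sizes, the terms of `H` of size at least `K` do not affect F - T H in sizes
    -- below `K`.
    have h2 : wnorm s (seriesPart S H) ≤ wnorm s (F - T (seriesPart S H)) := by
      refine wnorm_le_of_coeff fun α => ?_
      by_cases hα : size α < K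
      · rw [coeff_seriesPart_of_mem (s := S) hα]
        have h3 := hT _ _ h1 α (by omega)
        rw [map_sub, map_sub, sub_eq_zero] at h3
        rw [map_sub, ← h3, ← hH, map_add, add_sub_cancel_right]
      · rw [coeff_seriesPart_of_notMem (s := S) hα, enorm_zero]
        exact zero_le
    have h4 : wnorm s (seriesPart S H) ≤ wnorm s F + 2⁻¹ * wnorm s (seriesPart S H) :=
      h2.trans ((wnorm_sub_le s _ _).trans (by gcongr; exact hs _))
    have h5 : wnorm s (seriesPart S H) ≠ ∞ := wnorm_ne_top_of_finite
      ((finite_size_lt K).subset fun α hα => mem_of_coeff_seriesPart_ne_zero hα)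
    have h6 : 2⁻¹ * wnorm s (seriesPart S H) + 2⁻¹ * wnorm s (seriesPart S H) ≤
        wnorm s F + 2⁻¹ * wnorm s (seriesPart S H) := by
      rwa [← add_mul, ENNReal.inv_two_add_inv_two, one_mul]
    have h7 := (ENNReal.add_le_add_iff_right (ENNReal.mul_ne_top (by simp) h5)).1 h6
    calc wnorm s (seriesPart S H) = 2 * (2⁻¹ * wnorm s (seriesPart S H)) := by
          rw [← mul_assoc, ENNReal.mul_inv_cancel (by simp) (by simp), one_mul]
      _ ≤ _ := by gcongr
  rw [wnorm, ENNReal.tsum_eq_iSup_sum]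
  refine iSup_le fun F' => ?_
  refine le_trans ?_ (htr (F'.sup size + 1))
  refine le_trans (le_of_eq ?_) (ENNReal.sum_le_tsum F')
  refine Finset.sum_congr rfl fun α hα => ?_
  rw [coeff_seriesPart_of_mem (s := {α | size α < F'.sup size + 1})
    (Nat.lt_succ_of_le (Finset.le_sup hα))]

/-- Division of convergent power series. -/
theorem exists_convergent_add_eq {G : Finset (Fin n →₀ ℕ)}
    {Δ : (Fin n →₀ ℕ) → Set (Fin n →₀ ℕ)} {t : (Fin n →₀ ℕ) → Series ℂ n}
    (ht : ∀ e ∈ G, ∀ α, MvPowerSeries.coeff α (t e) ≠ 0 → size e < size α)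
    (hconv : ∀ e ∈ G, IsConvergent (t e)) {F : Series ℂ n} (hF : IsConvergent F) :
    ∃ H, IsConvergent H ∧ H + divisionMap G Δ t H = F := by
  obtain ⟨H, hH⟩ := exists_add_eq (divisionMap G Δ t) (vanishBelow_divisionMap ht) F
  refine ⟨H, ?_, hH⟩
  -- With this bound for each divisor, the whole map has norm at most 1/2; adding 1 to the
  -- cardinality covers the empty set of divisors.
  let c : ℝ≥0∞ := 2⁻¹ * ((G.card : ℝ≥0∞) + 1)⁻¹
  have hc : 0 < c := by
    refine ENNReal.mul_pos (by simp) ?_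
    exact ENNReal.inv_ne_zero.2 (by finiteness)
  have h1 : ∀ e, ∃ s₀, e ∈ G → ∀ s, s₀ ≤ s → wnorm s (t e) * (size e : ℝ≥0∞) ^ s ≤ c := by
    intro e
    by_cases he : e ∈ G
    · obtain ⟨s₀, h⟩ := exists_wnorm_mul_size_le (hconv e he) (ht e he) hc
      exact ⟨s₀, fun _ => h⟩
    · exact ⟨0, fun h => absurd h he⟩
  choose s₀ hs₀ using h1
  obtain ⟨s₁, hs₁⟩ := isConvergent_iff.1 hF
  let s := max s₁ (G.sup s₀)
  have hs : ∀ h, wnorm s (divisionMap G Δ t h) ≤ 2⁻¹ * wnorm s h := by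
    intro h
    rw [divisionMap_apply]
    refine (wnorm_sum_le s G _).trans ?_
    have h2 : ∀ e ∈ G, wnorm s (shift e (seriesPart (Δ e) h) * t e) ≤ c * wnorm s h := by
      intro e he
      refine (wnorm_mul_le s _ _).trans ((mul_le_mul_left
        ((wnorm_shift_le s e _).trans (mul_le_mul_right (wnorm_seriesPart_le s _ h) _)) _).trans ?_)
      have h3 := hs₀ e he s ((Finset.le_sup he).trans (le_max_right _ _))
      calc (size e : ℝ≥0∞) ^ s * wnorm s h * wnorm s (t e)
          = wnorm s (t e) * (size e : ℝ≥0∞) ^ s * wnorm s h := by ring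
        _ ≤ _ := mul_le_mul_left h3 _
    refine (Finset.sum_le_card_nsmul G _ _ h2).trans ?_
    rw [nsmul_eq_mul, ← mul_assoc]
    refine mul_le_mul_left ?_ _
    calc (G.card : ℝ≥0∞) * (2⁻¹ * ((G.card : ℝ≥0∞) + 1)⁻¹)
        = 2⁻¹ * ((G.card : ℝ≥0∞) / ((G.card : ℝ≥0∞) + 1)) := by rw [div_eq_mul_inv]; ring
      _ ≤ 2⁻¹ * 1 := by
          refine mul_le_mul_right (ENNReal.div_le_of_le_mul ?_) _
          rw [one_mul]
          exact le_self_add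
      _ = 2⁻¹ := mul_one _
  refine isConvergent_iff.2 ⟨s, ne_top_of_le_ne_top (ENNReal.mul_ne_top (by simp)
    (ne_top_of_le_ne_top hs₁ (wnorm_anti (le_max_left _ _) F)))
    (wnorm_le_two_mul (vanishBelow_divisionMap ht) hs hH)⟩

end Division

/-! ### The ring of convergent power series -/

section Convergent

open scoped ENNReal

variable {n : ℕ}

theorem IsConvergent.seriesPart {f : Series ℂ n} (hf : IsConvergent f) (s : Set (Fin n →₀ ℕ)) :
    IsConvergent (LocalGroebner.seriesPart s f) := by
  obtain ⟨t, ht⟩ := isConvergent_iff.1 hf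
  exact isConvergent_iff.2 ⟨t, ne_top_of_le_ne_top ht (wnorm_seriesPart_le t s f)⟩

theorem IsConvergent.shift {f : Series ℂ n} (hf : IsConvergent f) (e : Fin n →₀ ℕ) :
    IsConvergent (LocalGroebner.shift e f) := by
  obtain ⟨t, ht⟩ := isConvergent_iff.1 hf
  exact isConvergent_iff.2 ⟨t, ne_top_of_le_ne_top
    (ENNReal.mul_ne_top (ENNReal.pow_ne_top (ENNReal.natCast_ne_top _)) ht) (wnorm_shift_le t e f)⟩

theorem polyRing_le_convRing : polyRing ℂ n ≤ convRing n := fun _ hf =>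
  isConvergent_iff.2 ⟨0, wnorm_ne_top_of_finite (mem_polyRing_iff.1 hf)⟩

theorem lt_size_add_single (α : Fin n →₀ ℕ) (i : Fin n) :
    α i + 1 ≤ size (α + Finsupp.single i 1) := by
  refine le_trans ?_ (two_pow_degree_le_size _)
  rw [map_add, Finsupp.degree_single]
  exact (Nat.succ_le_succ (Finsupp.le_degree i α)).trans Nat.lt_two_pow_self.le

/-- Differentiation brings in a factor α_i + 1, bounded by the size of the exponent α + e_i; passing
from `s` to `s + 1` absorbs it. -/
theorem partials_mem_convRing (i : Fin n) {f : Series ℂ n} (hf : f ∈ convRing n) :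
    partials ℂ n i f ∈ convRing n := by
  obtain ⟨s, hs⟩ := isConvergent_iff.1 hf
  refine isConvergent_iff.2 ⟨s + 1, ne_top_of_le_ne_top (ENNReal.mul_ne_top
    (ENNReal.pow_ne_top (n := s + 1) (ENNReal.natCast_ne_top (size (Finsupp.single i 1)))) hs) ?_⟩
  refine le_trans ?_ (mul_le_mul_right (ENNReal.tsum_comp_le_tsum_of_injective
    (add_left_injective (Finsupp.single i 1))
    fun α => ‖MvPowerSeries.coeff α f‖ₑ * normWeight s α) _)
  rw [← ENNReal.tsum_mul_left]
  refine ENNReal.tsum_le_tsum fun α => ?_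
  rw [partials, MvPowerSeries.coeff_pderiv, enorm_mul]
  have h1 : ‖(α i + 1 : ℂ)‖ₑ ≤ (size (α + Finsupp.single i 1) : ℝ≥0∞) := by
    have : (α i + 1 : ℂ) = ((α i + 1 : ℕ) : ℂ) := by push_cast; rfl
    rw [this, ← ofReal_norm, Complex.norm_natCast, ENNReal.ofReal_natCast]
    exact_mod_cast lt_size_add_single α i
  have h2 : (size (α + Finsupp.single i 1) : ℝ≥0∞) * normWeight (s + 1) α =
      (size (Finsupp.single i 1) : ℝ≥0∞) ^ (s + 1) * normWeight s (α + Finsupp.single i 1) := by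
    have h3 : (size (α + Finsupp.single i 1) : ℝ≥0∞) *
        normWeight (s + 1) (α + Finsupp.single i 1) = normWeight s (α + Finsupp.single i 1) := by
      rw [normWeight, pow_succ', ← mul_assoc, ENNReal.mul_inv_cancel (size_ne_zero _)
        (ENNReal.natCast_ne_top _), one_mul]
      rfl
    rw [← h3, normWeight_add]
    calc _ = (size (α + Finsupp.single i 1) : ℝ≥0∞) * normWeight (s + 1) α *
          (normWeight (s + 1) (Finsupp.single i 1) *
            (size (Finsupp.single i 1) : ℝ≥0∞) ^ (s + 1)) := by rw [normWeight_mul_size, mul_one]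
      _ = _ := by ring
  calc _ ≤ ‖MvPowerSeries.coeff (α + Finsupp.single i 1) f‖ₑ *
        (size (α + Finsupp.single i 1) : ℝ≥0∞) * normWeight (s + 1) α := by gcongr
    _ = _ := by rw [mul_assoc, h2]; ring

/-- Division with the single exponent 0 solves H + H(g - 1) = 1, that is Hg = 1, where `g` is `f`
scaled to constant term 1. -/
theorem inv_mem_convRing {f : Series ℂ n} (hf : f ∈ convRing n)
    (h0 : MvPowerSeries.constantCoeff f ≠ 0) : f⁻¹ ∈ convRing n := by
  let g : Series ℂ n := MvPowerSeries.C (MvPowerSeries.constantCoeff f)⁻¹ * f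
  have hg : g ∈ convRing n := mul_mem (IsConvergent.const n _) hf
  obtain ⟨H, hH, h⟩ := exists_convergent_add_eq (G := {0}) (Δ := fun _ => Set.univ)
    (t := fun _ => g - 1) (F := 1) (by
      intro e he α hα
      rw [Finset.mem_singleton.1 he, size_zero]
      refine lt_of_le_of_ne (size_pos α) fun h => hα ?_
      have : α = 0 := size_injective (h.symm.trans size_zero.symm)
      rw [this, MvPowerSeries.coeff_zero_eq_constantCoeff_apply, map_sub, map_mul]
      simp [h0]) (fun _ _ => sub_mem hg (one_mem (convRing n))) (one_mem (convRing n))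
  have h1 : divisionMap {0} (fun _ => Set.univ) (fun _ => g - 1) H = H * (g - 1) := by
    rw [divisionMap_apply, Finset.sum_singleton]
    congr 1
    ext α
    rw [coeff_shift, coeff_seriesPart_of_mem (Set.mem_univ _), add_zero]
  rw [h1] at h
  have h2 : f⁻¹ = H * MvPowerSeries.C (MvPowerSeries.constantCoeff f)⁻¹ := by
    rw [eq_comm, MvPowerSeries.eq_inv_iff_mul_eq_one h0, mul_assoc]
    linear_combination h
  rw [h2]
  exact mul_mem hH (IsConvergent.const n _)

/-- The exponents of the smallest terms of the elements of an ideal. -/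
def leadExponents (I : Ideal (convRing n)) : Set (Fin n →₀ ℕ) :=
  {e | ∃ f ∈ I, MvPowerSeries.coeff e (f : Series ℂ n) = 1 ∧
    ∀ α, MvPowerSeries.coeff α (f : Series ℂ n) ≠ 0 → size e ≤ size α}

theorem exists_leadExponent {I : Ideal (convRing n)} {f : convRing n} (hf : f ∈ I) (h0 : f ≠ 0) :
    ∃ e ∈ leadExponents I, MvPowerSeries.coeff e (f : Series ℂ n) ≠ 0 := by
  have hne : {α | MvPowerSeries.coeff α (f : Series ℂ n) ≠ 0}.Nonempty := by
    by_contra h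
    refine h0 (Subtype.ext (MvPowerSeries.ext fun α => ?_))
    by_contra h'
    exact h ⟨α, h'⟩
  obtain ⟨e, he, hmin⟩ := exists_minimalFor_of_wellFoundedLT
    (fun α => MvPowerSeries.coeff α (f : Series ℂ n) ≠ 0) size hne
  refine ⟨e, ⟨⟨MvPowerSeries.C (MvPowerSeries.coeff e (f : Series ℂ n))⁻¹,
    IsConvergent.const n _⟩ * f, I.mul_mem_left _ hf, ?_, fun α hα => ?_⟩, he⟩
  · rw [MulMemClass.coe_mul, MvPowerSeries.coeff_C_mul, inv_mul_cancel₀ he]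
  · rw [MulMemClass.coe_mul, MvPowerSeries.coeff_C_mul] at hα
    rcases le_total (size e) (size α) with h | h
    · exact h
    · exact hmin (right_ne_zero_of_mul hα) h

/-- By Dickson's lemma finitely many leading exponents lie below all others. Dividing an element of
the ideal by elements with these leading exponents leaves a convergent remainder in the ideal with
no term divisible by any of them, so the remainder is zero. -/
theorem isNoetherianRing_convRing : IsNoetherianRing (convRing n) := by
  classical
  rw [isNoetherianRing_iff_ideal_fg]
  intro I
  have hfin : {e | Minimal (· ∈ leadExponents I) e}.Finite :=
    WellQuasiOrderedLE.finite_of_isAntichain (setOfPred_minimal_antichain _)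
  let G := hfin.toFinset
  have hG : ∀ e ∈ G, e ∈ leadExponents I := fun e he => (hfin.mem_toFinset.1 he).prop
  have hG' : ∀ e ∈ leadExponents I, ∃ g ∈ G, g ≤ e := by
    intro e he
    obtain ⟨g, hg, hg'⟩ := exists_minimal_le_of_wellFoundedLT (· ∈ leadExponents I) e he
    exact ⟨g, hfin.mem_toFinset.2 hg', hg⟩
  have hf : ∀ e, ∃ f ∈ I, e ∈ G → MvPowerSeries.coeff e (f : Series ℂ n) = 1 ∧
      ∀ α, MvPowerSeries.coeff α (f : Series ℂ n) ≠ 0 → size e ≤ size α := by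
    intro e
    by_cases he : e ∈ G
    · obtain ⟨f, hf, h⟩ := hG e he
      exact ⟨f, hf, fun _ => h⟩
    · exact ⟨0, zero_mem I, fun h => absurd h he⟩
  choose f hfI hf using hf
  have hpick : ∀ γ : Fin n →₀ ℕ, ∃ e, (∃ g ∈ G, g ≤ γ) → e ∈ G ∧ e ≤ γ := by
    intro γ
    by_cases h : ∃ g ∈ G, g ≤ γ
    · obtain ⟨g, h1, h2⟩ := h
      exact ⟨g, fun _ => ⟨h1, h2⟩⟩
    · exact ⟨0, fun h' => absurd h' h⟩
  choose pick hpick using hpick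
  -- Each monomial divisible by a leading one is assigned to exactly one divisor; any choice is
  -- admissible.
  let Δ : (Fin n →₀ ℕ) → Set (Fin n →₀ ℕ) := fun e => {γ | (∃ g ∈ G, g ≤ γ) ∧ pick γ = e}
  let t : (Fin n →₀ ℕ) → Series ℂ n := fun e => (f e : Series ℂ n) - MvPowerSeries.monomial e 1
  have ht : ∀ e ∈ G, ∀ α, MvPowerSeries.coeff α (t e) ≠ 0 → size e < size α := by
    intro e he α hα
    change MvPowerSeries.coeff α ((f e : Series ℂ n) - MvPowerSeries.monomial e 1) ≠ 0 at hα
    rw [map_sub, MvPowerSeries.coeff_monomial] at hα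
    split_ifs at hα with h
    · rw [h, (hf e he).1, sub_self] at hα
      exact absurd rfl hα
    · rw [sub_zero] at hα
      exact lt_of_le_of_ne ((hf e he).2 α hα) fun h' => h (size_injective h').symm
  refine ⟨G.image f, le_antisymm ?_ ?_⟩
  · rw [Submodule.span_le]
    intro x hx
    obtain ⟨e, -, rfl⟩ := Finset.mem_image.1 (Finset.mem_coe.1 hx)
    exact hfI e
  · intro F hF
    obtain ⟨H, hH, h⟩ := exists_convergent_add_eq (Δ := Δ) ht (fun e _ => sub_mem (f e).2
      (polyRing_le_convRing (mem_polyRing_of_finite ((Set.finite_singleton e).subset fun α hα => by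
        rw [Set.mem_ofPred_eq, MvPowerSeries.coeff_monomial] at hα
        exact (ite_ne_right_iff.1 hα).1)))) F.2
    let r : convRing n := ⟨seriesPart {γ | ¬ ∃ g ∈ G, g ≤ γ} H, hH.seriesPart _⟩
    let q : (Fin n →₀ ℕ) → convRing n := fun e =>
      ⟨shift e (seriesPart (Δ e) H), (hH.seriesPart _).shift e⟩
    have hsum : H = ∑ e ∈ G, seriesPart (Δ e) H + seriesPart {γ | ¬ ∃ g ∈ G, g ≤ γ} H := by
      ext γ
      rw [map_add, map_sum]
      by_cases hγ : ∃ g ∈ G, g ≤ γ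
      · rw [coeff_seriesPart_of_notMem (s := {γ | ¬ ∃ g ∈ G, g ≤ γ}) (not_not.2 hγ), add_zero,
          Finset.sum_eq_single (pick γ)]
        · exact (coeff_seriesPart_of_mem (s := Δ (pick γ)) ⟨hγ, rfl⟩ H).symm
        · exact fun e _ he => coeff_seriesPart_of_notMem (fun h => he h.2.symm) H
        · exact fun h => absurd (hpick γ hγ).1 h
      · rw [coeff_seriesPart_of_mem (s := {γ | ¬ ∃ g ∈ G, g ≤ γ}) hγ, Finset.sum_eq_zero, zero_add]
        exact fun e _ => coeff_seriesPart_of_notMem (fun h => hγ h.1) H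
    -- In F = H + ∑ q_e (f_e - x^e), splitting `H` as ∑ x^e q_e + r cancels the monomials x^e.
    have hFr : F = ∑ e ∈ G, q e * f e + r := by
      ext1
      rw [← h, AddMemClass.coe_add, AddSubmonoidClass.coe_finsetSum, divisionMap_apply]
      conv_lhs => rw [hsum, add_right_comm, ← hsum, ← Finset.sum_add_distrib]
      refine congrArg (· + (r : Series ℂ n)) (Finset.sum_congr rfl fun e _ => ?_)
      have h1 : MvPowerSeries.monomial e 1 * shift e (seriesPart (Δ e) H) = seriesPart (Δ e) H := by
        refine monomial_mul_shift fun γ hγ => ?_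
        obtain ⟨h2, h3⟩ := mem_of_coeff_seriesPart_ne_zero hγ
        exact h3 ▸ (hpick γ h2).2
      change _ + _ * ((f e : Series ℂ n) - MvPowerSeries.monomial e 1) =
        shift e (seriesPart (Δ e) H) * (f e : Series ℂ n)
      linear_combination -h1
    have hqI : ∑ e ∈ G, q e * f e ∈ I :=
      sum_mem fun e _ => I.mul_mem_left _ (hfI e)
    have hr : r = 0 := by
      by_contra h0
      have hrI : r ∈ I := by
        rw [← add_sub_cancel_left (∑ e ∈ G, q e * f e) r, ← hFr]
        exact sub_mem hF hqI
      obtain ⟨e, he, he'⟩ := exists_leadExponent hrI h0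
      exact mem_of_coeff_seriesPart_ne_zero he' (hG' e he)
    rw [hFr, hr, add_zero]
    exact sum_mem fun e he => Ideal.mul_mem_left _ _
      (Submodule.subset_span (Finset.mem_coe.2 (Finset.mem_image_of_mem f he)))

theorem isGood_convRing : IsGood (convRing n) where
  noetherian := isNoetherianRing_convRing
  poly_le := polyRing_le_convRing
  inv_mem _ := inv_mem_convRing
  mem_pow := mem_vanishing_pow
    (fun i => polyRing_le_convRing ⟨MvPolynomial.X i, MvPolynomial.coe_X i⟩)
    fun _ hf _ => (IsConvergent.seriesPart hf _).shift _
  part_mem _ _ _ _ hf := IsConvergent.seriesPart hf _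
  partials_mem i _ := partials_mem_convRing i

end Convergent

/-! ### Ideals generated by polynomial data -/

section Polynomial

variable {k : Type*} [Field k] {n : ℕ} {C : SeriesRing k n}

theorem fanU_extend_poly (hC : IsGood C) (h : polyRing k n ≤ C) (I : Ideal (polyRing k n)) :
    fanU (extend C I) = fanU (extend (formalRing k n) I) := by
  have h' : C ≤ formalRing k n := le_top
  rw [fanU_extend hC, extend_extend h h']

theorem fanW_extend_poly (hC : IsGood C) (h : polyRing k n ≤ C)
    (I : Ideal (diffOps (polyRing k n))) :
    fanW (extend (diffOps C) I) = fanW (extend (diffOps (formalRing k n)) I) := by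
  rw [fanW_extend hC, extend_extend (diffOps_mono h) fun P _ => mem_diffOps_formalRing P]

end Polynomial

end LocalGroebner

end

theorem mainTheorem10 (n : ℕ) (k : Type*) [Field k] :
    -- ideals of the algebraic, respectively analytic, local ring
    (∀ I : Ideal (localRing k n), fanU I = fanU (extend (formalRing k n) I)) ∧
    (∀ I : Ideal (convRing n), fanU I = fanU (extend (formalRing ℂ n) I)) ∧
    -- left ideals of differential operators
    (∀ I : Ideal (diffOps (localRing k n)), fanW I = fanW (extend (diffOps (formalRing k n)) I)) ∧
    (∀ I : Ideal (diffOps (convRing n)), fanW I = fanW (extend (diffOps (formalRing ℂ n)) I)) ∧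
    -- homogenized left ideals
    (∀ I : Ideal (diffOps (localRing k n)),
      fanH (homogenizeIdeal I) = fanH (homogenizeIdeal (extend (diffOps (formalRing k n)) I))) ∧
    (∀ I : Ideal (diffOps (convRing n)),
      fanH (homogenizeIdeal I) = fanH (homogenizeIdeal (extend (diffOps (formalRing ℂ n)) I))) ∧
    -- the local fan of a polynomial ideal, or of a left ideal of the Weyl algebra
    (∀ I : Ideal (polyRing k n), fanU (extend (localRing k n) I) = fanU (extend (formalRing k n) I)) ∧
    (∀ I : Ideal (polyRing ℂ n),
      fanU (extend (localRing ℂ n) I) = fanU (extend (convRing n) I) ∧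
      fanU (extend (convRing n) I) = fanU (extend (formalRing ℂ n) I)) ∧
    (∀ I : Ideal (diffOps (polyRing k n)),
      fanW (extend (diffOps (localRing k n)) I) = fanW (extend (diffOps (formalRing k n)) I)) ∧
    (∀ I : Ideal (diffOps (polyRing ℂ n)),
      fanW (extend (diffOps (localRing ℂ n)) I) = fanW (extend (diffOps (convRing n)) I) ∧
      fanW (extend (diffOps (convRing n)) I) = fanW (extend (diffOps (formalRing ℂ n)) I)) := by
  refine ⟨fanU_extend isGood_localRing, fanU_extend isGood_convRing,
    fanW_extend isGood_localRing, fanW_extend isGood_convRing,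
    fanH_homogenizeIdeal isGood_localRing, fanH_homogenizeIdeal isGood_convRing,
    fanU_extend_poly isGood_localRing polyRing_le_localRing,
    fun I => ⟨?_, fanU_extend_poly isGood_convRing polyRing_le_convRing I⟩,
    fanW_extend_poly isGood_localRing polyRing_le_localRing,
    fun I => ⟨?_, fanW_extend_poly isGood_convRing polyRing_le_convRing I⟩⟩
  -- The algebraic and the convergent extension are compared through the formal one.
  · rw [fanU_extend_poly isGood_localRing polyRing_le_localRing,
      fanU_extend_poly isGood_convRing polyRing_le_convRing]
  · rw [fanW_extend_poly isGood_localRing polyRing_le_localRing,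
      fanW_extend_poly isGood_convRing polyRing_le_convRing]
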